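/- Let $A\in\mathbb R^{n\times n}$, $B\in\mathbb R^{n\times m}$, $b\in\mathbb R^n$, $f:\mathbb R^n\times\mathbb R^m\to\mathbb R$. For $T>0$ and $x\in\mathbb R^n$ consider the problem of minimizing $$J_T(x;u)=\int_0^T f(X(t),u(t))\,dt\in(-\infty,+\infty]\quad\text{over } u\in L^2(0,T;\mathbb R^m),\qquad \dot X=AX+Bu+b \text{ on }[0,T],\quad X(0)=x .$$ Assume: (A1) $b\in\operatorname{im}(A,B)=\operatorname{im}A+\operatorname{im}B$; (A2) $f\in C^2(\mathbb R^n\times\mathbb R^m)$ and there is $\delta>0$ with $\nabla^2 f(x,u)\ge\delta I_{n+m}$ for all $(x,u)$. Let $\mathscr C=\operatorname{im}(B,AB,\dots,A^{n-1}B)$ be the controllable subspace, $k=\dim\mathscr C$, let $P_2\in\mathbb R^{n\times(n-k)}$ have as columns an orthonormal basis of $\mathscr C^\perp$, and put $A_{22}=P_2^\top AP_2$. Let $c\in\mathbb R^{n-k}$ be any vector with $A_{22}c=P_2^\top b$ (such a $c$ exists by (A1)). Let $$\mathscr G_1=\Big(\bigoplus_{\mu\in\sigma(A_{22}),\ \operatorname{Re}\mu<0}G(\mu,A_{22})\Big)\cap\mathbb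 R^{n-k},\qquad \mathscr G_2=\ker A_{22}\subseteq\mathbb R^{n-k},$$ where $G(\mu,A_{22})\subseteq\mathbb C^{n-k}$ is the generalized eigenspace; the sum $\mathscr G_1\oplus\mathscr G_2$ is direct, and $Q_2:\mathscr G_1\oplus\mathscr G_2\to\mathscr G_2$ denotes the corresponding projection. The set of feasible initial states is $\mathscr X=\{x\in\mathbb R^n: P_2^\top x+c\in\mathscr G_1\oplus\mathscr G_2\}$. For $x\in\mathscr X$, Problem (O) is to minimize $f$ over $$\mathscr V_x=\{(z,u)\in\mathbb R^n\times\mathbb R^m:\ Az+Bu+b=0,\ P_2^\top z+c=Q_2(P_2^\top x+c)\}.$$ Theorem. Let $x\in\mathscr X$. Then Problem (O) has a unique solution $(x^*,u^*)$, for every $T>0$ the optimal control problem with initial state $x$ has a unique optimal pair $(\bar X_T,\bar u_T)$ (with $\bar u_T$ unique almost everywhere on $[0,T]$), and there are constants $K,\lambda>0$, independent of $T$ (but possibly depending on $x$), such that for every $T>0$ $$|\bar X_T(t)-x^*|\le K\big[e^{-\lambda t}+e^{-\lambda(T-t)}\big],\qquad 0\le t\le T .$$ -/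

import Mathlib

open MeasureTheory Set

noncomputable section

namespace Turnpike

/-- Euclidean space `ℝⁿ` of column vectors. -/
abbrev E (n : ℕ) : Type := EuclideanSpace ℝ (Fin n)

/-- The linear map `x ↦ M x` between Euclidean spaces given by a real matrix. -/
abbrev lin {p q : ℕ} (M : Matrix (Fin p) (Fin q) ℝ) : E q →ₗ[ℝ] E p :=
  Matrix.toEuclideanLin M

/-! ### The finite-horizon optimal control problem -/

section Control

variable {n m : ℕ}

/-- `X` is the state trajectory on `[0,T]` of `X' = A X + B u + b`, `X 0 = x`, i.e. the
(absolutely) continuous solution of the equivalent integral equation. -/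
def IsTrajectory (A : Matrix (Fin n) (Fin n) ℝ) (B : Matrix (Fin n) (Fin m) ℝ) (b : E n)
    (T : ℝ) (x : E n) (X : ℝ → E n) (u : ℝ → E m) : Prop :=
  ContinuousOn X (Icc 0 T) ∧
    ∀ t ∈ Icc (0 : ℝ) T, X t = x + ∫ s in (0 : ℝ)..t, (lin A (X s) + lin B (u s) + b)

/-- State-control pairs: `u ∈ L²(0,T;ℝᵐ)` and `X` is the trajectory of `u` starting at `x`. -/
def IsAdmissible (A : Matrix (Fin n) (Fin n) ℝ) (B : Matrix (Fin n) (Fin m) ℝ) (b : E n)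
    (T : ℝ) (x : E n) (X : ℝ → E n) (u : ℝ → E m) : Prop :=
  MemLp u 2 (volume.restrict (Icc 0 T)) ∧ IsTrajectory A B b T x X u

/-- The cost `∫₀ᵀ f(X(t),u(t)) dt` as an extended real number: the integral of the positive part
minus that of the negative part. (The latter is finite when `f` is bounded below.) -/
def cost (f : E n × E m → ℝ) (T : ℝ) (X : ℝ → E n) (u : ℝ → E m) : EReal :=
  ((∫⁻ t in Icc 0 T, ENNReal.ofReal (f (X t, u t)) : ENNReal) : EReal) -
    ((∫⁻ t in Icc 0 T, ENNReal.ofReal (-f (X t, u t)) : ENNReal) : EReal)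

/-- The value function `V_T(x)`. -/
def value (A : Matrix (Fin n) (Fin n) ℝ) (B : Matrix (Fin n) (Fin m) ℝ) (b : E n)
    (f : E n × E m → ℝ) (T : ℝ) (x : E n) : EReal :=
  sInf {r | ∃ X u, IsAdmissible A B b T x X u ∧ cost f T X u = r}

/-- `(X, u)` is an optimal pair for the horizon `T` and the initial state `x`. -/
def IsOptimalPair (A : Matrix (Fin n) (Fin n) ℝ) (B : Matrix (Fin n) (Fin m) ℝ) (b : E n)
    (f : E n × E m → ℝ) (T : ℝ) (x : E n) (X : ℝ → E n) (u : ℝ → E m) : Prop :=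
  IsAdmissible A B b T x X u ∧ cost f T X u = value A B b f T x

/-- `f` is `C²` and strongly convex: `∇²f ≥ δ I` everywhere for some `δ > 0`. -/
def IsC2StronglyConvex (f : E n × E m → ℝ) : Prop :=
  ContDiff ℝ 2 f ∧ ∃ δ : ℝ, 0 < δ ∧ ∀ p h : E n × E m,
    δ * (‖h.1‖ ^ 2 + ‖h.2‖ ^ 2) ≤ fderiv ℝ (fderiv ℝ f) p h h

end Control

/-! ### The uncontrollable block, feasible initial states and the static problem -/

section Static

variable {n m l : ℕ}

/-- The controllable subspace `im (B, AB, …, Aⁿ⁻¹B)`. -/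
def controllable (A : Matrix (Fin n) (Fin n) ℝ) (B : Matrix (Fin n) (Fin m) ℝ) :
    Submodule ℝ (E n) :=
  ⨆ j : Fin n, LinearMap.range (lin (A ^ (j : ℕ) * B))

/-- The matrix whose columns are the vectors of an orthonormal basis of a subspace. -/
def colMatrix {S : Submodule ℝ (E n)} (v : OrthonormalBasis (Fin l) ℝ S) :
    Matrix (Fin n) (Fin l) ℝ :=
  Matrix.of fun i j => (v j : E n) i

/-- The block `A₂₂ = P₂ᵀ A P₂`. -/
def block (A : Matrix (Fin n) (Fin n) ℝ) (P₂ : Matrix (Fin n) (Fin l) ℝ) :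
    Matrix (Fin l) (Fin l) ℝ :=
  P₂.transpose * A * P₂

/-- The direct sum of the complex generalized eigenspaces of a real matrix `M` for the
eigenvalues with negative real part. -/
def stableComplex (M : Matrix (Fin l) (Fin l) ℝ) : Submodule ℂ (Fin l → ℂ) :=
  ⨆ μ ∈ {μ : ℂ | μ ∈ spectrum ℂ (M.map ((↑) : ℝ → ℂ)) ∧ μ.re < 0},
    Module.End.maxGenEigenspace (Matrix.toLin' (M.map ((↑) : ℝ → ℂ))) μ

/-- `𝒢₁`: the real vectors in the sum of the stable generalized eigenspaces. -/
def G₁ (M : Matrix (Fin l) (Fin l) ℝ) : Submodule ℝ (E l) where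
  carrier := {y | (fun i => (y i : ℂ)) ∈ stableComplex M}
  zero_mem' := by
    have h : (fun i => (((0 : E l) i : ℝ) : ℂ)) = 0 := by ext i; simp
    simp only [mem_ofPred_eq, h, Submodule.zero_mem]
  add_mem' := by
    intro y z hy hz
    have h : (fun i => (((y + z) i : ℝ) : ℂ)) = (fun i => (y i : ℂ)) + fun i => (z i : ℂ) := by
      ext i; simp
    simp only [mem_ofPred_eq, h]
    exact Submodule.add_mem _ hy hz
  smul_mem' := by
    intro r y hy
    have h : (fun i => (((r • y) i : ℝ) : ℂ)) = (r : ℂ) • fun i => (y i : ℂ) := by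
      ext i; simp
    simp only [mem_ofPred_eq, h]
    exact Submodule.smul_mem _ _ hy

/-- `𝒢₂ = ker M`. -/
def G₂ (M : Matrix (Fin l) (Fin l) ℝ) : Submodule ℝ (E l) := LinearMap.ker (lin M)

/-- The sum `𝒢₁ + 𝒢₂` is direct. -/
theorem disjoint_G (M : Matrix (Fin l) (Fin l) ℝ) : Disjoint (G₁ M) (G₂ M) := by
  rw [Submodule.disjoint_def]
  intro y hy₁ hy₂
  set φ := Matrix.toLin' (M.map ((↑) : ℝ → ℂ)) with hφ
  set w : Fin l → ℂ := fun i => (y i : ℂ) with hw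
  have h0 : w ∈ Module.End.maxGenEigenspace φ 0 := by
    apply Module.End.eigenspace_le_maxGenEigenspace
    rw [Module.End.mem_eigenspace_iff, zero_smul, hφ, Matrix.toLin'_apply]
    have hy : M.mulVec y.ofLp = 0 := by
      have := congrArg WithLp.ofLp (LinearMap.mem_ker.1 hy₂)
      simpa using this
    ext i
    have hi := congrFun hy i
    simp only [Matrix.mulVec, dotProduct, Pi.zero_apply, Matrix.map_apply, hw] at hi ⊢
    exact_mod_cast hi
  have h1 : w ∈ ⨆ μ : ℂ, ⨆ _ : μ ≠ 0, Module.End.maxGenEigenspace φ μ := by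
    refine (iSup₂_le fun μ hμ => ?_ : stableComplex M ≤ _) hy₁
    refine le_iSup₂_of_le μ ?_ le_rfl
    rintro rfl
    exact absurd hμ.2 (by simp)
  have hw0 : w = 0 :=
    Submodule.disjoint_def.1 (Module.End.independent_maxGenEigenspace φ 0) w h0 h1
  ext i
  have := congrFun hw0 i
  simpa [hw] using this

/-- The isomorphism `𝒢₁ × 𝒢₂ ≃ 𝒢₁ ⊕ 𝒢₂`, `(y₁, y₂) ↦ y₁ + y₂`. -/
def splitEquiv (M : Matrix (Fin l) (Fin l) ℝ) : (G₁ M × G₂ M) ≃ₗ[ℝ] ↥(G₁ M ⊔ G₂ M) :=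
  (LinearEquiv.ofInjective ((G₁ M).subtype.coprod (G₂ M).subtype) (by
    rw [← LinearMap.ker_eq_bot, LinearMap.ker_coprod_of_disjoint_range _ _
      (by simpa using disjoint_G M)]
    simp)).trans (LinearEquiv.ofEq _ _ (Submodule.sup_eq_range _ _).symm)

/-- `Q₂ : 𝒢₁ ⊕ 𝒢₂ → 𝒢₂`, the projection onto `𝒢₂` along `𝒢₁`. -/
def Q₂ (M : Matrix (Fin l) (Fin l) ℝ) : ↥(G₁ M ⊔ G₂ M) →ₗ[ℝ] G₂ M :=
  (LinearMap.snd ℝ (G₁ M) (G₂ M)).comp (splitEquiv M).symm.toLinearMap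

/-- The set `𝒳` of feasible initial states. -/
def feasible (A : Matrix (Fin n) (Fin n) ℝ) (P₂ : Matrix (Fin n) (Fin l) ℝ) (c : E l) :
    Set (E n) :=
  {x | lin P₂.transpose x + c ∈ G₁ (block A P₂) ⊔ G₂ (block A P₂)}

/-- The constraint set `𝒱ₓ` of the static problem attached to a feasible initial state `x`. -/
def steadySet (A : Matrix (Fin n) (Fin n) ℝ) (B : Matrix (Fin n) (Fin m) ℝ) (b : E n)
    (P₂ : Matrix (Fin n) (Fin l) ℝ) (c : E l) (x : E n) (hx : x ∈ feasible A P₂ c) :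
    Set (E n × E m) :=
  {p | lin A p.1 + lin B p.2 + b = 0 ∧
    lin P₂.transpose p.1 + c = (Q₂ (block A P₂) ⟨lin P₂.transpose x + c, hx⟩ : E l)}

/-- `p = (x*, u*)` solves Problem (O): it minimizes `f` over `𝒱ₓ`. -/
def IsStaticSolution (A : Matrix (Fin n) (Fin n) ℝ) (B : Matrix (Fin n) (Fin m) ℝ) (b : E n)
    (f : E n × E m → ℝ) (P₂ : Matrix (Fin n) (Fin l) ℝ) (c : E l) (x : E n)
    (hx : x ∈ feasible A P₂ c) (p : E n × E m) : Prop :=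
  p ∈ steadySet A B b P₂ c x hx ∧ ∀ q ∈ steadySet A B b P₂ c x hx, f p ≤ f q

end Static

end Turnpike

end

namespace Turnpike

/-! ### Second-order Taylor bounds -/

section Convexity

/-! Subtract the static optimum `p = (x*, u*)`: the deviation `(ξ, w)` solves `ξ' = Aξ + Bw`. Its
uncontrolled part `π ξ = P₂ᵀ ξ` is a fixed curve `y` with `y' = A₂₂ y`, and the constraint built
from `Q₂` puts `y 0` in `𝒢₁`, so `y` decays exponentially (`sub_Q₂_mem_G₁`,
`exists_decaying_solution`).

Lagrange multipliers for the static problem (`IsStaticSolution.exists_multipliers`) write the linear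
part of `f` at `p` as `η(Aξ + Bw) + ν(π ξ)`. Along a trajectory the first term integrates to a
boundary term and the second depends on `y` only. Hence, for fixed end points, minimizing `∫ f` is
the same as minimizing `∫ g`, where the Taylor remainder `g` dominates a multiple of `|ξ|² + |w|²`
and is bounded by such a multiple on balls (`IsRotatedCost`).

Two states compatible with `y` can be joined in unit time at a cost linear in their norms
(`exists_steering`, by the Hamiltonian flow of the minimum energy problem). Chaining such arcs
through small lifts of `y` connects any two times with energy controlled by the squared end states
and a geometric tail (`exists_connecting_solution`).

Comparison with these arcs first bounds the energy of a minimizer independently of `T`. For the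
energy `S k` on `[k, N - k]` it then gives `S (k+1) ≤ Q (S k - S (k+1) + q^(k+1))`, since the states
at the ends of the inner interval are bounded by the energy of the two removed unit intervals. This
hole-filling recurrence forces geometric decay (`geometric_decay_of_recurrence`), and energy on a
unit interval controls the state pointwise.

Existence and uniqueness of optimal pairs rest on the quantitative midpoint convexity of `f`:
minimizing sequences are Cauchy in `L²` (`exists_isMin`, `IsMin.unique`). -/

theorem second_order_lower_bound_real {φ φ' φ'' : ℝ → ℝ} {m : ℝ}
    (h1 : ∀ t, HasDerivAt φ (φ' t) t) (h2 : ∀ t, HasDerivAt φ' (φ'' t) t)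
    (hm : ∀ t ∈ Icc (0 : ℝ) 1, m ≤ φ'' t) : φ 0 + φ' 0 + m / 2 ≤ φ 1 := by
  have d1 : ∀ t, HasDerivAt (fun t => φ' t - m * t) (φ'' t - m) t := fun t => by
    simpa using (h2 t).fun_sub ((hasDerivAt_id' t).const_mul m)
  have m1 : MonotoneOn (fun t => φ' t - m * t) (Icc 0 1) := by
    refine monotoneOn_of_deriv_nonneg (convex_Icc 0 1)
      (fun t _ => (d1 t).continuousAt.continuousWithinAt)
      (fun t _ => (d1 t).differentiableAt.differentiableWithinAt) fun t ht => ?_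
    rw [(d1 t).deriv]
    linarith [hm t (interior_subset ht)]
  have d2 : ∀ t, HasDerivAt (fun t => φ t - φ' 0 * t - m / 2 * t ^ 2)
      (φ' t - φ' 0 - m * t) t := fun t => by
    refine (((h1 t).fun_sub ((hasDerivAt_id' t).const_mul (φ' 0))).fun_sub
      ((hasDerivAt_pow 2 t).const_mul (m / 2))).congr_deriv ?_
    simp only [Nat.cast_ofNat, Nat.add_one_sub_one, pow_one, mul_one]
    ring
  have m2 : MonotoneOn (fun t => φ t - φ' 0 * t - m / 2 * t ^ 2) (Icc 0 1) := by
    refine monotoneOn_of_deriv_nonneg (convex_Icc 0 1)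
      (fun t _ => (d2 t).continuousAt.continuousWithinAt)
      (fun t _ => (d2 t).differentiableAt.differentiableWithinAt) fun t ht => ?_
    rw [(d2 t).deriv]
    have ht' := interior_subset ht
    have := m1 (left_mem_Icc.2 zero_le_one) ht' ht'.1
    simp only at this
    linarith
  have := m2 (left_mem_Icc.2 zero_le_one) (right_mem_Icc.2 zero_le_one) zero_le_one
  simp only at this
  linarith

variable {P : Type*} [NormedAddCommGroup P] [NormedSpace ℝ P]

theorem second_order_lower_bound {f : P → ℝ} (hf : ContDiff ℝ 2 f) {p h : P} {m : ℝ}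
    (hm : ∀ t ∈ Icc (0 : ℝ) 1, m ≤ fderiv ℝ (fderiv ℝ f) (p + t • h) h h) :
    f p + fderiv ℝ f p h + m / 2 ≤ f (p + h) := by
  have hl : ∀ t : ℝ, HasDerivAt (fun t : ℝ => p + t • h) h t := fun t => by
    simpa using ((hasDerivAt_id t).smul_const h).const_add p
  have hf' : ContDiff ℝ 1 (fderiv ℝ f) := hf.fderiv_right (by norm_num)
  have h1 : ∀ t : ℝ, HasDerivAt (fun t : ℝ => f (p + t • h)) (fderiv ℝ f (p + t • h) h) t :=
    fun t => ((hf.differentiable (by norm_num)).differentiableAt.hasFDerivAt).comp_hasDerivAt t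
      (hl t)
  have h2 : ∀ t : ℝ, HasDerivAt (fun t : ℝ => fderiv ℝ f (p + t • h) h)
      (fderiv ℝ (fderiv ℝ f) (p + t • h) h h) t := fun t => by
    have := ((hf'.differentiable (by norm_num)).differentiableAt.hasFDerivAt).comp_hasDerivAt t
      (hl t)
    exact (ContinuousLinearMap.apply ℝ ℝ h).hasFDerivAt.comp_hasDerivAt t this
  have := second_order_lower_bound_real h1 h2 hm
  simpa using this

theorem second_order_upper_bound {f : P → ℝ} (hf : ContDiff ℝ 2 f) {p h : P} {m : ℝ}
    (hm : ∀ t ∈ Icc (0 : ℝ) 1, fderiv ℝ (fderiv ℝ f) (p + t • h) h h ≤ m) :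
    f (p + h) ≤ f p + fderiv ℝ f p h + m / 2 := by
  have e1 : fderiv ℝ (fun q => -f q) = fun q => -fderiv ℝ f q := by
    ext1 q; exact fderiv_fun_neg
  have := second_order_lower_bound hf.neg (p := p) (h := h) (m := -m) fun t ht => by
    rw [e1, fderiv_fun_neg]
    simpa using hm t ht
  rw [e1] at this
  simp only [neg_apply] at this
  linarith

theorem exists_quadratic_upper_bound [FiniteDimensional ℝ P] {f : P → ℝ} (hf : ContDiff ℝ 2 f)
    (p : P) (R : ℝ) :
    ∃ C, 0 ≤ C ∧ ∀ h, ‖h‖ ≤ R → f (p + h) - f p - fderiv ℝ f p h ≤ C * ‖h‖ ^ 2 := by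
  have hc : Continuous fun q => ‖fderiv ℝ (fderiv ℝ f) q‖ :=
    ((hf.fderiv_right (m := 1) (by norm_num)).continuous_fderiv (by norm_num)).norm
  obtain ⟨C, hC⟩ := (isCompact_closedBall p R).bddAbove_image hc.continuousOn
  -- The absolute value is needed because the ball is empty when `R < 0`, and then `C` may be
  -- negative.
  refine ⟨|C|, abs_nonneg C, fun h hR => ?_⟩
  have := second_order_upper_bound hf (p := p) (h := h) (m := |C| * ‖h‖ ^ 2) fun t ht => by
    have h1 : ‖fderiv ℝ (fderiv ℝ f) (p + t • h)‖ ≤ C := by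
      refine hC ⟨p + t • h, ?_, rfl⟩
      rw [mem_closedBall_iff_norm, add_sub_cancel_left, norm_smul, Real.norm_of_nonneg ht.1]
      nlinarith [norm_nonneg h, ht.2]
    calc fderiv ℝ (fderiv ℝ f) (p + t • h) h h ≤ ‖fderiv ℝ (fderiv ℝ f) (p + t • h) h h‖ :=
          Real.le_norm_self _
      _ ≤ ‖fderiv ℝ (fderiv ℝ f) (p + t • h)‖ * ‖h‖ * ‖h‖ :=
          ContinuousLinearMap.le_opNorm₂ _ _ _
      _ ≤ |C| * ‖h‖ * ‖h‖ := by gcongr; exact h1.trans (le_abs_self C)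
      _ = |C| * ‖h‖ ^ 2 := by ring
  have h0 : 0 ≤ |C| * ‖h‖ ^ 2 := by positivity
  linarith

end Convexity

/-! ### Consequences of strong convexity -/

section StronglyConvex

variable {V W : Type*} [NormedAddCommGroup V] [NormedAddCommGroup W]

/-- The squared Euclidean norm on a product. -/
def sqNorm (p : V × W) : ℝ := ‖p.1‖ ^ 2 + ‖p.2‖ ^ 2

theorem sqNorm_nonneg (p : V × W) : 0 ≤ sqNorm p := by unfold sqNorm; positivity

theorem sq_norm_le_sqNorm (p : V × W) : ‖p‖ ^ 2 ≤ sqNorm p := by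
  unfold sqNorm
  rcases max_choice ‖p.1‖ ‖p.2‖ with h | h <;> rw [Prod.norm_def, h] <;>
    nlinarith [sq_nonneg ‖p.1‖, sq_nonneg ‖p.2‖]

theorem sqNorm_eq_zero {p : V × W} (h : sqNorm p ≤ 0) : p = 0 := by
  have := sq_norm_le_sqNorm p
  have h0 : ‖p‖ = 0 := by nlinarith [norm_nonneg p]
  exact norm_eq_zero.1 h0

theorem sqNorm_neg (p : V × W) : sqNorm (-p) = sqNorm p := by simp [sqNorm]

variable [NormedSpace ℝ V] [NormedSpace ℝ W]

theorem sqNorm_smul (r : ℝ) (p : V × W) : sqNorm (r • p) = r ^ 2 * sqNorm p := by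
  simp only [sqNorm, Prod.smul_fst, Prod.smul_snd, norm_smul, mul_pow, Real.norm_eq_abs, sq_abs]
  ring

variable {f : V × W → ℝ} {δ : ℝ}

theorem strongConvex_lower (hf : ContDiff ℝ 2 f)
    (hδ : ∀ p h, δ * sqNorm h ≤ fderiv ℝ (fderiv ℝ f) p h h) (p h : V × W) :
    f p + fderiv ℝ f p h + δ / 2 * sqNorm h ≤ f (p + h) := by
  have := second_order_lower_bound hf (p := p) (h := h) fun t _ => hδ (p + t • h) h
  linarith

/-- Expand at the midpoint in the directions `±(p - q)/2`: the gradient terms cancel on averaging,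
and `δ/2 · 1/4 = δ/8`. The gain is what yields uniqueness and Cauchy minimizing sequences. -/
theorem strongConvex_midpoint (hf : ContDiff ℝ 2 f)
    (hδ : ∀ p h, δ * sqNorm h ≤ fderiv ℝ (fderiv ℝ f) p h h) (p q : V × W) :
    f ((1 / 2 : ℝ) • (p + q)) + δ / 8 * sqNorm (p - q) ≤ (f p + f q) / 2 := by
  have h1 := strongConvex_lower hf hδ ((1 / 2 : ℝ) • (p + q)) ((1 / 2 : ℝ) • (p - q))
  have h2 := strongConvex_lower hf hδ ((1 / 2 : ℝ) • (p + q)) (-((1 / 2 : ℝ) • (p - q)))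
  have e1 : (1 / 2 : ℝ) • (p + q) + (1 / 2 : ℝ) • (p - q) = p := by module
  have e2 : (1 / 2 : ℝ) • (p + q) + -((1 / 2 : ℝ) • (p - q)) = q := by module
  rw [e1] at h1
  rw [e2, map_neg, sqNorm_neg] at h2
  rw [sqNorm_smul] at h1 h2
  linarith

theorem strongConvex_coercive (hf : ContDiff ℝ 2 f) (hδ0 : 0 < δ)
    (hδ : ∀ p h, δ * sqNorm h ≤ fderiv ℝ (fderiv ℝ f) p h h) :
    ∃ M, 0 ≤ M ∧ ∀ p, δ / 4 * sqNorm p - M ≤ f p := by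
  set L := ‖fderiv ℝ f 0‖
  refine ⟨|f 0| + L ^ 2 / δ, by positivity, fun p => ?_⟩
  have h1 := strongConvex_lower hf hδ 0 p
  rw [zero_add] at h1
  have h2 : -(L * ‖p‖) ≤ fderiv ℝ f 0 p :=
    (neg_le_neg ((fderiv ℝ f 0).le_opNorm p)).trans (neg_le_of_abs_le le_rfl)
  have h3 := sq_norm_le_sqNorm p
  -- Young's inequality: half of the quadratic growth `δ/2` absorbs the linear term.
  have h4 : L * ‖p‖ ≤ δ / 4 * ‖p‖ ^ 2 + L ^ 2 / δ := by
    have : 0 ≤ (δ / 2 * ‖p‖ - L) ^ 2 / δ := by positivity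
    have e : (δ / 2 * ‖p‖ - L) ^ 2 / δ = δ / 4 * ‖p‖ ^ 2 + L ^ 2 / δ - L * ‖p‖ := by
      field_simp; ring
    linarith
  have h5 := neg_abs_le (f 0)
  nlinarith

end StronglyConvex

/-! ### Integral inequalities on intervals -/

section Integrals

theorem _root_.MeasureTheory.IntegrableOn.intervalIntegrable_of_mem {V : Type*}
    [NormedAddCommGroup V] {h : ℝ → V} {a c s t : ℝ} (hi : IntegrableOn h (Icc a c))
    (hs : s ∈ Icc a c) (ht : t ∈ Icc a c) : IntervalIntegrable h volume s t :=
  (hi.mono_set (uIcc_subset_Icc hs ht)).intervalIntegrable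

theorem integral_mono_subinterval {h : ℝ → ℝ} {a c s t : ℝ} (hi : IntegrableOn h (Icc a c))
    (h0 : ∀ r, 0 ≤ h r) (hs : a ≤ s) (hst : s ≤ t) (ht : t ≤ c) :
    ∫ r in s..t, h r ≤ ∫ r in a..c, h r :=
  intervalIntegral.integral_mono_interval hs hst ht (Filter.Eventually.of_forall h0)
    (hi.intervalIntegrable_of_mem ⟨le_rfl, by linarith⟩ ⟨by linarith, le_rfl⟩)

theorem memLp_Icc_of_continuousOn {V : Type*} [NormedAddCommGroup V] {ξ : ℝ → V} {a c : ℝ}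
    (h : ContinuousOn ξ (Icc a c)) (q : ENNReal) : MemLp ξ q (volume.restrict (Icc a c)) := by
  obtain ⟨M, hM⟩ := isCompact_Icc.exists_bound_of_continuousOn h
  exact MemLp.of_bound (h.aestronglyMeasurable measurableSet_Icc) M
    ((ae_restrict_iff' measurableSet_Icc).2 (Filter.Eventually.of_forall hM))

/-- Cauchy–Schwarz against the constant 1, read off from `∫ (L h - I)² ≥ 0`, with `L` the length of
the interval and `I` the integral of `h`. -/
theorem sq_integral_le {h : ℝ → ℝ} {a c : ℝ} (hac : a ≤ c) (h1 : IntervalIntegrable h volume a c)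
    (h2 : IntervalIntegrable (fun t => h t ^ 2) volume a c) :
    (∫ t in a..c, h t) ^ 2 ≤ (c - a) * ∫ t in a..c, h t ^ 2 := by
  rcases hac.eq_or_lt with rfl | hlt
  · simp
  set I := ∫ t in a..c, h t
  set L := c - a
  have hL : 0 < L := sub_pos.2 hlt
  have h0 : 0 ≤ ∫ t in a..c, (L * h t - I) ^ 2 :=
    intervalIntegral.integral_nonneg hac fun t _ => sq_nonneg _
  have e : ∫ t in a..c, (L * h t - I) ^ 2 =
      L ^ 2 * (∫ t in a..c, h t ^ 2) - 2 * L * I * I + L * I ^ 2 := by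
    have : (fun t => (L * h t - I) ^ 2) =
        fun t => L ^ 2 * h t ^ 2 - 2 * L * I * h t + I ^ 2 := by ext t; ring
    rw [this, intervalIntegral.integral_add ((h2.const_mul _).sub (h1.const_mul _))
      intervalIntegrable_const, intervalIntegral.integral_sub (h2.const_mul _) (h1.const_mul _),
      intervalIntegral.integral_const_mul, intervalIntegral.integral_const_mul,
      intervalIntegral.integral_const, smul_eq_mul]
  rw [e] at h0
  nlinarith

end Integrals

/-! ### Trajectories of the linear control system -/

section Solutions

variable {V W : Type*} [NormedAddCommGroup V] [NormedAddCommGroup W]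

variable {a b c : ℝ} {ξ ξ' : ℝ → V} {w w' : ℝ → W}

theorem integrableOn_sqNorm (hξ : MemLp ξ 2 (volume.restrict (Icc a c)))
    (hw : MemLp w 2 (volume.restrict (Icc a c))) :
    IntegrableOn (fun t => sqNorm (ξ t, w t)) (Icc a c) :=
  (hξ.integrable_norm_pow (p := 2) (by norm_num)).add
    (hw.integrable_norm_pow (p := 2) (by norm_num))

variable [NormedSpace ℝ V] [NormedSpace ℝ W]

/-- `ξ` solves `ξ' = A ξ + B w` on `[a, c]` with a square integrable control `w`. -/
structure IsSol (A : V →L[ℝ] V) (B : W →L[ℝ] V) (a c : ℝ) (ξ : ℝ → V) (w : ℝ → W) : Prop where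
  memLp : MemLp w 2 (volume.restrict (Icc a c))
  cont : ContinuousOn ξ (Icc a c)
  eq : ∀ t ∈ Icc a c, ξ t = ξ a + ∫ s in a..t, (A (ξ s) + B (w s))

variable {A : V →L[ℝ] V} {B : W →L[ℝ] V}

theorem memLp_rhs (A : V →L[ℝ] V) (B : W →L[ℝ] V) (hξ : MemLp ξ 2 (volume.restrict (Icc a c)))
    (hw : MemLp w 2 (volume.restrict (Icc a c))) :
    MemLp (fun t => A (ξ t) + B (w t)) 2 (volume.restrict (Icc a c)) :=
  (A.comp_memLp' hξ).add (B.comp_memLp' hw)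

theorem integrableOn_rhs (A : V →L[ℝ] V) (B : W →L[ℝ] V)
    (hξ : MemLp ξ 2 (volume.restrict (Icc a c))) (hw : MemLp w 2 (volume.restrict (Icc a c))) :
    IntegrableOn (fun t => A (ξ t) + B (w t)) (Icc a c) :=
  (memLp_rhs A B hξ hw).integrable (by norm_num)

theorem sq_norm_rhs_le (A : V →L[ℝ] V) (B : W →L[ℝ] V) (x : V) (y : W) :
    ‖A x + B y‖ ^ 2 ≤ 2 * (‖A‖ ^ 2 + ‖B‖ ^ 2) * sqNorm (x, y) := by
  have h1 : ‖A x + B y‖ ≤ ‖A‖ * ‖x‖ + ‖B‖ * ‖y‖ :=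
    (norm_add_le _ _).trans (add_le_add (A.le_opNorm x) (B.le_opNorm y))
  have h2 : ‖A x + B y‖ ^ 2 ≤ (‖A‖ * ‖x‖ + ‖B‖ * ‖y‖) ^ 2 := by gcongr
  simp only [sqNorm]
  nlinarith [sq_nonneg (‖A‖ * ‖x‖ - ‖B‖ * ‖y‖), sq_nonneg (‖A‖ * ‖y‖), sq_nonneg (‖B‖ * ‖x‖)]

theorem sq_norm_integral_rhs_le (A : V →L[ℝ] V) (B : W →L[ℝ] V)
    (hξ : MemLp ξ 2 (volume.restrict (Icc a c))) (hw : MemLp w 2 (volume.restrict (Icc a c)))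
    {s t : ℝ} (hs : a ≤ s) (hst : s ≤ t) (ht : t ≤ c) :
    ‖∫ r in s..t, (A (ξ r) + B (w r))‖ ^ 2 ≤
      (c - a) * (2 * (‖A‖ ^ 2 + ‖B‖ ^ 2)) * ∫ r in a..c, sqNorm (ξ r, w r) := by
  have ms : s ∈ Icc a c := ⟨hs, by linarith⟩
  have mt : t ∈ Icc a c := ⟨by linarith, ht⟩
  have hi := (memLp_rhs A B hξ hw).integrable_norm_pow (p := 2) (by norm_num)
  have hn := (integrableOn_rhs A B hξ hw).norm
  have he := integrableOn_sqNorm hξ hw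
  calc ‖∫ r in s..t, (A (ξ r) + B (w r))‖ ^ 2
      ≤ (∫ r in s..t, ‖A (ξ r) + B (w r)‖) ^ 2 := by
        gcongr; exact intervalIntegral.norm_integral_le_integral_norm hst
    _ ≤ (t - s) * ∫ r in s..t, ‖A (ξ r) + B (w r)‖ ^ 2 :=
        sq_integral_le hst (IntegrableOn.intervalIntegrable_of_mem hn ms mt)
          (IntegrableOn.intervalIntegrable_of_mem hi ms mt)
    _ ≤ (c - a) * ∫ r in a..c, ‖A (ξ r) + B (w r)‖ ^ 2 := by
        gcongr
        · exact intervalIntegral.integral_nonneg hst fun r _ => sq_nonneg _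
        · linarith
        · exact integral_mono_subinterval hi (fun r => sq_nonneg _) hs hst ht
    _ ≤ (c - a) * ∫ r in a..c, 2 * (‖A‖ ^ 2 + ‖B‖ ^ 2) * sqNorm (ξ r, w r) := by
        have ma : a ∈ Icc a c := ⟨le_rfl, by linarith⟩
        have mc : c ∈ Icc a c := ⟨by linarith, le_rfl⟩
        refine mul_le_mul_of_nonneg_left ?_ (by linarith)
        exact intervalIntegral.integral_mono_on (by linarith)
          (IntegrableOn.intervalIntegrable_of_mem hi ma mc)
          ((he.intervalIntegrable_of_mem ma mc).const_mul _)
          fun r _ => sq_norm_rhs_le A B (ξ r) (w r)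
    _ = _ := by rw [intervalIntegral.integral_const_mul]; ring

namespace IsSol

theorem memLp_state (h : IsSol A B a c ξ w) : MemLp ξ 2 (volume.restrict (Icc a c)) :=
  memLp_Icc_of_continuousOn h.cont 2

theorem integrableOn (h : IsSol A B a c ξ w) :
    IntegrableOn (fun t => A (ξ t) + B (w t)) (Icc a c) :=
  integrableOn_rhs A B h.memLp_state h.memLp

theorem integrableOn_sqNorm (h : IsSol A B a c ξ w) :
    IntegrableOn (fun t => sqNorm (ξ t, w t)) (Icc a c) :=
  Turnpike.integrableOn_sqNorm h.memLp_state h.memLp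

theorem sub_eq (h : IsSol A B a c ξ w) {s t : ℝ} (hs : s ∈ Icc a c) (ht : t ∈ Icc a c) :
    ξ t = ξ s + ∫ r in s..t, (A (ξ r) + B (w r)) := by
  have ma : a ∈ Icc a c := ⟨le_rfl, hs.1.trans hs.2⟩
  rw [h.eq t ht, h.eq s hs, add_assoc, intervalIntegral.integral_add_adjacent_intervals
    (h.integrableOn.intervalIntegrable_of_mem ma hs)
    (h.integrableOn.intervalIntegrable_of_mem hs ht)]

theorem mono (h : IsSol A B a c ξ w) {a' c' : ℝ} (ha : a ≤ a') (hc : c' ≤ c) :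
    IsSol A B a' c' ξ w where
  memLp := h.memLp.mono_measure (Measure.restrict_mono (Icc_subset_Icc ha hc) le_rfl)
  cont := h.cont.mono (Icc_subset_Icc ha hc)
  eq _ ht := h.sub_eq ⟨ha, ht.1.trans (ht.2.trans hc)⟩ ⟨ha.trans ht.1, ht.2.trans hc⟩

theorem congr (h : IsSol A B a c ξ w) (hξ : ∀ t ∈ Icc a c, ξ' t = ξ t)
    (hw : w' =ᵐ[volume.restrict (Icc a c)] w) : IsSol A B a c ξ' w' where
  memLp := (memLp_congr_ae hw).2 h.memLp
  cont := h.cont.congr hξ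
  eq t ht := by
    rw [hξ t ht, hξ a ⟨le_rfl, ht.1.trans ht.2⟩, h.eq t ht]
    congr 1
    refine intervalIntegral.integral_congr_ae_restrict ?_
    have hs : uIoc a t ⊆ Icc a c := by
      rw [uIoc_of_le ht.1]
      exact Ioc_subset_Icc_self.trans (Icc_subset_Icc le_rfl ht.2)
    have h1 := ae_restrict_of_ae_restrict_of_subset hs hw
    have h2 : ∀ᵐ s ∂volume.restrict (uIoc a t), s ∈ uIoc a t :=
      ae_restrict_mem measurableSet_uIoc
    filter_upwards [h1, h2] with s h3 h4
    rw [h3, hξ s (hs h4)]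

theorem glue (h : IsSol A B a b ξ w) (h' : IsSol A B b c ξ' w') (hab : a ≤ b) (hbc : b ≤ c)
    (heq : ξ b = ξ' b) :
    IsSol A B a c (fun t => if t ≤ b then ξ t else ξ' t) (fun t => if t ≤ b then w t else w' t) := by
  set η : ℝ → V := fun t => if t ≤ b then ξ t else ξ' t with hη
  set ω : ℝ → W := fun t => if t ≤ b then w t else w' t with hω
  have g1 : IsSol A B a b η ω := by
    refine h.congr (fun t ht => by simp [hη, ht.2]) ?_
    filter_upwards [ae_restrict_mem measurableSet_Icc] with t ht
    simp [hω, ht.2]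
  have g2 : IsSol A B b c η ω := by
    refine h'.congr (fun t ht => ?_) ?_
    · rcases ht.1.eq_or_lt with rfl | hlt
      · simp [hη, heq]
      · simp [hη, hlt.not_ge]
    -- At the junction `b` the glued control takes the value of `w`, not of `w'`; this null set is
    -- dropped.
    · rw [Measure.restrict_congr_set Ioc_ae_eq_Icc.symm]
      filter_upwards [ae_restrict_mem measurableSet_Ioc] with t ht
      simp [hω, ht.1.not_ge]
  have hu : Icc a c = Icc a b ∪ Icc b c := (Icc_union_Icc_eq_Icc hab hbc).symm
  have hc' : ContinuousOn η (Icc a c) := by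
    rw [hu]; exact g1.cont.union_of_isClosed g2.cont isClosed_Icc isClosed_Icc
  have hm : MemLp ω 2 (volume.restrict (Icc a c)) := by
    have hms : AEStronglyMeasurable ω (volume.restrict (Icc a c)) := by
      rw [hu]; exact aestronglyMeasurable_union_iff.2 ⟨g1.memLp.1, g2.memLp.1⟩
    rw [memLp_two_iff_integrable_sq_norm hms, hu]
    exact IntegrableOn.union (g1.memLp.integrable_norm_pow (p := 2) (by norm_num))
      (g2.memLp.integrable_norm_pow (p := 2) (by norm_num))
  have hi := integrableOn_rhs A B (memLp_Icc_of_continuousOn hc' 2) hm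
  refine ⟨hm, hc', fun t ht => ?_⟩
  rcases le_total t b with htb | htb
  · exact g1.eq t ⟨ht.1, htb⟩
  · have mb : b ∈ Icc a c := ⟨hab, hbc⟩
    rw [g2.eq t ⟨htb, ht.2⟩, g1.eq b ⟨hab, le_rfl⟩, add_assoc,
      intervalIntegral.integral_add_adjacent_intervals
        (hi.intervalIntegrable_of_mem ⟨le_rfl, hab.trans hbc⟩ mb)
        (hi.intervalIntegrable_of_mem mb ht)]

theorem of_hasDerivAt [CompleteSpace V] (hw : Continuous w)
    (h : ∀ t, HasDerivAt ξ (A (ξ t) + B (w t)) t) : IsSol A B a c ξ w where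
  memLp := memLp_Icc_of_continuousOn hw.continuousOn 2
  cont := fun t _ => (h t).continuousAt.continuousWithinAt
  eq _ _ := by
    have hc : Continuous ξ := continuous_iff_continuousAt.2 fun t => (h t).continuousAt
    rw [intervalIntegral.integral_eq_sub_of_hasDerivAt (fun s _ => h s)
      (((A.continuous.comp hc).add (B.continuous.comp hw)).intervalIntegrable _ _)]
    abel

theorem sq_norm_sub_le (h : IsSol A B a c ξ w) {s t : ℝ} (hs : s ∈ Icc a c) (ht : t ∈ Icc a c) :
    ‖ξ t - ξ s‖ ^ 2 ≤
      (c - a) * (2 * (‖A‖ ^ 2 + ‖B‖ ^ 2)) * ∫ r in a..c, sqNorm (ξ r, w r) := by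
  wlog hst : s ≤ t generalizing s t
  · rw [norm_sub_rev]; exact this ht hs (le_of_not_ge hst)
  rw [h.sub_eq hs ht, add_sub_cancel_left]
  exact sq_norm_integral_rhs_le A B h.memLp_state h.memLp hs.1 hst ht.2

theorem sq_norm_le_of_initial (h : IsSol A B a c ξ w) (hca : c - a ≤ 1) {s t : ℝ}
    (hs : s ∈ Icc a c) (ht : t ∈ Icc a c) :
    ‖ξ t‖ ^ 2 ≤ 2 * ‖ξ s‖ ^ 2 +
      4 * (‖A‖ ^ 2 + ‖B‖ ^ 2) * ∫ r in a..c, sqNorm (ξ r, w r) := by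
  have h1 := h.sq_norm_sub_le hs ht
  have hac : a ≤ c := hs.1.trans hs.2
  have h0 : 0 ≤ ∫ r in a..c, sqNorm (ξ r, w r) :=
    intervalIntegral.integral_nonneg hac fun r _ => sqNorm_nonneg _
  have h2 : (c - a) * (2 * (‖A‖ ^ 2 + ‖B‖ ^ 2)) * ∫ r in a..c, sqNorm (ξ r, w r) ≤
      1 * (2 * (‖A‖ ^ 2 + ‖B‖ ^ 2)) * ∫ r in a..c, sqNorm (ξ r, w r) := by gcongr
  have h3 : ‖ξ t‖ ≤ ‖ξ s‖ + ‖ξ t - ξ s‖ := by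
    simpa using norm_add_le (ξ s) (ξ t - ξ s)
  have h4 : ‖ξ t‖ ^ 2 ≤ (‖ξ s‖ + ‖ξ t - ξ s‖) ^ 2 := by gcongr
  nlinarith [sq_nonneg (‖ξ s‖ - ‖ξ t - ξ s‖)]

/-- The previous bound compares the state at `t` with the state at any `s` of the interval;
averaging it over `s` replaces the reference state by the energy. This turns energy estimates into
pointwise ones. -/
theorem sq_norm_le_of_unit (h : IsSol A B a (a + 1) ξ w) {t : ℝ} (ht : t ∈ Icc a (a + 1)) :
    ‖ξ t‖ ^ 2 ≤ (2 + 4 * (‖A‖ ^ 2 + ‖B‖ ^ 2)) * ∫ r in a..(a + 1), sqNorm (ξ r, w r) := by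
  set I := ∫ r in a..(a + 1), sqNorm (ξ r, w r) with hI
  have ha : a ≤ a + 1 := by linarith
  have hi := h.integrableOn_sqNorm.intervalIntegrable_of_mem (left_mem_Icc.2 ha)
    (right_mem_Icc.2 ha)
  have h1 : ∫ s in a..(a + 1), ‖ξ t‖ ^ 2 ≤
      ∫ s in a..(a + 1), (2 * sqNorm (ξ s, w s) + 4 * (‖A‖ ^ 2 + ‖B‖ ^ 2) * I) := by
    refine intervalIntegral.integral_mono_on ha intervalIntegrable_const
      ((hi.const_mul _).add intervalIntegrable_const) fun s hs => ?_
    have := h.sq_norm_le_of_initial (by linarith) hs ht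
    have h2 : ‖ξ s‖ ^ 2 ≤ sqNorm (ξ s, w s) := by simp [sqNorm]
    linarith
  rw [intervalIntegral.integral_add (hi.const_mul _) intervalIntegrable_const,
    intervalIntegral.integral_const_mul, intervalIntegral.integral_const,
    intervalIntegral.integral_const, ← hI] at h1
  simp only [add_sub_cancel_left, one_smul] at h1
  linarith

end IsSol

end Solutions

/-! ### Limit theorems for minimizing sequences -/

section Fatou

/-- Fatou's lemma applied to `F k + M ≥ 0`; the added constant is integrable because the measure is
finite. -/
theorem integral_le_of_tendsto_ae {α : Type*} [MeasurableSpace α] {μ : Measure α}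
    [IsFiniteMeasure μ] {F : ℕ → α → ℝ} {G : α → ℝ} {M m : ℝ} (hF : ∀ k, Integrable (F k) μ)
    (hM : ∀ k, ∀ᵐ t ∂μ, -M ≤ F k t)
    (hlim : ∀ᵐ t ∂μ, Filter.Tendsto (fun k => F k t) Filter.atTop (nhds (G t)))
    (hm : Filter.Tendsto (fun k => ∫ t, F k t ∂μ) Filter.atTop (nhds m)) :
    Integrable G μ ∧ ∫ t, G t ∂μ ≤ m := by
  have hGm : AEStronglyMeasurable G μ :=
    aestronglyMeasurable_of_tendsto_ae Filter.atTop (fun k => (hF k).1) hlim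
  have hG0 : ∀ᵐ t ∂μ, 0 ≤ G t + M := by
    filter_upwards [ae_all_iff.2 hM, hlim] with t h1 h2
    have := ge_of_tendsto' h2 h1
    linarith
  have hFi : ∀ k, Integrable (fun t => F k t + M) μ := fun k => (hF k).add (integrable_const M)
  have hF0 : ∀ k, 0 ≤ᵐ[μ] fun t => F k t + M := fun k => by
    filter_upwards [hM k] with t ht
    simp only [Pi.zero_apply]
    linarith
  have e1 : ∀ k, ∫⁻ t, ENNReal.ofReal (F k t + M) ∂μ =
      ENNReal.ofReal ((∫ t, F k t ∂μ) + ∫ _, M ∂μ) := fun k => by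
    rw [← ofReal_integral_eq_lintegral_ofReal (hFi k) (hF0 k),
      integral_add (hF k) (integrable_const M)]
  have hlt : ∫⁻ t, ENNReal.ofReal (G t + M) ∂μ ≤ ENNReal.ofReal (m + ∫ _, M ∂μ) := by
    have h1 : ∫⁻ t, ENNReal.ofReal (G t + M) ∂μ =
        ∫⁻ t, Filter.liminf (fun k => ENNReal.ofReal (F k t + M)) Filter.atTop ∂μ := by
      refine lintegral_congr_ae ?_
      filter_upwards [hlim] with t ht
      exact ((ENNReal.continuous_ofReal.tendsto _).comp (ht.add_const M)).liminf_eq.symm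
    rw [h1]
    refine (lintegral_liminf_le' fun k => (hFi k).1.aemeasurable.ennreal_ofReal).trans ?_
    simp only [e1]
    exact ((ENNReal.continuous_ofReal.tendsto _).comp (hm.add_const _)).liminf_eq.le
  have hGi : Integrable (fun t => G t + M) μ := by
    refine ⟨hGm.add aestronglyMeasurable_const, ?_⟩
    rw [hasFiniteIntegral_iff_ofReal hG0]
    exact hlt.trans_lt ENNReal.ofReal_lt_top
  have hGi' : Integrable G μ := by
    simpa using hGi.add (integrable_const (-M))
  refine ⟨hGi', ?_⟩
  rw [← ofReal_integral_eq_lintegral_ofReal hGi hG0, integral_add hGi' (integrable_const M)] at hlt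
  have hm0 : 0 ≤ m + ∫ _, M ∂μ := ge_of_tendsto' (hm.add_const _) fun k => by
    rw [← integral_add (hF k) (integrable_const M)]
    exact integral_nonneg_of_ae (hF0 k)
  have := (ENNReal.ofReal_le_ofReal_iff hm0).1 hlt
  linarith

end Fatou

section L2

theorem tendsto_sqrt_zero {b : ℕ → ℝ} (hb : Filter.Tendsto b Filter.atTop (nhds 0)) :
    Filter.Tendsto (fun k => √(b k)) Filter.atTop (nhds 0) := by
  have := (Real.continuous_sqrt.tendsto 0).comp hb
  rwa [Real.sqrt_zero] at this

variable {V : Type*} [NormedAddCommGroup V] {α : Type*} [MeasurableSpace α] {μ : Measure α}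

theorem sq_norm_toLp {w : α → V} (hw : MemLp w 2 μ) : ‖hw.toLp w‖ ^ 2 = ∫ t, ‖w t‖ ^ 2 ∂μ := by
  have h0 : 0 ≤ ∫ t, ‖w t‖ ^ (2 : ENNReal).toReal ∂μ :=
    integral_nonneg fun t => Real.rpow_nonneg (norm_nonneg _) _
  rw [Lp.norm_toLp, hw.eLpNorm_eq_integral_rpow_norm (by norm_num) (by norm_num),
    ENNReal.toReal_ofReal (Real.rpow_nonneg h0 _), ← Real.rpow_natCast, ← Real.rpow_mul h0]
  simp

theorem exists_l2_limit [CompleteSpace V] {w : ℕ → α → V} (hw : ∀ k, MemLp (w k) 2 μ) {b : ℕ → ℝ}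
    (hb : Filter.Tendsto b Filter.atTop (nhds 0))
    (hc : ∀ k j N, N ≤ k → N ≤ j → ∫ t, ‖w k t - w j t‖ ^ 2 ∂μ ≤ b N) :
    ∃ w' : α → V, MemLp w' 2 μ ∧
      Filter.Tendsto (fun k => ∫ t, ‖w k t - w' t‖ ^ 2 ∂μ) Filter.atTop (nhds 0) ∧
      ∃ ns : ℕ → ℕ, StrictMono ns ∧
        ∀ᵐ t ∂μ, Filter.Tendsto (fun k => w (ns k) t) Filter.atTop (nhds (w' t)) := by
  set g : ℕ → Lp V 2 μ := fun k => (hw k).toLp (w k)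
  have hg : CauchySeq g := by
    refine cauchySeq_of_le_tendsto_0 (fun k => √(b k)) (fun k j N hk hj => ?_)
      (tendsto_sqrt_zero hb)
    rw [dist_eq_norm, ← MemLp.toLp_sub]
    refine Real.le_sqrt_of_sq_le ?_
    rw [sq_norm_toLp]
    exact hc k j N hk hj
  obtain ⟨G, hG⟩ := cauchySeq_tendsto_of_complete hg
  have hGm : MemLp G 2 μ := Lp.memLp G
  refine ⟨G, hGm, ?_, ?_⟩
  · have : Filter.Tendsto (fun k => ‖g k - G‖ ^ 2) Filter.atTop (nhds 0) := by
      simpa using (tendsto_iff_norm_sub_tendsto_zero.1 hG).pow 2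
    refine this.congr fun k => ?_
    have e : g k - G = ((hw k).sub hGm).toLp _ := by
      rw [MemLp.toLp_sub (hw k) hGm, Lp.toLp_coeFn]
    rw [e, sq_norm_toLp]
    rfl
  · obtain ⟨ns, hns, hae⟩ := (tendstoInMeasure_of_tendsto_Lp hG).exists_seq_tendsto_ae
    refine ⟨ns, hns, ?_⟩
    have h1 : ∀ᵐ t ∂μ, ∀ k, g k t = w k t := ae_all_iff.2 fun k => (hw k).coeFn_toLp
    filter_upwards [hae, h1] with t h2 h3
    simpa only [h3] using h2

end L2

/-! ### Existence and uniqueness of minimizers -/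

section Existence

variable {V W : Type*} [NormedAddCommGroup V] [NormedSpace ℝ V]
  [NormedAddCommGroup W] [NormedSpace ℝ W] {A : V →L[ℝ] V} {B : W →L[ℝ] V}

theorem IsSol.lincomb {a c : ℝ} {ξ ξ' : ℝ → V} {w w' : ℝ → W} (h : IsSol A B a c ξ w)
    (h' : IsSol A B a c ξ' w') (r s : ℝ) :
    IsSol A B a c (fun t => r • ξ t + s • ξ' t) (fun t => r • w t + s • w' t) where
  memLp := (h.memLp.const_smul r).add (h'.memLp.const_smul s)
  cont := (h.cont.const_smul r).add (h'.cont.const_smul s)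
  eq t ht := by
    have ma : a ∈ Icc a c := ⟨le_rfl, ht.1.trans ht.2⟩
    have i1 := h.integrableOn.intervalIntegrable_of_mem ma ht
    have i2 := h'.integrableOn.intervalIntegrable_of_mem ma ht
    have e : (fun q => A (r • ξ q + s • ξ' q) + B (r • w q + s • w' q)) =
        fun q => r • (A (ξ q) + B (w q)) + s • (A (ξ' q) + B (w' q)) := by
      ext q; simp only [map_add, map_smul]; module
    have e' : ∫ q in a..t, (r • (A (ξ q) + B (w q)) + s • (A (ξ' q) + B (w' q))) =
        r • (∫ q in a..t, (A (ξ q) + B (w q))) + s • ∫ q in a..t, (A (ξ' q) + B (w' q)) := by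
      rw [← intervalIntegral.integral_smul, ← intervalIntegral.integral_smul]
      exact intervalIntegral.integral_add (i1.smul r) (i2.smul s)
    rw [e, e', h.eq t ht, h'.eq t ht]
    module

theorem IsSol.sub_sol {a c : ℝ} {ξ ξ' : ℝ → V} {w w' : ℝ → W} (h : IsSol A B a c ξ w)
    (h' : IsSol A B a c ξ' w') :
    IsSol A B a c (fun t => ξ t - ξ' t) (fun t => w t - w' t) := by
  have := h.lincomb h' 1 (-1)
  simpa [sub_eq_add_neg] using this

/-- Solutions with initial state `x₀` and finite cost. -/
structure IsAdm (A : V →L[ℝ] V) (B : W →L[ℝ] V) (h : V × W → ℝ) (T : ℝ) (x₀ : V)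
    (ξ : ℝ → V) (w : ℝ → W) : Prop where
  sol : IsSol A B 0 T ξ w
  init : ξ 0 = x₀
  int : IntegrableOn (fun t => h (ξ t, w t)) (Icc 0 T)

/-- Minimizers of `∫ h(ξ, w)` among the solutions with given initial state. -/
def IsMin (A : V →L[ℝ] V) (B : W →L[ℝ] V) (h : V × W → ℝ) (T : ℝ) (x₀ : V)
    (ξ : ℝ → V) (w : ℝ → W) : Prop :=
  IsAdm A B h T x₀ ξ w ∧ ∀ ξ' w', IsAdm A B h T x₀ ξ' w' →
    ∫ t in (0 : ℝ)..T, h (ξ t, w t) ≤ ∫ t in (0 : ℝ)..T, h (ξ' t, w' t)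

variable {h : V × W → ℝ} {T M κ : ℝ} {x₀ : V} {ξ ξ' : ℝ → V} {w w' : ℝ → W}

theorem IsSol.aestronglyMeasurable_comp (hh : Continuous h) {a c : ℝ} (hs : IsSol A B a c ξ w) :
    AEStronglyMeasurable (fun t => h (ξ t, w t)) (volume.restrict (Icc a c)) :=
  hh.comp_aestronglyMeasurable (hs.memLp_state.1.prodMk hs.memLp.1)

/-- The system is linear, so the average of two admissible pairs is a solution with the same initial
state. Its cost is integrable, being squeezed between `-M` and the average of the two integrable
costs; integrating `hmid` gives the gain. -/
theorem IsAdm.midpoint (hT : 0 ≤ T) (hh : Continuous h) (hM : ∀ p, -M ≤ h p) (hκ : 0 ≤ κ)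
    (hmid : ∀ p q, h ((1 / 2 : ℝ) • (p + q)) + κ * sqNorm (p - q) ≤ (h p + h q) / 2)
    (h1 : IsAdm A B h T x₀ ξ w) (h2 : IsAdm A B h T x₀ ξ' w') :
    ∃ ξ'' w'', IsAdm A B h T x₀ ξ'' w'' ∧
      (∫ t in (0 : ℝ)..T, h (ξ'' t, w'' t)) +
          κ * ∫ t in (0 : ℝ)..T, sqNorm (ξ t - ξ' t, w t - w' t) ≤
        ((∫ t in (0 : ℝ)..T, h (ξ t, w t)) + ∫ t in (0 : ℝ)..T, h (ξ' t, w' t)) / 2 := by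
  have hsol := h1.sol.lincomb h2.sol (1 / 2) (1 / 2)
  set ξ'' : ℝ → V := fun t => (1 / 2 : ℝ) • ξ t + (1 / 2 : ℝ) • ξ' t
  set w'' : ℝ → W := fun t => (1 / 2 : ℝ) • w t + (1 / 2 : ℝ) • w' t
  have hpt : ∀ t, h (ξ'' t, w'' t) + κ * sqNorm (ξ t - ξ' t, w t - w' t) ≤
      (h (ξ t, w t) + h (ξ' t, w' t)) / 2 := fun t => by
    have := hmid (ξ t, w t) (ξ' t, w' t)
    have e : (1 / 2 : ℝ) • ((ξ t, w t) + (ξ' t, w' t)) = (ξ'' t, w'' t) := by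
      simp [ξ'', w'']
    rwa [e] at this
  have hint : IntegrableOn (fun t => h (ξ'' t, w'' t)) (Icc 0 T) := by
    have hb : IntegrableOn (fun t => |M| + (|h (ξ t, w t)| + |h (ξ' t, w' t)|)) (Icc 0 T) :=
      (integrable_const _).add (h1.int.abs.add h2.int.abs)
    refine Integrable.mono' hb (hsol.aestronglyMeasurable_comp hh)
      (Filter.Eventually.of_forall fun t => ?_)
    have a1 := hpt t
    have a2 := hM (ξ'' t, w'' t)
    have a3 : 0 ≤ κ * sqNorm (ξ t - ξ' t, w t - w' t) := mul_nonneg hκ (sqNorm_nonneg _)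
    rw [Real.norm_eq_abs, abs_le]
    have b1 := le_abs_self (h (ξ t, w t))
    have b2 := le_abs_self (h (ξ' t, w' t))
    have b3 := le_abs_self M
    have b4 := abs_nonneg (h (ξ t, w t))
    have b5 := abs_nonneg (h (ξ' t, w' t))
    have b6 := abs_nonneg M
    constructor <;> linarith
  refine ⟨ξ'', w'', ⟨hsol, ?_, hint⟩, ?_⟩
  · simp only [ξ'', h1.init, h2.init]; module
  · have m0 : (0 : ℝ) ∈ Icc 0 T := ⟨le_rfl, hT⟩
    have mT : T ∈ Icc 0 T := ⟨hT, le_rfl⟩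
    have i1 := h1.int.intervalIntegrable_of_mem m0 mT
    have i2 := h2.int.intervalIntegrable_of_mem m0 mT
    have i3 := hint.intervalIntegrable_of_mem m0 mT
    have i4 := ((h1.sol.sub_sol h2.sol).integrableOn_sqNorm.intervalIntegrable_of_mem m0 mT)
    rw [← intervalIntegral.integral_const_mul, ← intervalIntegral.integral_add i3 (i4.const_mul κ),
      ← intervalIntegral.integral_add i1 i2, ← intervalIntegral.integral_div]
    exact intervalIntegral.integral_mono_on hT (i3.add (i4.const_mul κ)) ((i1.add i2).div_const 2)
      fun t _ => hpt t

theorem IsAdm.sq_norm_sub_le (h1 : IsAdm A B h T x₀ ξ w) (h2 : IsAdm A B h T x₀ ξ' w') {t : ℝ}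
    (ht : t ∈ Icc 0 T) : ‖ξ t - ξ' t‖ ^ 2 ≤ T * (2 * (‖A‖ ^ 2 + ‖B‖ ^ 2)) *
      ∫ r in (0 : ℝ)..T, sqNorm (ξ r - ξ' r, w r - w' r) := by
  have := (h1.sol.sub_sol h2.sol).sq_norm_sub_le (s := 0) ⟨le_rfl, ht.1.trans ht.2⟩ ht
  simpa [h1.init, h2.init] using this

theorem IsMin.unique (hT : 0 ≤ T) (hh : Continuous h) (hM : ∀ p, -M ≤ h p) (hκ : 0 < κ)
    (hmid : ∀ p q, h ((1 / 2 : ℝ) • (p + q)) + κ * sqNorm (p - q) ≤ (h p + h q) / 2)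
    (h1 : IsMin A B h T x₀ ξ w) (h2 : IsMin A B h T x₀ ξ' w') :
    EqOn ξ' ξ (Icc 0 T) ∧ w' =ᵐ[volume.restrict (Icc 0 T)] w := by
  obtain ⟨ξ'', w'', h3, h4⟩ := h1.1.midpoint hT hh hM hκ.le hmid h2.1
  have a1 := h1.2 _ _ h3
  have a2 := h2.2 _ _ h3
  have hsub := h1.1.sol.sub_sol h2.1.sol
  have h0 : 0 ≤ ∫ t in (0 : ℝ)..T, sqNorm (ξ t - ξ' t, w t - w' t) :=
    intervalIntegral.integral_nonneg hT fun t _ => sqNorm_nonneg _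
  have hz : ∫ t in (0 : ℝ)..T, sqNorm (ξ t - ξ' t, w t - w' t) = 0 := by
    have : κ * ∫ t in (0 : ℝ)..T, sqNorm (ξ t - ξ' t, w t - w' t) ≤ 0 := by linarith
    exact le_antisymm (by nlinarith) h0
  refine ⟨fun t ht => ?_, ?_⟩
  · have := h1.1.sq_norm_sub_le h2.1 ht
    rw [hz, mul_zero] at this
    have h5 : ‖ξ t - ξ' t‖ = 0 := by nlinarith [norm_nonneg (ξ t - ξ' t)]
    exact (sub_eq_zero.1 (norm_eq_zero.1 h5)).symm
  · rw [intervalIntegral.integral_of_le hT, ← integral_Icc_eq_integral_Ioc] at hz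
    have := (integral_eq_zero_iff_of_nonneg (fun t => sqNorm_nonneg _)
      hsub.integrableOn_sqNorm).1 hz
    filter_upwards [this] with t ht
    have h6 := sqNorm_eq_zero (le_of_eq ht)
    exact (sub_eq_zero.1 (congrArg Prod.snd h6)).symm

/-- The direct method without weak compactness: the midpoint of two nearly optimal pairs cannot beat
the infimum, so the gain term bounds their distance. Controls then converge in `L²`, states
uniformly, and Fatou passes to the limit in the cost. -/
theorem exists_isMin [CompleteSpace V] [CompleteSpace W] (hT : 0 ≤ T) (hh : Continuous h)
    (hM : ∀ p, -M ≤ h p) (hκ : 0 < κ)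
    (hmid : ∀ p q, h ((1 / 2 : ℝ) • (p + q)) + κ * sqNorm (p - q) ≤ (h p + h q) / 2)
    (hne : ∃ ξ w, IsAdm A B h T x₀ ξ w) : ∃ ξ w, IsMin A B h T x₀ ξ w := by
  set S : Set ℝ := {r | ∃ ξ w, IsAdm A B h T x₀ ξ w ∧ ∫ t in (0 : ℝ)..T, h (ξ t, w t) = r}
  have m0 : (0 : ℝ) ∈ Icc 0 T := ⟨le_rfl, hT⟩
  have mT : T ∈ Icc 0 T := ⟨hT, le_rfl⟩
  have hSne : S.Nonempty := by
    obtain ⟨ξ, w, hw⟩ := hne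
    exact ⟨_, ξ, w, hw, rfl⟩
  have hSb : BddBelow S := by
    refine ⟨∫ t in (0 : ℝ)..T, -M, ?_⟩
    rintro _ ⟨ξ, w, hw, rfl⟩
    exact intervalIntegral.integral_mono_on hT intervalIntegrable_const
      (hw.int.intervalIntegrable_of_mem m0 mT) fun t _ => hM _
  set m := sInf S
  have hlow : ∀ ξ w, IsAdm A B h T x₀ ξ w → m ≤ ∫ t in (0 : ℝ)..T, h (ξ t, w t) :=
    fun ξ w hw => csInf_le hSb ⟨ξ, w, hw, rfl⟩
  have hseq : ∀ k : ℕ, ∃ ξ w, IsAdm A B h T x₀ ξ w ∧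
      ∫ t in (0 : ℝ)..T, h (ξ t, w t) < m + 1 / ((k : ℝ) + 1) := fun k => by
    obtain ⟨_, ⟨ξ, w, hw, rfl⟩, hlt⟩ := exists_lt_of_csInf_lt hSne
      (show m < m + 1 / ((k : ℝ) + 1) by linarith [Nat.one_div_pos_of_nat (α := ℝ) (n := k)])
    exact ⟨ξ, w, hw, hlt⟩
  choose ξ w hadm hlt using hseq
  have hε : Filter.Tendsto (fun k : ℕ => 1 / ((k : ℝ) + 1)) Filter.atTop (nhds 0) :=
    tendsto_one_div_add_atTop_nhds_zero_nat
  -- Both costs lie within `1 / (N + 1)` of the infimum `m`, while the cost of the midpoint is at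
  -- least `m`.
  have hD : ∀ k j N, N ≤ k → N ≤ j →
      ∫ t in (0 : ℝ)..T, sqNorm (ξ k t - ξ j t, w k t - w j t) ≤ κ⁻¹ * (1 / ((N : ℝ) + 1)) := by
    intro k j N hk hj
    obtain ⟨ξ'', w'', h3, h4⟩ := (hadm k).midpoint hT hh hM hκ.le hmid (hadm j)
    have a1 := hlow _ _ h3
    have a2 := hlt k
    have a3 := hlt j
    have a4 : 1 / ((k : ℝ) + 1) ≤ 1 / ((N : ℝ) + 1) := Nat.one_div_le_one_div hk
    have a5 : 1 / ((j : ℝ) + 1) ≤ 1 / ((N : ℝ) + 1) := Nat.one_div_le_one_div hj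
    rw [le_inv_mul_iff₀ hκ]
    linarith
  have htoset : ∀ F : ℝ → ℝ, ∫ t in Icc 0 T, F t = ∫ t in (0 : ℝ)..T, F t := fun F => by
    rw [intervalIntegral.integral_of_le hT, integral_Icc_eq_integral_Ioc]
  have hwc : ∀ k j N, N ≤ k → N ≤ j →
      ∫ t in Icc 0 T, ‖w k t - w j t‖ ^ 2 ≤ κ⁻¹ * (1 / ((N : ℝ) + 1)) := by
    intro k j N hk hj
    refine le_trans ?_ (hD k j N hk hj)
    rw [← htoset]
    have hs := (hadm k).sol.sub_sol (hadm j).sol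
    exact integral_mono (hs.memLp.integrable_norm_pow (p := 2) (by norm_num))
      hs.integrableOn_sqNorm fun t => by simp [sqNorm]
  obtain ⟨w', hw', hwlim, ns, hns, hwae⟩ := exists_l2_limit (fun k => (hadm k).sol.memLp)
    (b := fun k => κ⁻¹ * (1 / ((k : ℝ) + 1))) (by simpa using hε.const_mul κ⁻¹)
    hwc
  set C := T * (2 * (‖A‖ ^ 2 + ‖B‖ ^ 2)) with hC
  have hC0 : 0 ≤ C := by positivity
  set β : ℕ → ℝ := fun k => √(C * (κ⁻¹ * (1 / ((k : ℝ) + 1)))) with hβ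
  have hβlim : Filter.Tendsto β Filter.atTop (nhds 0) := by
    have : Filter.Tendsto (fun k : ℕ => C * (κ⁻¹ * (1 / ((k : ℝ) + 1)))) Filter.atTop (nhds 0) := by
      simpa using (hε.const_mul κ⁻¹).const_mul C
    exact tendsto_sqrt_zero this
  have hdist : ∀ t ∈ Icc 0 T, ∀ k j N, N ≤ k → N ≤ j → dist (ξ k t) (ξ j t) ≤ β N := by
    intro t ht k j N hk hj
    rw [dist_eq_norm]
    refine Real.le_sqrt_of_sq_le (((hadm k).sq_norm_sub_le (hadm j) ht).trans ?_)
    exact mul_le_mul_of_nonneg_left (hD k j N hk hj) hC0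
  -- The limit curve is wanted as a function on all of `ℝ`; its values outside `[0, T]` are
  -- irrelevant.
  have hlimex : ∀ t, ∃ L, t ∈ Icc 0 T → Filter.Tendsto (fun k => ξ k t) Filter.atTop (nhds L) := by
    intro t
    by_cases ht : t ∈ Icc 0 T
    · obtain ⟨L, hL⟩ := cauchySeq_tendsto_of_complete
        (cauchySeq_of_le_tendsto_0 β (hdist t ht) hβlim)
      exact ⟨L, fun _ => hL⟩
    · exact ⟨0, fun h => absurd h ht⟩
  choose ξ' hξ' using hlimex
  have hunif : ∀ t ∈ Icc 0 T, ∀ k, ‖ξ k t - ξ' t‖ ≤ β k := fun t ht k => by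
    rw [← dist_eq_norm]
    refine le_of_tendsto (tendsto_const_nhds.dist (hξ' t ht)) ?_
    filter_upwards [Filter.eventually_ge_atTop k] with j hj using hdist t ht k j k le_rfl hj
  have hξ'c : ContinuousOn ξ' (Icc 0 T) := by
    have : TendstoUniformlyOn ξ ξ' Filter.atTop (Icc 0 T) := by
      rw [Metric.tendstoUniformlyOn_iff]
      intro ε hε
      filter_upwards [hβlim.eventually_lt_const hε] with k hk t ht
      rw [dist_comm, dist_eq_norm]
      exact (hunif t ht k).trans_lt hk
    exact this.continuousOn (Filter.Frequently.of_forall fun k => (hadm k).sol.cont)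
  have hξ'm := memLp_Icc_of_continuousOn hξ'c 2
  have hint' := integrableOn_rhs A B hξ'm hw'
  have hdiff : Filter.Tendsto (fun k => ∫ t in (0 : ℝ)..T, sqNorm (ξ k t - ξ' t, w k t - w' t))
      Filter.atTop (nhds 0) := by
    have hup : Filter.Tendsto (fun k => T * β k ^ 2 + ∫ t in Icc 0 T, ‖w k t - w' t‖ ^ 2)
        Filter.atTop (nhds 0) := by
      simpa using ((hβlim.pow 2).const_mul T).add hwlim
    refine squeeze_zero (fun k => intervalIntegral.integral_nonneg hT fun t _ => sqNorm_nonneg _)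
      (fun k => ?_) hup
    have i1 : IntegrableOn (fun t => ‖ξ k t - ξ' t‖ ^ 2) (Icc 0 T) :=
      ((hadm k).sol.memLp_state.sub hξ'm).integrable_norm_pow (p := 2) (by norm_num)
    have i2 : IntegrableOn (fun t => ‖w k t - w' t‖ ^ 2) (Icc 0 T) :=
      ((hadm k).sol.memLp.sub hw').integrable_norm_pow (p := 2) (by norm_num)
    have j1 := i1.intervalIntegrable_of_mem m0 mT
    simp only [sqNorm]
    rw [intervalIntegral.integral_add j1 (i2.intervalIntegrable_of_mem m0 mT), htoset]
    gcongr
    calc ∫ t in (0 : ℝ)..T, ‖ξ k t - ξ' t‖ ^ 2 ≤ ∫ t in (0 : ℝ)..T, β k ^ 2 :=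
          intervalIntegral.integral_mono_on hT j1 intervalIntegrable_const fun t ht => by
            gcongr; exact hunif t ht k
      _ = T * β k ^ 2 := by simp
  have hsol : IsSol A B 0 T ξ' w' := by
    refine ⟨hw', hξ'c, fun t ht => ?_⟩
    have h0 : ξ' 0 = x₀ := tendsto_nhds_unique (hξ' 0 m0)
      (by simpa only [(hadm _).init] using tendsto_const_nhds)
    have hlim : Filter.Tendsto (fun k => ∫ s in (0 : ℝ)..t, (A (ξ k s) + B (w k s))) Filter.atTop
        (nhds (∫ s in (0 : ℝ)..t, (A (ξ' s) + B (w' s)))) := by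
      rw [tendsto_iff_norm_sub_tendsto_zero]
      have hs : Filter.Tendsto (fun k => √(C *
          ∫ t in (0 : ℝ)..T, sqNorm (ξ k t - ξ' t, w k t - w' t))) Filter.atTop (nhds 0) := by
        exact tendsto_sqrt_zero (by simpa using hdiff.const_mul C)
      refine squeeze_zero (fun k => norm_nonneg _) (fun k => Real.le_sqrt_of_sq_le ?_) hs
      have := sq_norm_integral_rhs_le A B ((hadm k).sol.memLp_state.sub hξ'm)
        ((hadm k).sol.memLp.sub hw') le_rfl ht.1 ht.2
      rw [sub_zero] at this
      rw [← intervalIntegral.integral_sub ((hadm k).sol.integrableOn.intervalIntegrable_of_mem m0 ht)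
        (hint'.intervalIntegrable_of_mem m0 ht)]
      have e : (fun s => A (ξ k s) + B (w k s) - (A (ξ' s) + B (w' s))) =
          fun s => A ((ξ k - ξ') s) + B ((w k - w') s) := by
        ext s
        simp only [Pi.sub_apply, map_sub]
        abel
      rw [e]
      exact this
    rw [h0]
    refine tendsto_nhds_unique (hξ' t ht) ((hlim.const_add x₀).congr fun k => ?_)
    rw [(hadm k).sol.eq t ht, (hadm k).init]
  have hJ : Filter.Tendsto (fun k => ∫ t in Icc 0 T, h (ξ (ns k) t, w (ns k) t)) Filter.atTop
      (nhds m) := by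
    have : Filter.Tendsto (fun k => ∫ t in Icc 0 T, h (ξ k t, w k t)) Filter.atTop (nhds m) := by
      refine tendsto_of_tendsto_of_tendsto_of_le_of_le tendsto_const_nhds
        (g := fun _ => m)
        (h := fun k : ℕ => m + 1 / ((k : ℝ) + 1)) (by simpa using hε.const_add m) (fun k => ?_) (fun k => ?_)
      · simp only [htoset]; exact hlow _ _ (hadm k)
      · simp only [htoset]; exact (hlt k).le
    exact this.comp hns.tendsto_atTop
  -- Only a subsequence of the controls converges almost everywhere; the costs still tend to `m`
  -- along it.
  have hae : ∀ᵐ t ∂volume.restrict (Icc 0 T), Filter.Tendsto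
      (fun k => h (ξ (ns k) t, w (ns k) t)) Filter.atTop (nhds (h (ξ' t, w' t))) := by
    filter_upwards [hwae, ae_restrict_mem measurableSet_Icc] with t h1 h2
    exact (hh.tendsto _).comp (((hξ' t h2).comp hns.tendsto_atTop).prodMk_nhds h1)
  obtain ⟨hi, hle⟩ := integral_le_of_tendsto_ae (fun k => (hadm (ns k)).int)
    (fun k => Filter.Eventually.of_forall fun t => hM _) hae hJ
  have h0 : ξ' 0 = x₀ := tendsto_nhds_unique (hξ' 0 m0)
    (by simpa only [(hadm _).init] using tendsto_const_nhds)
  refine ⟨ξ', w', ⟨hsol, h0, hi⟩, fun ξ₁ w₁ h₁ => ?_⟩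
  rw [← htoset]
  exact hle.trans (hlow _ _ h₁)

end Existence

/-! ### Uniqueness and flows for linear equations -/

section LinearODE

variable {V : Type*} [NormedAddCommGroup V] [NormedSpace ℝ V]

theorem eqOn_of_linear_ode (M : V →L[ℝ] V) {y z : ℝ → V} {a c : ℝ}
    (hy : ContinuousOn y (Icc a c)) (hy' : ∀ t ∈ Ico a c, HasDerivWithinAt y (M (y t)) (Ici t) t)
    (hz : ContinuousOn z (Icc a c)) (hz' : ∀ t ∈ Ico a c, HasDerivWithinAt z (M (z t)) (Ici t) t)
    (h : y a = z a) : EqOn y z (Icc a c) :=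
  ODE_solution_unique (v := fun _ => M) (fun _ => M.lipschitz) hy hy' hz hz' h

theorem eqOn_of_hasDerivAt (M : V →L[ℝ] V) {y z : ℝ → V} {a c : ℝ}
    (hy : ∀ t, HasDerivAt y (M (y t)) t) (hz : ∀ t, HasDerivAt z (M (z t)) t)
    (h : y a = z a) : EqOn y z (Icc a c) :=
  eqOn_of_linear_ode M (fun t _ => (hy t).continuousAt.continuousWithinAt)
    (fun t _ => (hy t).hasDerivWithinAt) (fun t _ => (hz t).continuousAt.continuousWithinAt)
    (fun t _ => (hz t).hasDerivWithinAt) h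

/-- Extending `y` continuously beyond `[a, c]` makes the right side of the integral equation
differentiable everywhere, so that the uniqueness theorem for differentiable solutions applies. -/
theorem eqOn_of_integral_eq [CompleteSpace V] (M : V →L[ℝ] V) {y z : ℝ → V} {a c : ℝ}
    (hy : ContinuousOn y (Icc a c)) (hy' : ∀ t ∈ Icc a c, y t = y a + ∫ s in a..t, M (y s))
    (hz : ∀ t, HasDerivAt z (M (z t)) t) (h : y a = z a) : EqOn y z (Icc a c) := by
  rcases le_or_gt a c with hac | hac
  swap
  · simp [Icc_eq_empty_of_lt hac]
  have hx : Continuous (IccExtend hac ((Icc a c).domRestrict y)) :=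
    (continuousOn_iff_continuous_domRestrict.1 hy).Icc_extend'
  set x := IccExtend hac ((Icc a c).domRestrict y)
  have hxy : ∀ t ∈ Icc a c, x t = y t := fun t ht => IccExtend_of_mem hac _ ht
  set F : ℝ → V := fun t => y a + ∫ s in a..t, M (x s)
  have hF : ∀ t, HasDerivAt F (M (x t)) t := fun t =>
    ((M.continuous.comp hx).integral_hasStrictDerivAt a t).hasDerivAt.const_add _
  have hFy : EqOn F y (Icc a c) := fun t ht => by
    rw [hy' t ht]
    simp only [F]
    congr 1
    refine intervalIntegral.integral_congr fun s hs => ?_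
    rw [uIcc_of_le ht.1] at hs
    simp only [hxy s ⟨hs.1, hs.2.trans ht.2⟩]
  refine hFy.symm.trans (eqOn_of_linear_ode M
    (fun t _ => (hF t).continuousAt.continuousWithinAt) (fun t ht => ?_)
    (fun t _ => (hz t).continuousAt.continuousWithinAt) (fun t _ => (hz t).hasDerivWithinAt) ?_)
  · have ht' := Ico_subset_Icc_self ht
    have := (hF t).hasDerivWithinAt (s := Ici t)
    rwa [hxy t ht', ← hFy ht'] at this
  · simp [F, h]

/-- The flow `exp (t H)` of a linear vector field. -/
noncomputable def linearFlow (H : V →L[ℝ] V) (t : ℝ) : V →L[ℝ] V := NormedSpace.exp (t • H)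

theorem linearFlow_zero_apply (H : V →L[ℝ] V) (z : V) : linearFlow H 0 z = z := by
  simp [linearFlow]

variable [CompleteSpace V]

theorem hasDerivAt_linearFlow (H : V →L[ℝ] V) (z : V) (t : ℝ) :
    HasDerivAt (fun t => linearFlow H t z) (H (linearFlow H t z)) t :=
  (ContinuousLinearMap.apply ℝ V z).hasFDerivAt.comp_hasDerivAt t
    (hasDerivAt_exp_smul_const' (𝕂 := ℝ) H t)

theorem exists_linearFlow_bound (H : V →L[ℝ] V) :
    ∃ κ, 0 ≤ κ ∧ ∀ t ∈ Icc (0 : ℝ) 1, ∀ z, ‖linearFlow H t z‖ ≤ κ * ‖z‖ := by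
  have hc : Continuous (linearFlow H) := continuous_iff_continuousAt.2 fun t =>
    (hasDerivAt_exp_smul_const' (𝕂 := ℝ) H t).continuousAt
  obtain ⟨κ, hκ⟩ := (isCompact_Icc (a := (0 : ℝ)) (b := 1)).exists_bound_of_continuousOn
    hc.continuousOn
  refine ⟨κ, (norm_nonneg _).trans (hκ 0 (left_mem_Icc.2 zero_le_one)), fun t ht z => ?_⟩
  exact ((linearFlow H t).le_opNorm z).trans (by gcongr; exact hκ t ht)

end LinearODE

section Uncontrolled

variable {V W G : Type*} [NormedAddCommGroup V] [NormedSpace ℝ V] [CompleteSpace V]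
  [NormedAddCommGroup W] [NormedSpace ℝ W]
  [NormedAddCommGroup G] [NormedSpace ℝ G] [CompleteSpace G]

/-- Applying `π` to the integral equation removes the control, and linear uniqueness leaves only one
curve. -/
theorem IsSol.uncontrolled_eq {A : V →L[ℝ] V} {B : W →L[ℝ] V} {π : V →L[ℝ] G} {M : G →L[ℝ] G}
    (hπA : ∀ z, π (A z) = M (π z)) (hπB : ∀ u, π (B u) = 0) {a c : ℝ} {ξ : ℝ → V} {w : ℝ → W}
    (h : IsSol A B a c ξ w) {y : ℝ → G} (hy : ∀ t, HasDerivAt y (M (y t)) t)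
    (h0 : π (ξ a) = y a) {t : ℝ} (ht : t ∈ Icc a c) : π (ξ t) = y t := by
  refine eqOn_of_integral_eq M (y := fun t => π (ξ t)) (π.continuous.comp_continuousOn h.cont)
    (fun s hs => ?_) hy h0 ht
  have hi := h.integrableOn.intervalIntegrable_of_mem ⟨le_rfl, hs.1.trans hs.2⟩ hs
  rw [h.eq s hs, map_add, ← π.intervalIntegral_comp_comm hi]
  simp [hπA, hπB]

end Uncontrolled

/-! ### Steering in unit time by the Hamiltonian flow -/

section Steering

variable {V W : Type*} [NormedAddCommGroup V] [InnerProductSpace ℝ V] [CompleteSpace V]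
  [NormedAddCommGroup W] [InnerProductSpace ℝ W] [CompleteSpace W]

/-- The Hamiltonian operator of the minimum energy control problem. -/
noncomputable def hamiltonian (A : V →L[ℝ] V) (B : W →L[ℝ] V) : (V × V) →L[ℝ] (V × V) :=
  (A.comp (ContinuousLinearMap.fst ℝ V V) +
    (B.comp (ContinuousLinearMap.adjoint B)).comp (ContinuousLinearMap.snd ℝ V V)).prod
  (-(ContinuousLinearMap.adjoint A).comp (ContinuousLinearMap.snd ℝ V V))

/-- The flow of the Hamiltonian operator. -/
noncomputable def hamFlow (A : V →L[ℝ] V) (B : W →L[ℝ] V) (t : ℝ) : (V × V) →L[ℝ] (V × V) :=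
  linearFlow (hamiltonian A B) t

variable (A : V →L[ℝ] V) (B : W →L[ℝ] V)

theorem hamFlow_zero (z : V × V) : hamFlow A B 0 z = z := linearFlow_zero_apply _ z

theorem hasDerivAt_hamFlow (z : V × V) (t : ℝ) :
    HasDerivAt (fun t => hamFlow A B t z) (hamiltonian A B (hamFlow A B t z)) t :=
  hasDerivAt_linearFlow _ z t

theorem continuous_hamFlow (z : V × V) : Continuous fun t => hamFlow A B t z :=
  continuous_iff_continuousAt.2 fun t => (hasDerivAt_hamFlow A B z t).continuousAt

theorem hasDerivAt_hamFlow_fst (z : V × V) (t : ℝ) :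
    HasDerivAt (fun t => (hamFlow A B t z).1)
      (A (hamFlow A B t z).1 + B (ContinuousLinearMap.adjoint B (hamFlow A B t z).2)) t := by
  refine ((ContinuousLinearMap.fst ℝ V V).hasFDerivAt.comp_hasDerivAt t
    (hasDerivAt_hamFlow A B z t)).congr_deriv ?_
  simp [hamiltonian]

theorem hasDerivAt_hamFlow_snd (z : V × V) (t : ℝ) :
    HasDerivAt (fun t => (hamFlow A B t z).2)
      (-(ContinuousLinearMap.adjoint A (hamFlow A B t z).2)) t := by
  refine ((ContinuousLinearMap.snd ℝ V V).hasFDerivAt.comp_hasDerivAt t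
    (hasDerivAt_hamFlow A B z t)).congr_deriv ?_
  simp [hamiltonian]

theorem hasDerivAt_hamFlow_inner (z : V × V) (t : ℝ) :
    HasDerivAt (fun t => inner ℝ (hamFlow A B t z).2 (hamFlow A B t z).1)
      (‖ContinuousLinearMap.adjoint B (hamFlow A B t z).2‖ ^ 2) t := by
  have := (hasDerivAt_hamFlow_snd A B z t).inner ℝ (hasDerivAt_hamFlow_fst A B z t)
  refine this.congr_deriv ?_
  rw [inner_add_right, inner_neg_left, ContinuousLinearMap.adjoint_inner_left,
    ← ContinuousLinearMap.adjoint_inner_left B, real_inner_self_eq_norm_sq]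
  ring

/-- The pairing of costate `q` and state has derivative `|B* q|²`, hence is monotone; it vanishes at
both ends since the state does. So `B* q = 0` on `(0, 1)`. Differentiating `⟨q, Aʲ B u⟩ = 0` with
`q' = -A* q` raises `j` by one, and continuity carries the identity to `t = 0`, where `q = p`. -/
theorem hamFlow_costate_unobservable {p : V} (h : (hamFlow A B 1 (0, p)).1 = 0) (j : ℕ) (u : W) :
    inner ℝ p ((A ^ j) (B u)) = 0 := by
  set q : ℝ → V := fun t => (hamFlow A B t (0, p)).2 with hq
  have hqc : Continuous q := continuous_snd.comp (continuous_hamFlow A B (0, p))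
  have hD := hasDerivAt_hamFlow_inner A B (0, p)
  have hmono : Monotone fun t => inner ℝ (hamFlow A B t (0, p)).2 (hamFlow A B t (0, p)).1 :=
    monotone_of_deriv_nonneg (fun t => (hD t).differentiableAt) fun t => by
      rw [(hD t).deriv]; positivity
  have hB : ∀ t ∈ Ioo (0 : ℝ) 1, ∀ u, inner ℝ (q t) (B u) = 0 := by
    intro t ht u
    have hc : (fun t => inner ℝ (hamFlow A B t (0, p)).2 (hamFlow A B t (0, p)).1)
        =ᶠ[nhds t] fun _ => (0 : ℝ) := by
      filter_upwards [Ioo_mem_nhds ht.1 ht.2] with s hs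
      have h1 := hmono hs.1.le
      have h2 := hmono hs.2.le
      simp only [hamFlow_zero, h, inner_zero_right] at h1 h2
      exact le_antisymm h2 h1
    have h0 := (hD t).unique ((hasDerivAt_const t (0 : ℝ)).congr_of_eventuallyEq hc)
    have h1 : ContinuousLinearMap.adjoint B (q t) = 0 := by
      simpa using h0
    rw [← ContinuousLinearMap.adjoint_inner_left, h1, inner_zero_left]
  have hj : ∀ j : ℕ, ∀ t ∈ Ioo (0 : ℝ) 1, inner ℝ (q t) ((A ^ j) (B u)) = 0 := by
    intro j
    induction j with
    | zero => intro t ht; simpa using hB t ht u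
    | succ j ih =>
      intro t ht
      have hc : (fun t => inner ℝ (q t) ((A ^ j) (B u))) =ᶠ[nhds t] fun _ => (0 : ℝ) := by
        filter_upwards [Ioo_mem_nhds ht.1 ht.2] with s hs using ih s hs
      have hd := (hasDerivAt_hamFlow_snd A B (0, p) t).inner ℝ
        (hasDerivAt_const t ((A ^ j) (B u)))
      have h0 := hd.unique ((hasDerivAt_const t (0 : ℝ)).congr_of_eventuallyEq hc)
      rw [inner_zero_right, zero_add, inner_neg_left, neg_eq_zero,
        ContinuousLinearMap.adjoint_inner_left] at h0
      rw [pow_succ']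
      exact h0
  have hcl : IsClosed {t | inner ℝ (q t) ((A ^ j) (B u)) = 0} :=
    isClosed_eq (hqc.inner continuous_const) continuous_const
  have hsub := hcl.closure_subset_iff.2 (fun t ht => hj j t ht : Ioo (0 : ℝ) 1 ⊆ _)
  rw [closure_Ioo zero_ne_one] at hsub
  have := hsub (left_mem_Icc.2 zero_le_one)
  simpa [hq, hamFlow_zero] using this

variable {A B}
variable {G : Type*} [NormedAddCommGroup G] [NormedSpace ℝ G] {π : V →L[ℝ] G} {M : G →L[ℝ] G}

theorem hamFlow_uncontrolled_eq (hπA : ∀ z, π (A z) = M (π z)) (hπB : ∀ u, π (B u) = 0)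
    {y : ℝ → G} (hy : ∀ t, HasDerivAt y (M (y t)) t) {z : V × V} (h0 : π z.1 = y 0) :
    π (hamFlow A B 1 z).1 = y 1 := by
  have hd : ∀ t, HasDerivAt (fun t => π (hamFlow A B t z).1) (M (π (hamFlow A B t z).1)) t :=
    fun t => by
      refine (π.hasFDerivAt.comp_hasDerivAt t (hasDerivAt_hamFlow_fst A B z t)).congr_deriv ?_
      simp [hπA, hπB]
  exact eqOn_of_hasDerivAt M (a := 0) (c := 1) hd hy (by simpa [hamFlow_zero] using h0)
    (right_mem_Icc.2 zero_le_one)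

variable [FiniteDimensional ℝ V]

/-- Starting from state 0, the map from initial costate to final state preserves `ker π`. A costate
of `ker π` sent to 0 is unobservable, hence by `hctrl` orthogonal to itself. Injective in finite
dimension, the map is invertible on `ker π`, and `κ` is the norm of its inverse. -/
theorem exists_costate (hπA : ∀ z, π (A z) = M (π z)) (hπB : ∀ u, π (B u) = 0)
    (hctrl : ∀ p : V, (∀ (j : ℕ) (u : W), inner ℝ p ((A ^ j) (B u)) = 0) →
      ∀ z, π z = 0 → inner ℝ p z = 0) :
    ∃ κ, 0 ≤ κ ∧ ∀ d, π d = 0 → ∃ p, (hamFlow A B 1 (0, p)).1 = d ∧ ‖p‖ ≤ κ * ‖d‖ := by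
  set S := LinearMap.ker (π : V →ₗ[ℝ] G)
  set L₀ : V →L[ℝ] V := ((ContinuousLinearMap.fst ℝ V V).comp (hamFlow A B 1)).comp
    (ContinuousLinearMap.inr ℝ V V) with hL₀
  have hL₀a : ∀ p, L₀ p = (hamFlow A B 1 (0, p)).1 := fun p => rfl
  have hS : ∀ p ∈ S, (L₀ : V →ₗ[ℝ] V) p ∈ S := fun p hp => by
    have := hamFlow_uncontrolled_eq (A := A) (B := B) hπA hπB (y := fun _ => 0)
      (fun t => by simpa using hasDerivAt_const t (0 : G)) (z := (0, p)) (by simp)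
    simpa [S, hL₀a] using this
  set L : S →ₗ[ℝ] S := (L₀ : V →ₗ[ℝ] V).restrict hS
  have hinj : Function.Injective L := by
    rw [← LinearMap.ker_eq_bot, LinearMap.ker_eq_bot']
    intro p hp
    have h1 : (hamFlow A B 1 (0, (p : V))).1 = 0 := congrArg Subtype.val hp
    have h2 := hctrl p (hamFlow_costate_unobservable A B h1) p p.2
    exact Subtype.ext (inner_self_eq_zero.1 h2)
  set e := (LinearEquiv.ofInjectiveEndo L hinj).toContinuousLinearEquiv
  refine ⟨‖(e.symm : S →L[ℝ] S)‖, ContinuousLinearMap.opNorm_nonneg _, fun d hd => ?_⟩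
  set d' : S := ⟨d, by simpa [S] using hd⟩
  refine ⟨(e.symm d' : S), ?_, ?_⟩
  · exact congrArg Subtype.val (e.apply_symm_apply d')
  · exact (e.symm : S →L[ℝ] S).le_opNorm d'

theorem exists_steering (hπA : ∀ z, π (A z) = M (π z)) (hπB : ∀ u, π (B u) = 0)
    (hctrl : ∀ p : V, (∀ (j : ℕ) (u : W), inner ℝ p ((A ^ j) (B u)) = 0) →
      ∀ z, π z = 0 → inner ℝ p z = 0) :
    ∃ κ, 0 ≤ κ ∧ ∀ y : ℝ → G, (∀ t, HasDerivAt y (M (y t)) t) → ∀ (a : ℝ) (x₀ x₁ : V),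
      π x₀ = y a → π x₁ = y (a + 1) → ∃ (ξ : ℝ → V) (w : ℝ → W), IsSol A B a (a + 1) ξ w ∧
        ξ a = x₀ ∧ ξ (a + 1) = x₁ ∧ ∀ t ∈ Icc a (a + 1),
          ‖ξ t‖ ≤ κ * (‖x₀‖ + ‖x₁‖) ∧ ‖w t‖ ≤ κ * (‖x₀‖ + ‖x₁‖) := by
  obtain ⟨κ₁, hκ₁, hp⟩ := exists_costate hπA hπB hctrl
  obtain ⟨κ₂, hκ₂0, hκ₂⟩ := exists_linearFlow_bound (hamiltonian A B)
  set β := ‖ContinuousLinearMap.adjoint B‖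
  set κ₃ := κ₂ * (1 + κ₁ * (1 + κ₂)) with hκ₃
  have hκ₃0 : 0 ≤ κ₃ := by positivity
  refine ⟨(1 + β) * κ₃, by positivity, fun y hy a x₀ x₁ h0 h1 => ?_⟩
  have hy' : ∀ t, HasDerivAt (fun t => y (t + a)) (M (y (t + a))) t := fun t =>
    (hy (t + a)).comp_add_const t a
  -- The uncontrolled parts of the target and of the arc with zero initial costate both equal `y (a
  -- + 1)`, so their difference can be corrected by a costate.
  have hd : π (x₁ - (hamFlow A B 1 (x₀, 0)).1) = 0 := by
    rw [map_sub, hamFlow_uncontrolled_eq (y := fun t => y (t + a)) hπA hπB hy' (by simpa using h0),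
      h1, add_comm, sub_self]
  obtain ⟨p, hp1, hp2⟩ := hp _ hd
  set z := hamFlow A B with hz
  have hzp : (z 1 (x₀, p)).1 = x₁ := by
    have : (x₀, p) = (x₀, 0) + ((0, p) : V × V) := by simp
    rw [this, map_add, Prod.fst_add, hp1]; abel
  have hn1 : ‖(z 1 (x₀, 0)).1‖ ≤ κ₂ * ‖x₀‖ := by
    refine (norm_fst_le _).trans ((hκ₂ 1 (right_mem_Icc.2 zero_le_one) _).trans ?_)
    rw [Prod.norm_mk, norm_zero, max_eq_left (norm_nonneg _)]
  have hnp : ‖p‖ ≤ κ₁ * (1 + κ₂) * (‖x₀‖ + ‖x₁‖) := by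
    have : ‖x₁ - (z 1 (x₀, 0)).1‖ ≤ (1 + κ₂) * (‖x₀‖ + ‖x₁‖) := by
      refine (norm_sub_le _ _).trans ?_
      nlinarith [norm_nonneg x₀, norm_nonneg x₁, mul_nonneg hκ₂0 (norm_nonneg x₁)]
    calc ‖p‖ ≤ κ₁ * ‖x₁ - (z 1 (x₀, 0)).1‖ := hp2
      _ ≤ κ₁ * ((1 + κ₂) * (‖x₀‖ + ‖x₁‖)) := by gcongr
      _ = _ := by ring
  have hbound : ∀ t ∈ Icc a (a + 1), ‖z (t - a) (x₀, p)‖ ≤ κ₃ * (‖x₀‖ + ‖x₁‖) := by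
    intro t ht
    have ht' : t - a ∈ Icc (0 : ℝ) 1 := ⟨by linarith [ht.1], by linarith [ht.2]⟩
    have hm : ‖((x₀, p) : V × V)‖ ≤ (1 + κ₁ * (1 + κ₂)) * (‖x₀‖ + ‖x₁‖) := by
      rw [Prod.norm_mk]
      refine max_le ?_ ?_
      · have : 0 ≤ κ₁ * (1 + κ₂) * (‖x₀‖ + ‖x₁‖) := by positivity
        nlinarith [norm_nonneg x₁]
      · nlinarith [norm_nonneg x₀, norm_nonneg x₁]
    calc ‖z (t - a) (x₀, p)‖ ≤ κ₂ * ‖((x₀, p) : V × V)‖ := hκ₂ _ ht' _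
      _ ≤ κ₂ * ((1 + κ₁ * (1 + κ₂)) * (‖x₀‖ + ‖x₁‖)) := by gcongr
      _ = _ := by rw [hκ₃]; ring
  have hcz : Continuous fun t => z (t - a) (x₀, p) :=
    (continuous_hamFlow A B (x₀, p)).comp (continuous_id.sub continuous_const)
  refine ⟨fun t => (z (t - a) (x₀, p)).1,
    fun t => ContinuousLinearMap.adjoint B (z (t - a) (x₀, p)).2, ?_, ?_, ?_, fun t ht => ?_⟩
  · refine IsSol.of_hasDerivAt ((ContinuousLinearMap.continuous _).comp
      (continuous_snd.comp hcz)) fun t => ?_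
    exact (hasDerivAt_hamFlow_fst A B (x₀, p) (t - a)).comp_sub_const t a
  · simp [hz, hamFlow_zero]
  · simpa using hzp
  · have hb := hbound t ht
    have hs : 0 ≤ κ₃ * (‖x₀‖ + ‖x₁‖) := by positivity
    constructor
    · refine ((norm_fst_le _).trans hb).trans ?_
      have : 0 ≤ β * (κ₃ * (‖x₀‖ + ‖x₁‖)) := by positivity
      linarith
    · refine ((ContinuousLinearMap.adjoint B).le_opNorm _).trans ?_
      have : β * ‖(z (t - a) (x₀, p)).2‖ ≤ β * (κ₃ * (‖x₀‖ + ‖x₁‖)) := by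
        gcongr; exact (norm_snd_le _).trans hb
      linarith

end Steering

/-! ### Exponential decay on the stable subspace -/

section Stable

variable {l : ℕ}

/-- The initial values of exponentially decaying solutions of a complex linear equation. -/
noncomputable def decaying (φ : (Fin l → ℂ) →ₗ[ℂ] (Fin l → ℂ)) : Submodule ℂ (Fin l → ℂ) where
  carrier := {v | ∃ z : ℝ → Fin l → ℂ, (∀ t, HasDerivAt z (φ (z t)) t) ∧ z 0 = v ∧
    ∃ C α : ℝ, 0 < α ∧ 0 ≤ C ∧ ∀ t, 0 ≤ t → ‖z t‖ ≤ C * Real.exp (-α * t)}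
  zero_mem' := ⟨fun _ => 0, fun t => by simpa using hasDerivAt_const t (0 : Fin l → ℂ), rfl,
    0, 1, one_pos, le_rfl, fun t _ => by simp⟩
  add_mem' := by
    rintro v v' ⟨z, hz, hz0, C, α, hα, hC, hb⟩ ⟨z', hz', hz0', C', α', hα', hC', hb'⟩
    refine ⟨fun t => z t + z' t, fun t => by simpa using (hz t).fun_add (hz' t), by
      simp [hz0, hz0'], C + C', min α α', lt_min hα hα', add_nonneg hC hC', fun t ht => ?_⟩
    have h1 : Real.exp (-α * t) ≤ Real.exp (-min α α' * t) := by
      gcongr; exact min_le_left _ _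
    have h2 : Real.exp (-α' * t) ≤ Real.exp (-min α α' * t) := by
      gcongr; exact min_le_right _ _
    calc ‖z t + z' t‖ ≤ ‖z t‖ + ‖z' t‖ := norm_add_le _ _
      _ ≤ C * Real.exp (-α * t) + C' * Real.exp (-α' * t) := add_le_add (hb t ht) (hb' t ht)
      _ ≤ C * Real.exp (-min α α' * t) + C' * Real.exp (-min α α' * t) := by gcongr
      _ = _ := by ring
  smul_mem' := by
    rintro r v ⟨z, hz, hz0, C, α, hα, hC, hb⟩
    refine ⟨fun t => r • z t, fun t => by simpa using (hz t).fun_const_smul r, by simp [hz0],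
      ‖r‖ * C, α, hα, by positivity, fun t ht => ?_⟩
    rw [norm_smul, mul_assoc]
    gcongr
    exact hb t ht

theorem hasDerivAt_nilpotent_exp (N : (Fin l → ℂ) →ₗ[ℂ] (Fin l → ℂ)) {v : Fin l → ℂ} {k : ℕ}
    (hk : (N ^ k) v = 0) (t : ℝ) :
    HasDerivAt (fun t : ℝ => ∑ j ∈ Finset.range k, (t ^ j / (j.factorial : ℝ)) • (N ^ j) v)
      (N (∑ j ∈ Finset.range k, (t ^ j / (j.factorial : ℝ)) • (N ^ j) v)) t := by
  have hd : HasDerivAt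
      (fun t : ℝ => ∑ j ∈ Finset.range k, (t ^ j / (j.factorial : ℝ)) • (N ^ j) v)
      (∑ j ∈ Finset.range k, ((j : ℝ) * t ^ (j - 1) / (j.factorial : ℝ)) • (N ^ j) v) t :=
    HasDerivAt.fun_sum fun j _ => ((hasDerivAt_pow j t).div_const _).smul_const _
  refine hd.congr_deriv ?_
  rw [map_sum]
  have e1 : ∑ j ∈ Finset.range k, N ((t ^ j / (j.factorial : ℝ)) • (N ^ j) v) =
      ∑ j ∈ Finset.range k, (t ^ j / (j.factorial : ℝ)) • (N ^ (j + 1)) v := by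
    refine Finset.sum_congr rfl fun j _ => ?_
    rw [LinearMap.map_smul_of_tower, pow_succ', Module.End.mul_apply]
  rw [e1]
  cases k with
  | zero => simp
  | succ k =>
    rw [Finset.sum_range_succ', Finset.sum_range_succ, hk]
    simp only [Nat.cast_zero, zero_mul, zero_div, zero_smul, add_zero, smul_zero]
    refine Finset.sum_congr rfl fun j _ => ?_
    congr 1
    rw [Nat.factorial_succ, add_tsub_cancel_right]
    push_cast
    have : (j.factorial : ℝ) ≠ 0 := by positivity
    field_simp

/-- With `N = φ - μ` nilpotent on `v`, the solution is `e^{μt} ∑ tʲ/j! Nʲ v`. Half of the decay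
rate, `ε = -Re μ / 2`, pays for the polynomial through `tʲ/j! ≤ ε⁻ʲ e^{εt}`. -/
theorem maxGenEigenspace_le_decaying (φ : (Fin l → ℂ) →ₗ[ℂ] (Fin l → ℂ)) {μ : ℂ} (hμ : μ.re < 0) :
    Module.End.maxGenEigenspace φ μ ≤ decaying φ := by
  intro v hv
  obtain ⟨k, hk⟩ := Module.End.mem_maxGenEigenspace φ μ v |>.1 hv
  set N := φ - μ • 1 with hN
  set q : ℝ → Fin l → ℂ :=
    fun t => ∑ j ∈ Finset.range k, (t ^ j / (j.factorial : ℝ)) • (N ^ j) v with hq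
  have hqd : ∀ t, HasDerivAt q (N (q t)) t := hasDerivAt_nilpotent_exp N hk
  have hq0 : q 0 = v := by
    cases k with
    | zero => simpa [hq] using hk.symm
    | succ k => simp [hq, Finset.sum_range_succ']
  set ε := -μ.re / 2 with hε
  have hε0 : 0 < ε := by rw [hε]; linarith
  have hexp : ∀ t : ℝ, HasDerivAt (fun t : ℝ => Complex.exp (μ * t)) (μ * Complex.exp (μ * t)) t :=
    fun t => by
      have := ((Complex.ofRealCLM.hasDerivAt (x := t)).const_mul μ).cexp
      simpa [mul_comm] using this
  refine ⟨fun t => Complex.exp (μ * t) • q t, fun t => ?_, by simp [hq0],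
    ∑ j ∈ Finset.range k, (ε ^ j)⁻¹ * ‖(N ^ j) v‖, ε, hε0, by positivity, fun t ht => ?_⟩
  · refine ((hexp t).fun_smul (hqd t)).congr_deriv ?_
    rw [map_smul]
    have : φ (q t) = N (q t) + μ • q t := by simp [hN]
    rw [this]
    module
  · have h1 : ‖q t‖ ≤ (∑ j ∈ Finset.range k, (ε ^ j)⁻¹ * ‖(N ^ j) v‖) * Real.exp (ε * t) := by
      rw [Finset.sum_mul]
      refine norm_sum_le_of_le _ fun j _ => ?_
      rw [norm_smul, Real.norm_of_nonneg (by positivity)]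
      have := Real.pow_div_factorial_le_exp (ε * t) (by positivity) j
      have h2 : t ^ j / (j.factorial : ℝ) ≤ (ε ^ j)⁻¹ * Real.exp (ε * t) := by
        rw [inv_mul_eq_div, le_div_iff₀ (by positivity)]
        calc t ^ j / (j.factorial : ℝ) * ε ^ j = (ε * t) ^ j / (j.factorial : ℝ) := by ring
          _ ≤ _ := this
      calc t ^ j / (j.factorial : ℝ) * ‖(N ^ j) v‖
          ≤ (ε ^ j)⁻¹ * Real.exp (ε * t) * ‖(N ^ j) v‖ := by gcongr
        _ = _ := by ring
    have h3 : ‖Complex.exp (μ * t)‖ = Real.exp (-ε * t) * Real.exp (-ε * t) := by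
      rw [Complex.norm_exp, ← Real.exp_add]
      congr 1
      simp [hε]
      ring
    have h4 : Real.exp (-ε * t) * Real.exp (ε * t) = 1 := by
      rw [← Real.exp_add]; simp
    rw [norm_smul, h3]
    calc Real.exp (-ε * t) * Real.exp (-ε * t) * ‖q t‖
        ≤ Real.exp (-ε * t) * Real.exp (-ε * t) *
          ((∑ j ∈ Finset.range k, (ε ^ j)⁻¹ * ‖(N ^ j) v‖) * Real.exp (ε * t)) := by gcongr
      _ = (∑ j ∈ Finset.range k, (ε ^ j)⁻¹ * ‖(N ^ j) v‖) * Real.exp (-ε * t) *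
          (Real.exp (-ε * t) * Real.exp (ε * t)) := by ring
      _ = _ := by rw [h4, mul_one]

/-- The real part of a complex vector. -/
noncomputable def realPart (l : ℕ) : (Fin l → ℂ) →L[ℝ] E l :=
  LinearMap.toContinuousLinearMap
    { toFun := fun z => WithLp.toLp 2 fun i => (z i).re
      map_add' := fun z z' => by ext i; simp
      map_smul' := fun r z => by ext i; simp }

theorem realPart_apply (z : Fin l → ℂ) (i : Fin l) : realPart l z i = (z i).re := rfl

/-- Since `M` is real, the real part of the decaying complex solution solves the real equation. -/
theorem exists_decaying_solution (M : Matrix (Fin l) (Fin l) ℝ) {y₁ : E l} (h : y₁ ∈ G₁ M) :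
    ∃ y : ℝ → E l, (∀ t, HasDerivAt y (lin M (y t)) t) ∧ y 0 = y₁ ∧
      ∃ C α : ℝ, 0 < α ∧ 0 ≤ C ∧ ∀ t, 0 ≤ t → ‖y t‖ ≤ C * Real.exp (-α * t) := by
  set φ := Matrix.toLin' (M.map ((↑) : ℝ → ℂ)) with hφ
  have hle : stableComplex M ≤ decaying φ :=
    iSup₂_le fun μ hμ => maxGenEigenspace_le_decaying φ hμ.2
  obtain ⟨z, hz, hz0, C, α, hα, hC, hb⟩ := hle h
  refine ⟨fun t => realPart l (z t), fun t => ?_, ?_, ‖realPart l‖ * C, α, hα, by positivity,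
    fun t ht => ?_⟩
  · refine ((realPart l).hasFDerivAt.comp_hasDerivAt t (hz t)).congr_deriv ?_
    ext i
    rw [realPart_apply, hφ, Matrix.toLin'_apply]
    simp [Matrix.mulVec, dotProduct, realPart_apply]
  · ext i
    simp [realPart_apply, hz0]
  · rw [mul_assoc]
    exact ((realPart l).le_opNorm _).trans (by gcongr; exact hb t ht)

end Stable

/-! ### The controllable subspace and the uncontrollable block -/

section Controllable

variable {n m l : ℕ} (A : Matrix (Fin n) (Fin n) ℝ) (B : Matrix (Fin n) (Fin m) ℝ)

theorem lin_mul_apply {p q r : ℕ} (M : Matrix (Fin p) (Fin q) ℝ) (N : Matrix (Fin q) (Fin r) ℝ)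
    (z : E r) : lin (M * N) z = lin M (lin N z) := by
  ext i; simp [Matrix.toLpLin_apply]

/-- Cayley–Hamilton reduces every power of `A` to powers below `n`. This makes the subspace
`A`-invariant. -/
theorem lin_pow_mul_mem_controllable (k : ℕ) (u : E m) :
    lin (A ^ k * B) u ∈ controllable A B := by
  rcases Nat.eq_zero_or_pos n with rfl | hn
  · rw [Subsingleton.elim (lin (A ^ k * B) u) 0]; exact Submodule.zero_mem _
  have : NeZero n := ⟨hn.ne'⟩
  have hdeg : (Polynomial.X ^ k %ₘ A.charpoly).natDegree < n := by
    have h1 := Polynomial.natDegree_modByMonic_lt (Polynomial.X ^ k) A.charpoly_monic (by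
      intro h
      have := congrArg Polynomial.natDegree h
      rw [A.charpoly_natDegree_eq_dim] at this
      simp at this
      omega)
    simpa [A.charpoly_natDegree_eq_dim] using h1
  rw [Matrix.pow_eq_aeval_mod_charpoly, Polynomial.aeval_eq_sum_range' hdeg, Matrix.sum_mul]
  have e : ∀ s : Finset ℕ, ∀ N : ℕ → Matrix (Fin n) (Fin m) ℝ,
      lin (∑ j ∈ s, N j) u = ∑ j ∈ s, lin (N j) u := fun s N => by
    have := map_sum Matrix.toEuclideanLin N s
    rw [lin, this, LinearMap.sum_apply]
  rw [e]
  refine Submodule.sum_mem _ fun j hj => ?_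
  rw [Matrix.smul_mul, lin, map_smul, LinearMap.smul_apply]
  exact Submodule.smul_mem _ _ (Submodule.mem_iSup_of_mem (⟨j, Finset.mem_range.1 hj⟩ : Fin n)
    ⟨u, rfl⟩)

theorem lin_range_subset_controllable (u : E m) : lin B u ∈ controllable A B := by
  simpa using lin_pow_mul_mem_controllable A B 0 u

theorem lin_mem_controllable {z : E n} (hz : z ∈ controllable A B) :
    lin A z ∈ controllable A B := by
  have : controllable A B ≤ (controllable A B).comap (lin A) := by
    refine iSup_le fun j => ?_
    rintro _ ⟨u, rfl⟩
    rw [Submodule.mem_comap, ← lin_mul_apply, ← Matrix.mul_assoc, ← pow_succ']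
    exact lin_pow_mul_mem_controllable A B _ u
  exact this hz

/-- Each generator is either in the image of `B` (exponent 0) or `A` applied to a generator of lower
exponent. Used to solve the steady equation without changing `P₂ᵀ z`. -/
theorem exists_steady_of_mem_controllable {d : E n} (hd : d ∈ controllable A B) :
    ∃ z ∈ controllable A B, ∃ u, lin A z + lin B u = d := by
  have hle : controllable A B ≤
      (controllable A B).map (lin A) ⊔ LinearMap.range (lin B) := by
    refine iSup_le fun j => ?_
    rintro _ ⟨u, rfl⟩
    rcases Nat.eq_zero_or_pos (j : ℕ) with hj | hj
    · rw [hj, pow_zero, Matrix.one_mul]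
      exact Submodule.mem_sup_right ⟨u, rfl⟩
    · refine Submodule.mem_sup_left ⟨lin (A ^ ((j : ℕ) - 1) * B) u,
        lin_pow_mul_mem_controllable A B _ u, ?_⟩
      rw [← lin_mul_apply, ← Matrix.mul_assoc, ← pow_succ', Nat.sub_add_cancel hj]
  obtain ⟨_, ⟨z, hz, rfl⟩, _, ⟨u, rfl⟩, h⟩ := Submodule.mem_sup.1 (hle hd)
  exact ⟨z, hz, u, h⟩

variable {A B}

section ColMatrix

variable (v : OrthonormalBasis (Fin l) ℝ ↥(controllable A B)ᗮ)

theorem colMatrix_transpose_apply (z : E n) (j : Fin l) :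
    lin (colMatrix v).transpose z j = inner ℝ (v j : E n) z := by
  simp [Matrix.toLpLin_apply, colMatrix, Matrix.mulVec, dotProduct, PiLp.inner_apply, mul_comm]

theorem colMatrix_apply (y : E l) : lin (colMatrix v) y = ∑ j, y j • (v j : E n) := by
  ext i
  simp [Matrix.toLpLin_apply, colMatrix, Matrix.mulVec, dotProduct, mul_comm]

theorem colMatrix_transpose_colMatrix (y : E l) :
    lin (colMatrix v).transpose (lin (colMatrix v) y) = y := by
  ext j
  rw [colMatrix_transpose_apply, colMatrix_apply, inner_sum]
  have : ∀ i, inner ℝ (v j : E n) (v i : E n) = if j = i then (1 : ℝ) else 0 := fun i => by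
    rw [← Submodule.coe_inner]; exact orthonormal_iff_ite.1 v.orthonormal j i
  simp [inner_smul_right, this]

theorem colMatrix_transpose_eq_zero_iff (z : E n) :
    lin (colMatrix v).transpose z = 0 ↔ z ∈ controllable A B := by
  constructor
  · intro h
    rw [← Submodule.orthogonal_orthogonal (controllable A B), Submodule.mem_orthogonal]
    intro w hw
    have h1 : (⟨w, hw⟩ : ↥(controllable A B)ᗮ) = ∑ j, inner ℝ (v j) ⟨w, hw⟩ • v j :=
      (v.sum_repr' _).symm
    have h2 := congrArg Subtype.val h1
    simp only [Submodule.coe_sum, Submodule.coe_smul] at h2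
    rw [h2, sum_inner]
    refine Finset.sum_eq_zero fun j _ => ?_
    rw [inner_smul_left, ← colMatrix_transpose_apply, h]
    simp
  · intro h
    ext j
    rw [colMatrix_transpose_apply, Submodule.inner_left_of_mem_orthogonal h (v j).2]
    rfl

/-- The vector `z - P₂ P₂ᵀ z` is controllable; `A` keeps it so, and `P₂ᵀ` then kills it. -/
theorem colMatrix_transpose_lin (z : E n) :
    lin (colMatrix v).transpose (lin A z) =
      lin (block A (colMatrix v)) (lin (colMatrix v).transpose z) := by
  rw [block, lin_mul_apply, lin_mul_apply, ← sub_eq_zero, ← map_sub, ← map_sub,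
    colMatrix_transpose_eq_zero_iff]
  refine lin_mem_controllable A B ?_
  rw [← colMatrix_transpose_eq_zero_iff v, map_sub, colMatrix_transpose_colMatrix, sub_self]

theorem colMatrix_transpose_range (u : E m) : lin (colMatrix v).transpose (lin B u) = 0 :=
  (colMatrix_transpose_eq_zero_iff v _).2 (lin_range_subset_controllable A B u)

theorem inner_eq_zero_of_unobservable {p : E n}
    (hp : ∀ (j : ℕ) (u : E m), inner ℝ p (lin (A ^ j * B) u) = 0) {z : E n}
    (hz : lin (colMatrix v).transpose z = 0) : inner ℝ p z = 0 := by
  have hle : controllable A B ≤ (ℝ ∙ p)ᗮ := by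
    refine iSup_le fun j => ?_
    rintro _ ⟨u, rfl⟩
    exact Submodule.mem_orthogonal_singleton_iff_inner_right.2 (hp j u)
  exact Submodule.mem_orthogonal_singleton_iff_inner_right.1
    (hle ((colMatrix_transpose_eq_zero_iff v z).1 hz))

end ColMatrix

end Controllable

section Projection

variable {l : ℕ} (M : Matrix (Fin l) (Fin l) ℝ)

/-- This is what makes the uncontrolled part of the deviation from the static solution start in the
stable subspace. -/
theorem sub_Q₂_mem_G₁ (y : ↥(G₁ M ⊔ G₂ M)) : (y : E l) - (Q₂ M y : E l) ∈ G₁ M := by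
  obtain ⟨⟨a, b⟩, rfl⟩ := (splitEquiv M).surjective y
  have h1 : ((splitEquiv M (a, b) : ↥(G₁ M ⊔ G₂ M)) : E l) = a + b := rfl
  have h2 : Q₂ M (splitEquiv M (a, b)) = b := by simp [Q₂]
  rw [h1, h2, add_sub_cancel_right]
  exact a.2

end Projection

/-! ### The static problem and its multipliers -/

section StaticProblem

variable {n m l : ℕ} {A : Matrix (Fin n) (Fin n) ℝ} {B : Matrix (Fin n) (Fin m) ℝ} {b : E n}
  {f : E n × E m → ℝ} {c : E l} {x : E n} {δ : ℝ}

/-- Lift the prescribed uncontrolled part to `z₀`. As `Q₂` takes values in `ker A₂₂` and `A₂₂ c =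
P₂ᵀ b`, the residual `A z₀ + b` is controllable, and a correction inside the controllable subspace
removes it. -/
theorem steadySet_nonempty (v : OrthonormalBasis (Fin l) ℝ ↥(controllable A B)ᗮ)
    (hc : lin (block A (colMatrix v)) c = lin (colMatrix v).transpose b)
    (hx : x ∈ feasible A (colMatrix v) c) : (steadySet A B b (colMatrix v) c x hx).Nonempty := by
  set y := Q₂ (block A (colMatrix v)) ⟨lin (colMatrix v).transpose x + c, hx⟩ with hy
  have hker : lin (block A (colMatrix v)) (y : E l) = 0 := y.2
  set z₀ := lin (colMatrix v) ((y : E l) - c) with hz₀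
  have hz₀' : lin (colMatrix v).transpose z₀ = (y : E l) - c := colMatrix_transpose_colMatrix v _
  have hd : -(lin A z₀ + b) ∈ controllable A B := by
    refine Submodule.neg_mem _ ((colMatrix_transpose_eq_zero_iff v _).1 ?_)
    rw [map_add, colMatrix_transpose_lin, hz₀', map_sub, hker, hc]
    abel
  obtain ⟨z, hz, u, hzu⟩ := exists_steady_of_mem_controllable A B hd
  refine ⟨(z₀ + z, u), ?_, ?_⟩
  · rw [map_add, add_assoc (lin A z₀), hzu]; abel
  · rw [map_add, hz₀', (colMatrix_transpose_eq_zero_iff v z).2 hz]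
    simp [hy]

theorem isClosed_steadySet (P : Matrix (Fin n) (Fin l) ℝ) (hx : x ∈ feasible A P c) :
    IsClosed (steadySet A B b P c x hx) := by
  have h : ∀ {p q : ℕ} (M : Matrix (Fin p) (Fin q) ℝ), Continuous (lin M) := fun M =>
    (lin M).continuous_of_finiteDimensional
  refine IsClosed.inter (isClosed_eq ?_ continuous_const) (isClosed_eq ?_ continuous_const)
  · exact (((h A).comp continuous_fst).add ((h B).comp continuous_snd)).add continuous_const
  · exact ((h P.transpose).comp continuous_fst).add continuous_const

theorem midpoint_mem_steadySet {P : Matrix (Fin n) (Fin l) ℝ} {hx : x ∈ feasible A P c}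
    {p q : E n × E m} (hp : p ∈ steadySet A B b P c x hx) (hq : q ∈ steadySet A B b P c x hx) :
    (1 / 2 : ℝ) • (p + q) ∈ steadySet A B b P c x hx := by
  constructor
  · have h := congrArg₂ (fun s t => (1 / 2 : ℝ) • (s + t)) hp.1 hq.1
    simp only [add_zero, smul_zero] at h
    rw [← h]
    simp only [Prod.smul_fst, Prod.smul_snd, Prod.fst_add, Prod.snd_add, map_smul, map_add]
    module
  · have h : lin P.transpose p.1 + c = lin P.transpose q.1 + c := hp.2.trans hq.2.symm
    refine Eq.trans ?_ hp.2
    rw [Prod.smul_fst, Prod.fst_add, map_smul, map_add, ← add_right_cancel h]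
    module

theorem IsStaticSolution.unique {P : Matrix (Fin n) (Fin l) ℝ} {hx : x ∈ feasible A P c}
    (hf : ContDiff ℝ 2 f) (hδ0 : 0 < δ)
    (hδ : ∀ p h, δ * sqNorm h ≤ fderiv ℝ (fderiv ℝ f) p h h) {p q : E n × E m}
    (hp : IsStaticSolution A B b f P c x hx p) (hq : IsStaticSolution A B b f P c x hx q) :
    q = p := by
  have h1 := strongConvex_midpoint hf hδ q p
  have hm := midpoint_mem_steadySet hq.1 hp.1
  have h2 := hp.2 _ hm
  have h3 := hq.2 _ hm
  have h4 : sqNorm (q - p) ≤ 0 := by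
    by_contra h
    have : 0 < δ / 8 * sqNorm (q - p) := by
      have := not_le.1 h
      positivity
    linarith
  exact sub_eq_zero.1 (sqNorm_eq_zero h4)

theorem exists_isStaticSolution {P : Matrix (Fin n) (Fin l) ℝ} (hx : x ∈ feasible A P c)
    (hf : ContDiff ℝ 2 f) (hδ0 : 0 < δ)
    (hδ : ∀ p h, δ * sqNorm h ≤ fderiv ℝ (fderiv ℝ f) p h h)
    (hne : (steadySet A B b P c x hx).Nonempty) :
    ∃ p, IsStaticSolution A B b f P c x hx p := by
  obtain ⟨p₀, hp₀⟩ := hne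
  obtain ⟨M, -, hM⟩ := strongConvex_coercive hf hδ0 hδ
  have hcoer : ∀ᶠ q in Filter.cocompact (E n × E m) ⊓ Filter.principal (steadySet A B b P c x hx),
      f p₀ ≤ f q := by
    refine Filter.Eventually.filter_mono inf_le_left ?_
    have ht : Filter.Tendsto (fun q : E n × E m => δ / 4 * ‖q‖ ^ 2 - M) (Filter.cocompact _)
        Filter.atTop := by
      refine Filter.tendsto_atTop_add_const_right _ _ ?_
      exact ((Filter.tendsto_pow_atTop two_ne_zero).comp
        (tendsto_norm_cocompact_atTop)).const_mul_atTop (by positivity)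
    filter_upwards [ht.eventually_ge_atTop (f p₀)] with q hq
    have := mul_le_mul_of_nonneg_left (sq_norm_le_sqNorm q) (by positivity : 0 ≤ δ / 4)
    linarith [hM q]
  obtain ⟨p, hp, hmin⟩ := hf.continuous.continuousOn.exists_isMinOn' (isClosed_steadySet P hx) hp₀
    hcoer
  exact ⟨p, hp, fun q hq => hmin hq⟩

/-- By first-order optimality the derivative vanishes on the kernel of the constraint map `Λ`, so it
factors through `Λ`. -/
theorem IsStaticSolution.exists_multipliers {P : Matrix (Fin n) (Fin l) ℝ}
    {hx : x ∈ feasible A P c} (hf : ContDiff ℝ 2 f) {p : E n × E m}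
    (hp : IsStaticSolution A B b f P c x hx p) :
    ∃ (η : E n →L[ℝ] ℝ) (ν : E l →L[ℝ] ℝ), ∀ z : E n × E m,
      fderiv ℝ f p z = η (lin A z.1 + lin B z.2) + ν (lin P.transpose z.1) := by
  set Λ : E n × E m →ₗ[ℝ] E n × E l :=
    ((lin A).coprod (lin B)).prod ((lin P.transpose).comp (LinearMap.fst ℝ (E n) (E m))) with hΛ
  have hΛa : ∀ z, Λ z = (lin A z.1 + lin B z.2, lin P.transpose z.1) := fun z => rfl
  have hann : (fderiv ℝ f p : E n × E m →ₗ[ℝ] ℝ) ∈ (LinearMap.ker Λ).dualAnnihilator := by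
    rw [Submodule.mem_dualAnnihilator]
    intro z hz
    rw [LinearMap.mem_ker, hΛa, Prod.mk_eq_zero] at hz
    have hmem : ∀ s : ℝ, p + s • z ∈ steadySet A B b P c x hx := fun s => by
      constructor
      · have h1 := hp.1.1
        have h2 := congrArg (fun w => s • w) hz.1
        simp only [smul_zero] at h2
        calc lin A (p + s • z).1 + lin B (p + s • z).2 + b
            = (lin A p.1 + lin B p.2 + b) + s • (lin A z.1 + lin B z.2) := by
              simp only [Prod.fst_add, Prod.snd_add, Prod.smul_fst, Prod.smul_snd, map_add,
                map_smul]
              module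
          _ = 0 := by rw [h1, h2, add_zero]
      · have h1 := hp.1.2
        rw [Prod.fst_add, Prod.smul_fst, map_add, map_smul, hz.2, smul_zero, add_zero]
        exact h1
    have hl : HasDerivAt (fun s : ℝ => p + s • z) z 0 := by
      simpa using ((hasDerivAt_id (0 : ℝ)).smul_const z).const_add p
    have hd : HasDerivAt (fun s : ℝ => f (p + s • z)) (fderiv ℝ f p z) 0 := by
      have h1 : HasFDerivAt f (fderiv ℝ f p) (p + (0 : ℝ) • z) := by
        rw [zero_smul, add_zero]
        exact (hf.differentiable (by norm_num)).differentiableAt.hasFDerivAt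
      exact h1.comp_hasDerivAt (0 : ℝ) hl
    have hmin : IsLocalMin (fun s : ℝ => f (p + s • z)) 0 :=
      Filter.Eventually.of_forall fun s => by simpa using hp.2 _ (hmem s)
    exact hmin.hasDerivAt_eq_zero hd
  rw [← LinearMap.range_dualMap_eq_dualAnnihilator_ker] at hann
  obtain ⟨ψ, hψ⟩ := hann
  refine ⟨(ψ.comp (LinearMap.inl ℝ (E n) (E l))).toContinuousLinearMap,
    (ψ.comp (LinearMap.inr ℝ (E n) (E l))).toContinuousLinearMap, fun z => ?_⟩
  have h1 : ψ (Λ z) = fderiv ℝ f p z := LinearMap.congr_fun hψ z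
  rw [← h1, hΛa]
  simp only [LinearMap.coe_toContinuousLinearMap', LinearMap.comp_apply, LinearMap.inl_apply,
    LinearMap.inr_apply]
  rw [← map_add]
  simp

end StaticProblem

section Glue

theorem integral_glue {p q : ℝ → ℝ} {a b c : ℝ} (hab : a ≤ b) (hbc : b ≤ c)
    (hp : IntegrableOn p (Icc a b)) (hq : IntegrableOn q (Icc b c)) :
    IntegrableOn (fun t => if t ≤ b then p t else q t) (Icc a c) ∧
      ∫ t in a..c, (if t ≤ b then p t else q t) = (∫ t in a..b, p t) + ∫ t in b..c, q t := by
  have h1 : IntegrableOn (fun t => if t ≤ b then p t else q t) (Icc a b) :=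
    hp.congr_fun (fun t ht => by simp [ht.2]) measurableSet_Icc
  have h2 : IntegrableOn (fun t => if t ≤ b then p t else q t) (Icc b c) := by
    rw [integrableOn_Icc_iff_integrableOn_Ioc] at hq ⊢
    exact hq.congr_fun (fun t ht => by simp [ht.1.not_ge]) measurableSet_Ioc
  have h3 : IntegrableOn (fun t => if t ≤ b then p t else q t) (Icc a c) := by
    rw [← Icc_union_Icc_eq_Icc hab hbc]; exact h1.union h2
  refine ⟨h3, ?_⟩
  have mb : b ∈ Icc a c := ⟨hab, hbc⟩
  rw [← intervalIntegral.integral_add_adjacent_intervals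
    (h3.intervalIntegrable_of_mem (left_mem_Icc.2 (hab.trans hbc)) mb)
    (h3.intervalIntegrable_of_mem mb (right_mem_Icc.2 (hab.trans hbc)))]
  congr 1
  · refine intervalIntegral.integral_congr fun t ht => ?_
    rw [uIcc_of_le hab] at ht
    simp [ht.2]
  · rw [intervalIntegral.integral_of_le hbc, intervalIntegral.integral_of_le hbc]
    exact setIntegral_congr_fun measurableSet_Ioc fun t ht => by simp [ht.1.not_ge]

variable {V W : Type*}

theorem comp_glue (F : V × W → ℝ) (ξ ξ' : ℝ → V) (w w' : ℝ → W) (b : ℝ) :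
    (fun t => F (if t ≤ b then ξ t else ξ' t, if t ≤ b then w t else w' t)) =
      fun t => if t ≤ b then F (ξ t, w t) else F (ξ' t, w' t) := by
  ext t; split_ifs <;> rfl

end Glue

/-! ### The hole-filling recurrence -/

section Recurrence

/-- Moving `S (i+1)` to the left gives a contraction by `C/(1+C)` plus a geometric source. The
constants depend on neither the sequence nor its length, hence later not on the horizon. -/
theorem geometric_decay_of_recurrence {C q S₀ : ℝ} (hC : 0 ≤ C) (hq0 : 0 ≤ q) (hq1 : q < 1)
    (hS₀ : 0 ≤ S₀) : ∃ D r : ℝ, 0 ≤ D ∧ 0 < r ∧ r < 1 ∧ ∀ (S : ℕ → ℝ) (n : ℕ), S 0 ≤ S₀ →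
      (∀ i, i + 1 ≤ n → S (i + 1) ≤ C * (S i - S (i + 1) + q ^ (i + 1))) →
      ∀ i, i ≤ n → S i ≤ D * r ^ i := by
  -- The second entry is the midpoint of `C/(1+C)` and 1; the slack it leaves, with the summand `2 *
  -- C` of the prefactor, absorbs the source.
  set r := max q ((1 + 2 * C) / (2 + 2 * C)) with hr
  have hr1 : r < 1 := max_lt hq1 (by rw [div_lt_one (by positivity)]; linarith)
  have hr2 : (1 + 2 * C) / (2 + 2 * C) ≤ r := le_max_right _ _
  have hr0 : 0 < r := lt_of_lt_of_le (by positivity) hr2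
  rw [div_le_iff₀ (by positivity)] at hr2
  refine ⟨S₀ + 2 * C, r, by positivity, hr0, hr1, fun S n h0 hrec i => ?_⟩
  induction i with
  | zero => intro _; simp only [pow_zero, mul_one]; linarith
  | succ i ih =>
    intro hi
    have h1 := hrec i hi
    have h2 := ih (by omega)
    have h3 : q ^ (i + 1) ≤ r ^ (i + 1) := pow_le_pow_left₀ hq0 (le_max_left _ _) _
    have h4 : (1 + C) * S (i + 1) ≤ C * ((S₀ + 2 * C) * r ^ i + r ^ (i + 1)) := by
      nlinarith
    have h5 : C * ((S₀ + 2 * C) * r ^ i + r ^ (i + 1)) ≤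
        (1 + C) * ((S₀ + 2 * C) * r ^ (i + 1)) := by
      have : C * ((S₀ + 2 * C) + r) ≤ (1 + C) * ((S₀ + 2 * C) * r) := by
        nlinarith [mul_nonneg hC hS₀]
      have hri : 0 ≤ r ^ i := by positivity
      calc C * ((S₀ + 2 * C) * r ^ i + r ^ (i + 1)) = C * ((S₀ + 2 * C) + r) * r ^ i := by ring
        _ ≤ (1 + C) * ((S₀ + 2 * C) * r) * r ^ i := by gcongr
        _ = _ := by ring
    have : 0 < 1 + C := by positivity
    exact le_of_mul_le_mul_left (h4.trans h5) this

end Recurrence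

/-! ### Connecting arcs over long intervals -/

section Chain

variable {V W G : Type*} [NormedAddCommGroup V] [NormedSpace ℝ V]
  [NormedAddCommGroup W] [NormedSpace ℝ W] [NormedAddCommGroup G] [NormedSpace ℝ G]
  {A : V →L[ℝ] V} {B : W →L[ℝ] V} {π : V →L[ℝ] G} {y : ℝ → G} {κ : ℝ}

/-- Unit steering arcs are glued through the way points `z k`. On each arc `|ξ|²` and `|w|²` are at
most `κ²(a + b)² ≤ 2κ²(a² + b²)`, whence `4κ²`; the `+ 1` in the uniform bound serves the degenerate
arc `i = j`. -/
theorem exists_chain (hκ : 0 ≤ κ)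
    (hst : ∀ (a : ℝ) (x₀ x₁ : V), π x₀ = y a → π x₁ = y (a + 1) →
      ∃ (ξ : ℝ → V) (w : ℝ → W), IsSol A B a (a + 1) ξ w ∧ ξ a = x₀ ∧ ξ (a + 1) = x₁ ∧
        ∀ t ∈ Icc a (a + 1), ‖ξ t‖ ≤ κ * (‖x₀‖ + ‖x₁‖) ∧ ‖w t‖ ≤ κ * (‖x₀‖ + ‖x₁‖))
    {z : ℕ → V} {R : ℝ} (hz : ∀ k, π (z k) = y k) (hR : ∀ k, ‖z k‖ ≤ R) {i j : ℕ} (hij : i ≤ j) :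
    ∃ (ξ : ℝ → V) (w : ℝ → W), IsSol A B i j ξ w ∧ ξ i = z i ∧ ξ j = z j ∧
      (∀ t ∈ Icc (i : ℝ) j, ‖ξ t‖ ≤ (2 * κ + 1) * R ∧ ‖w t‖ ≤ (2 * κ + 1) * R) ∧
      ∫ t in (i : ℝ)..j, sqNorm (ξ t, w t) ≤
        4 * κ ^ 2 * ∑ k ∈ Finset.Ico i j, (‖z k‖ ^ 2 + ‖z (k + 1)‖ ^ 2) := by
  have hR0 : 0 ≤ R := (norm_nonneg _).trans (hR 0)
  induction j, hij using Nat.le_induction with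
  | base =>
    refine ⟨fun _ => z i, fun _ => 0, ⟨MemLp.zero, continuousOn_const, fun t ht => ?_⟩, rfl, rfl,
      fun t _ => ⟨?_, ?_⟩, by simp⟩
    · have : t = i := le_antisymm ht.2 ht.1
      simp [this]
    · nlinarith [hR i, mul_nonneg hκ hR0]
    · rw [norm_zero]; positivity
  | succ j hij ih =>
    obtain ⟨ξ, w, hs, h0, h1, hb, hI⟩ := ih
    obtain ⟨ξ', w', hs', h0', h1', hb'⟩ := hst j (z j) (z (j + 1)) (hz j)
      (by rw [hz]; push_cast; rfl)
    have hij' : (i : ℝ) ≤ j := by exact_mod_cast hij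
    have hj : (j : ℝ) ≤ j + 1 := by linarith
    have hcast : ((j + 1 : ℕ) : ℝ) = j + 1 := by push_cast; rfl
    refine ⟨_, _, by rw [hcast]; exact hs.glue hs' hij' hj (h1.trans h0'.symm), by simp [hij', h0],
      by simp [h1'], fun t ht => ?_, ?_⟩
    · rw [hcast] at ht
      by_cases htj : t ≤ j
      · simpa only [htj, if_true] using hb t ⟨ht.1, htj⟩
      · have h2 := hb' t ⟨(not_le.1 htj).le, ht.2⟩
        have h3 : κ * (‖z j‖ + ‖z (j + 1)‖) ≤ (2 * κ + 1) * R := by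
          nlinarith [hR j, hR (j + 1)]
        simp only [htj, if_false]
        exact ⟨h2.1.trans h3, h2.2.trans h3⟩
    · obtain ⟨-, hg⟩ := integral_glue hij' hj hs.integrableOn_sqNorm hs'.integrableOn_sqNorm
      rw [comp_glue sqNorm, hcast, hg, Finset.sum_Ico_succ_top hij, mul_add]
      refine add_le_add hI ?_
      have h4 : ∫ t in (j : ℝ)..(j + 1), sqNorm (ξ' t, w' t) ≤
          ∫ _ in (j : ℝ)..(j + 1), 4 * κ ^ 2 * (‖z j‖ ^ 2 + ‖z (j + 1)‖ ^ 2) := by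
        refine intervalIntegral.integral_mono_on hj
          (hs'.integrableOn_sqNorm.intervalIntegrable_of_mem (left_mem_Icc.2 hj)
            (right_mem_Icc.2 hj)) intervalIntegrable_const fun t ht => ?_
        obtain ⟨h5, h6⟩ := hb' t ht
        have h7 : ‖ξ' t‖ ^ 2 ≤ (κ * (‖z j‖ + ‖z (j + 1)‖)) ^ 2 := by gcongr
        have h8 : ‖w' t‖ ^ 2 ≤ (κ * (‖z j‖ + ‖z (j + 1)‖)) ^ 2 := by gcongr
        simp only [sqNorm]
        nlinarith [mul_nonneg (sq_nonneg κ) (sq_nonneg (‖z j‖ - ‖z (j + 1)‖))]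
      simpa using h4

theorem exists_connecting_solution (hκ : 0 ≤ κ)
    (hst : ∀ (a : ℝ) (x₀ x₁ : V), π x₀ = y a → π x₁ = y (a + 1) →
      ∃ (ξ : ℝ → V) (w : ℝ → W), IsSol A B a (a + 1) ξ w ∧ ξ a = x₀ ∧ ξ (a + 1) = x₁ ∧
        ∀ t ∈ Icc a (a + 1), ‖ξ t‖ ≤ κ * (‖x₀‖ + ‖x₁‖) ∧ ‖w t‖ ≤ κ * (‖x₀‖ + ‖x₁‖))
    {ι : G →L[ℝ] V} (hι : ∀ v, π (ι v) = v) {C q : ℝ} (hq0 : 0 < q) (hq1 : q < 1)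
    (hy : ∀ k : ℕ, ‖y k‖ ^ 2 ≤ C * q ^ k) (R : ℝ) (hR : 0 ≤ R) :
    ∃ R' D, 0 ≤ R' ∧ 0 ≤ D ∧ ∀ (i j : ℕ) (x x' : V), i < j → π x = y i → π x' = y j →
      ‖x‖ ≤ R → ‖x'‖ ≤ R →
      ∃ (ξ : ℝ → V) (w : ℝ → W), IsSol A B i j ξ w ∧ ξ i = x ∧ ξ j = x' ∧
        (∀ t ∈ Icc (i : ℝ) j, ‖ξ t‖ ≤ R' ∧ ‖w t‖ ≤ R') ∧
        ∫ t in (i : ℝ)..j, sqNorm (ξ t, w t) ≤ D * (‖x‖ ^ 2 + ‖x'‖ ^ 2 + q ^ i) := by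
  have hC : 0 ≤ C := by simpa using (sq_nonneg _).trans (hy 0)
  set Q := ‖ι‖ ^ 2 * C with hQ
  have hQ0 : 0 ≤ Q := by positivity
  have hιy : ∀ k : ℕ, ‖ι (y k)‖ ^ 2 ≤ Q * q ^ k := fun k => by
    calc ‖ι (y k)‖ ^ 2 ≤ (‖ι‖ * ‖y k‖) ^ 2 := by gcongr; exact ι.le_opNorm _
      _ = ‖ι‖ ^ 2 * ‖y k‖ ^ 2 := by ring
      _ ≤ ‖ι‖ ^ 2 * (C * q ^ k) := by gcongr; exact hy k
      _ = _ := by rw [hQ]; ring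
  refine ⟨(2 * κ + 1) * (R + √Q), 8 * κ ^ 2 * (1 + Q / (1 - q)), by positivity, ?_, ?_⟩
  · have : 0 < 1 - q := by linarith
    positivity
  intro i j x x' hij hx hx' hxR hxR'
  -- Between the ends the way points are lifts of the uncontrolled part alone, so their squared
  -- norms sum to a multiple of `q^i`. Each way point belongs to at most two arcs, which turns `4κ²`
  -- into `8κ²`.
  set z : ℕ → V := fun k => if k = i then x else if k = j then x' else ι (y k) with hz
  have hzi : z i = x := by simp [hz]
  have hzj : z j = x' := by simp [hz, hij.ne']
  have hzy : ∀ k, π (z k) = y k := fun k => by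
    simp only [hz]; split_ifs with h1 h2
    · rw [hx, h1]
    · rw [hx', h2]
    · exact hι _
  have hs := Real.sqrt_nonneg Q
  have hzR : ∀ k, ‖z k‖ ≤ R + √Q := fun k => by
    simp only [hz]; split_ifs with h1 h2
    · linarith
    · linarith
    · have : ‖ι (y k)‖ ≤ √Q := Real.le_sqrt_of_sq_le
        ((hιy k).trans (mul_le_of_le_one_right hQ0 (pow_le_one₀ hq0.le hq1.le)))
      linarith
  obtain ⟨ξ, w, h1, h2, h3, h4, h5⟩ := exists_chain hκ hst hzy hzR hij.le
  refine ⟨ξ, w, h1, h2.trans hzi, h3.trans hzj, h4, h5.trans ?_⟩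
  have hz2 : ∀ k, ‖z k‖ ^ 2 ≤ (if k = i then ‖x‖ ^ 2 else 0) + (if k = j then ‖x'‖ ^ 2 else 0) +
      Q * q ^ k := fun k => by
    have : 0 ≤ Q * q ^ k := by positivity
    have a1 := sq_nonneg ‖x'‖
    simp only [hz]; split_ifs with h1 h2
    · linarith
    · linarith
    · linarith
    · linarith [hιy k]
  set S := ∑ k ∈ Finset.Ico i (j + 1), ‖z k‖ ^ 2
  have hS : S ≤ ‖x‖ ^ 2 + ‖x'‖ ^ 2 + Q * (q ^ i / (1 - q)) := by
    refine (Finset.sum_le_sum fun k _ => hz2 k).trans ?_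
    rw [Finset.sum_add_distrib, Finset.sum_add_distrib, Finset.sum_ite_eq', Finset.sum_ite_eq',
      if_pos (by simp; omega), if_pos (by simp; omega), ← Finset.mul_sum]
    gcongr
    exact geom_sum_Ico_le_of_lt_one hq0.le hq1
  have hS1 : ∑ k ∈ Finset.Ico i j, ‖z k‖ ^ 2 ≤ S :=
    Finset.sum_le_sum_of_subset_of_nonneg (Finset.Ico_subset_Ico le_rfl (by omega))
      fun _ _ _ => sq_nonneg _
  have hS2 : ∑ k ∈ Finset.Ico i j, ‖z (k + 1)‖ ^ 2 ≤ S := by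
    rw [Finset.sum_Ico_add' (fun k => ‖z k‖ ^ 2) i j 1]
    exact Finset.sum_le_sum_of_subset_of_nonneg (Finset.Ico_subset_Ico (by omega) le_rfl)
      fun _ _ _ => sq_nonneg _
  rw [Finset.sum_add_distrib]
  have h1q : 0 < 1 - q := by linarith
  have e : Q * (q ^ i / (1 - q)) = Q / (1 - q) * q ^ i := by ring
  have hQq : 0 ≤ Q / (1 - q) := by positivity
  have hfin : S ≤ (1 + Q / (1 - q)) * (‖x‖ ^ 2 + ‖x'‖ ^ 2 + q ^ i) := by
    rw [e] at hS
    have : 0 ≤ Q / (1 - q) * (‖x‖ ^ 2 + ‖x'‖ ^ 2) := by positivity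
    have : 0 ≤ q ^ i := by positivity
    nlinarith
  calc 4 * κ ^ 2 * (∑ k ∈ Finset.Ico i j, ‖z k‖ ^ 2 + ∑ k ∈ Finset.Ico i j, ‖z (k + 1)‖ ^ 2)
      ≤ 4 * κ ^ 2 * ((1 + Q / (1 - q)) * (‖x‖ ^ 2 + ‖x'‖ ^ 2 + q ^ i) +
        (1 + Q / (1 - q)) * (‖x‖ ^ 2 + ‖x'‖ ^ 2 + q ^ i)) := by
        gcongr
        · exact hS1.trans hfin
        · exact hS2.trans hfin
    _ = _ := by ring

end Chain

/-! ### Rotated cost and comparison of trajectories -/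

section Comparison

variable {V W G : Type*} [NormedAddCommGroup V] [NormedSpace ℝ V]
  [NormedAddCommGroup W] [NormedSpace ℝ W] [NormedAddCommGroup G] [NormedSpace ℝ G]

/-- `h` is, up to terms that depend only on the uncontrolled part `π` of the state and on the end
point of the trajectory, a positive definite function `g` of at most quadratic growth on balls. -/
structure IsRotatedCost (A : V →L[ℝ] V) (B : W →L[ℝ] V) (π : V →L[ℝ] G) (h g : V × W → ℝ)
    (h₀ : ℝ) (p : V →L[ℝ] ℝ) (ν : G →L[ℝ] ℝ) (c : ℝ) : Prop where
  eq : ∀ z, h z = h₀ + p (A z.1 + B z.2) + ν (π z.1) + g z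
  cont : Continuous g
  pos : 0 < c
  lower : ∀ z, c * sqNorm z ≤ g z
  upper : ∀ R : ℝ, ∃ C, 0 ≤ C ∧ ∀ z : V × W, ‖z.1‖ ≤ R → ‖z.2‖ ≤ R → g z ≤ C * sqNorm z

variable {A : V →L[ℝ] V} {B : W →L[ℝ] V} {π : V →L[ℝ] G} {h g : V × W → ℝ} {h₀ : ℝ}
  {p : V →L[ℝ] ℝ} {ν : G →L[ℝ] ℝ} {c : ℝ}

theorem IsRotatedCost.nonneg (hr : IsRotatedCost A B π h g h₀ p ν c) (z : V × W) : 0 ≤ g z :=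
  (mul_nonneg hr.pos.le (sqNorm_nonneg z)).trans (hr.lower z)

variable {a b : ℝ} {ξ ξ' : ℝ → V} {w w' : ℝ → W}

theorem IsRotatedCost.integrableOn_iff (hr : IsRotatedCost A B π h g h₀ p ν c)
    (hs : IsSol A B a b ξ w) :
    IntegrableOn (fun t => h (ξ t, w t)) (Icc a b) ↔
      IntegrableOn (fun t => g (ξ t, w t)) (Icc a b) := by
  have h1 : IntegrableOn (fun t => h₀ + p (A (ξ t) + B (w t)) + ν (π (ξ t))) (Icc a b) :=
    ((integrable_const h₀).add (p.integrable_comp hs.integrableOn)).add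
      ((ν.comp π).integrable_comp (hs.memLp_state.integrable (by norm_num)))
  have e : (fun t => h (ξ t, w t)) =
      fun t => (h₀ + p (A (ξ t) + B (w t)) + ν (π (ξ t))) + g (ξ t, w t) := by
    ext t; exact hr.eq (ξ t, w t)
  rw [e]
  refine ⟨fun h2 => ?_, fun h2 => h1.add h2⟩
  have := h2.sub h1
  refine this.congr (Filter.Eventually.of_forall fun t => ?_)
  simp

/-- The term `p(Aξ + Bw)` is the derivative of `p(ξ)`. All terms but the last agree for two
solutions with the same ends and the same `y`, so only `∫ g` matters when they are compared. -/
theorem IsRotatedCost.integral_eq [CompleteSpace V] (hr : IsRotatedCost A B π h g h₀ p ν c)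
    (hab : a ≤ b) (hs : IsSol A B a b ξ w) {y : ℝ → G} (hy : ∀ t ∈ Icc a b, π (ξ t) = y t)
    (hg : IntegrableOn (fun t => g (ξ t, w t)) (Icc a b)) :
    ∫ t in a..b, h (ξ t, w t) = (b - a) * h₀ + p (ξ b - ξ a) + (∫ t in a..b, ν (y t)) +
      ∫ t in a..b, g (ξ t, w t) := by
  have ma : a ∈ Icc a b := ⟨le_rfl, hab⟩
  have mb : b ∈ Icc a b := ⟨hab, le_rfl⟩
  have i1 := hs.integrableOn.intervalIntegrable_of_mem ma mb
  have i2 : IntervalIntegrable (fun t => p (A (ξ t) + B (w t))) volume a b :=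
    IntegrableOn.intervalIntegrable_of_mem (p.integrable_comp hs.integrableOn) ma mb
  have i3 : IntervalIntegrable (fun t => ν (π (ξ t))) volume a b :=
    IntegrableOn.intervalIntegrable_of_mem
      ((ν.comp π).integrable_comp (hs.memLp_state.integrable (by norm_num))) ma mb
  have i4 := hg.intervalIntegrable_of_mem ma mb
  have e : (fun t => h (ξ t, w t)) =
      fun t => h₀ + p (A (ξ t) + B (w t)) + ν (π (ξ t)) + g (ξ t, w t) := by
    ext t; exact hr.eq (ξ t, w t)
  have e2 : ∫ t in a..b, ν (π (ξ t)) = ∫ t in a..b, ν (y t) :=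
    intervalIntegral.integral_congr fun t ht => by
      rw [uIcc_of_le hab] at ht
      simp only [hy t ht]
  rw [e, intervalIntegral.integral_add ((intervalIntegrable_const.add i2).add i3) i4,
    intervalIntegral.integral_add (intervalIntegrable_const.add i2) i3,
    intervalIntegral.integral_add intervalIntegrable_const i2,
    p.intervalIntegral_comp_comm i1, e2, intervalIntegral.integral_const,
    hs.sub_eq ma mb, add_sub_cancel_left, smul_eq_mul]

theorem IsRotatedCost.integral_le_of_bounded (hr : IsRotatedCost A B π h g h₀ p ν c)
    (hab : a ≤ b) (hs : IsSol A B a b ξ w) {R C : ℝ}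
    (hC : ∀ z : V × W, ‖z.1‖ ≤ R → ‖z.2‖ ≤ R → g z ≤ C * sqNorm z)
    (hb : ∀ t ∈ Icc a b, ‖ξ t‖ ≤ R ∧ ‖w t‖ ≤ R) :
    IntegrableOn (fun t => g (ξ t, w t)) (Icc a b) ∧
      ∫ t in a..b, g (ξ t, w t) ≤ C * ∫ t in a..b, sqNorm (ξ t, w t) := by
  have hi : IntegrableOn (fun t => g (ξ t, w t)) (Icc a b) := by
    refine Integrable.mono' (hs.integrableOn_sqNorm.const_mul C)
      (hs.aestronglyMeasurable_comp hr.cont) ?_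
    filter_upwards [ae_restrict_mem measurableSet_Icc] with t ht
    rw [Real.norm_of_nonneg (hr.nonneg _)]
    exact hC _ (hb t ht).1 (hb t ht).2
  refine ⟨hi, ?_⟩
  rw [← intervalIntegral.integral_const_mul]
  have ma := left_mem_Icc.2 hab
  have mb := right_mem_Icc.2 hab
  exact intervalIntegral.integral_mono_on hab (hi.intervalIntegrable_of_mem ma mb)
    ((hs.integrableOn_sqNorm.intervalIntegrable_of_mem ma mb).const_mul C)
    fun t ht => hC _ (hb t ht).1 (hb t ht).2

theorem IsRotatedCost.energy_le (hr : IsRotatedCost A B π h g h₀ p ν c)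
    (hab : a ≤ b) (hs : IsSol A B a b ξ w)
    (hg : IntegrableOn (fun t => g (ξ t, w t)) (Icc a b)) :
    c * ∫ t in a..b, sqNorm (ξ t, w t) ≤ ∫ t in a..b, g (ξ t, w t) := by
  rw [← intervalIntegral.integral_const_mul]
  have ma := left_mem_Icc.2 hab
  have mb := right_mem_Icc.2 hab
  exact intervalIntegral.integral_mono_on hab
    ((hs.integrableOn_sqNorm.intervalIntegrable_of_mem ma mb).const_mul c)
    (hg.intervalIntegrable_of_mem ma mb) fun t _ => hr.lower _

/-- Replacing a minimizer on a subinterval by a solution with the same end points does not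
decrease the cost. -/
theorem IsMin.integral_le_of_endpoints [CompleteSpace V] {T : ℝ} {x₀ : V}
    (hm : IsMin A B h T x₀ ξ w) (ha : 0 ≤ a) (hab : a ≤ b) (hb : b ≤ T) (hs : IsSol A B a b ξ' w')
    (h1 : ξ' a = ξ a) (h2 : ξ' b = ξ b) (hi : IntegrableOn (fun t => h (ξ' t, w' t)) (Icc a b)) :
    ∫ t in a..b, h (ξ t, w t) ≤ ∫ t in a..b, h (ξ' t, w' t) := by
  have hadm := hm.1
  have h0T : 0 ≤ T := ha.trans (hab.trans hb)
  have m0 : (0 : ℝ) ∈ Icc 0 T := ⟨le_rfl, h0T⟩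
  have mT : T ∈ Icc 0 T := ⟨h0T, le_rfl⟩
  have ma : a ∈ Icc 0 T := ⟨ha, hab.trans hb⟩
  have mb : b ∈ Icc 0 T := ⟨ha.trans hab, hb⟩
  have s1 := hs.glue (hadm.sol.mono (ha.trans hab) le_rfl : IsSol A B b T ξ w) hab hb h2
  have s2 := (hadm.sol.mono le_rfl (hab.trans hb) : IsSol A B 0 a ξ w).glue s1 ha (hab.trans hb)
    (by simp [hab, h1])
  obtain ⟨i1, e1⟩ := integral_glue hab hb hi
    (hadm.int.mono_set (Icc_subset_Icc (ha.trans hab) le_rfl))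
  obtain ⟨i2, e2⟩ := integral_glue ha (hab.trans hb)
    (hadm.int.mono_set (Icc_subset_Icc le_rfl (hab.trans hb))) i1
  have e : (fun t => h (if t ≤ a then ξ t else if t ≤ b then ξ' t else ξ t,
      if t ≤ a then w t else if t ≤ b then w' t else w t)) =
      fun t => if t ≤ a then h (ξ t, w t) else if t ≤ b then h (ξ' t, w' t) else h (ξ t, w t) := by
    ext t; split_ifs <;> rfl
  have hc := hm.2 _ _ ⟨s2, by simp [ha, hadm.init], by rw [e]; exact i2⟩
  rw [e, e2, e1,
    ← intervalIntegral.integral_add_adjacent_intervals (hadm.int.intervalIntegrable_of_mem m0 ma)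
      (hadm.int.intervalIntegrable_of_mem ma mT),
    ← intervalIntegral.integral_add_adjacent_intervals (hadm.int.intervalIntegrable_of_mem ma mb)
      (hadm.int.intervalIntegrable_of_mem mb mT)] at hc
  linarith

/-- On a long horizon a unit window around `t` suffices; the initial state enters only for `T ≤ 1`.
The constant does not depend on `T`. -/
theorem IsSol.sq_norm_le_initial_add_energy {T : ℝ} (hs : IsSol A B 0 T ξ w) {t : ℝ}
    (ht : t ∈ Icc 0 T) :
    ‖ξ t‖ ^ 2 ≤ (2 + 4 * (‖A‖ ^ 2 + ‖B‖ ^ 2)) *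
      (‖ξ 0‖ ^ 2 + ∫ r in (0 : ℝ)..T, sqNorm (ξ r, w r)) := by
  set D := 4 * (‖A‖ ^ 2 + ‖B‖ ^ 2) with hD
  have hD0 : 0 ≤ D := by positivity
  have hT : 0 ≤ T := ht.1.trans ht.2
  set I := ∫ r in (0 : ℝ)..T, sqNorm (ξ r, w r) with hI
  have hI0 : 0 ≤ I := intervalIntegral.integral_nonneg hT fun r _ => sqNorm_nonneg _
  have h0 := sq_nonneg ‖ξ 0‖
  rcases le_or_gt T 1 with h1 | h1
  · have := hs.sq_norm_le_of_initial (by linarith) (s := 0) ⟨le_rfl, hT⟩ ht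
    nlinarith
  · set a := min t (T - 1) with ha
    have ha0 : 0 ≤ a := le_min ht.1 (by linarith)
    have ha1 : a + 1 ≤ T := by have := min_le_right t (T - 1); linarith
    have hat : t ∈ Icc a (a + 1) := by
      refine ⟨min_le_left _ _, ?_⟩
      rcases min_choice t (T - 1) with h2 | h2 <;> rw [ha, h2]
      · linarith
      · linarith [ht.2]
    have h3 := (hs.mono ha0 ha1).sq_norm_le_of_unit hat
    have h4 : ∫ r in a..(a + 1), sqNorm (ξ r, w r) ≤ I :=
      integral_mono_subinterval hs.integrableOn_sqNorm (fun r => sqNorm_nonneg _) ha0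
        (by linarith) ha1
    calc ‖ξ t‖ ^ 2 ≤ (2 + D) * ∫ r in a..(a + 1), sqNorm (ξ r, w r) := h3
      _ ≤ (2 + D) * (‖ξ 0‖ ^ 2 + I) := by gcongr; linarith

end Comparison

/-! ### Uniform energy bound, energy decay and the turnpike estimate -/

section Estimate

variable {V W G : Type*} [NormedAddCommGroup V] [NormedSpace ℝ V]
  [NormedAddCommGroup W] [NormedSpace ℝ W]
  [NormedAddCommGroup G] [NormedSpace ℝ G]
  {A : V →L[ℝ] V} {B : W →L[ℝ] V} {π : V →L[ℝ] G} {h g : V × W → ℝ} {h₀ : ℝ}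
  {p : V →L[ℝ] ℝ} {ν : G →L[ℝ] ℝ} {c : ℝ} {M : G →L[ℝ] G} {y : ℝ → G} {x₀ : V}

/-- Connecting solutions through integer times with quadratic energy bounds. -/
def HasConnections (A : V →L[ℝ] V) (B : W →L[ℝ] V) (π : V →L[ℝ] G) (y : ℝ → G) (q : ℝ) : Prop :=
  ∀ R : ℝ, 0 ≤ R → ∃ R' D, 0 ≤ R' ∧ 0 ≤ D ∧ ∀ (i j : ℕ) (x x' : V), i < j → π x = y i →
    π x' = y j → ‖x‖ ≤ R → ‖x'‖ ≤ R →
    ∃ (ξ : ℝ → V) (w : ℝ → W), IsSol A B i j ξ w ∧ ξ i = x ∧ ξ j = x' ∧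
      (∀ t ∈ Icc (i : ℝ) j, ‖ξ t‖ ≤ R' ∧ ‖w t‖ ≤ R') ∧
      ∫ t in (i : ℝ)..j, sqNorm (ξ t, w t) ≤ D * (‖x‖ ^ 2 + ‖x'‖ ^ 2 + q ^ i)

/-- Connect up to the integer time `⌈T⌉` and restrict to `[0, T]`; the terminal state is free. -/
theorem HasConnections.exists_bounded_candidate {q R : ℝ}
    (hconn : HasConnections (W := W) A B π y q) (hR : 0 ≤ R) (hx₀ : π x₀ = y 0) (hx₀R : ‖x₀‖ ≤ R)
    (hend : ∀ k : ℕ, ∃ x', π x' = y k ∧ ‖x'‖ ≤ R) :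
    ∃ R' D, 0 ≤ R' ∧ 0 ≤ D ∧ ∀ T : ℝ, 0 < T → ∃ (ξ : ℝ → V) (w : ℝ → W), IsSol A B 0 T ξ w ∧
      ξ 0 = x₀ ∧ (∀ t ∈ Icc 0 T, ‖ξ t‖ ≤ R' ∧ ‖w t‖ ≤ R') ∧
      ∫ t in (0 : ℝ)..T, sqNorm (ξ t, w t) ≤ D := by
  obtain ⟨R', D, hR', hD, hc⟩ := hconn R hR
  refine ⟨R', D * (R ^ 2 + R ^ 2 + 1), hR', by positivity, fun T hT => ?_⟩
  obtain ⟨x', hx', hx'R⟩ := hend ⌈T⌉₊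
  have hTn : T ≤ (⌈T⌉₊ : ℝ) := Nat.le_ceil T
  obtain ⟨ξ, w, h1, h2, -, h4, h5⟩ := hc 0 ⌈T⌉₊ x₀ x' (Nat.ceil_pos.2 hT) (by simpa using hx₀)
    hx' hx₀R hx'R
  rw [Nat.cast_zero] at h1 h2 h4 h5
  refine ⟨ξ, w, h1.mono le_rfl hTn, h2, fun t ht => h4 t ⟨ht.1, ht.2.trans hTn⟩, ?_⟩
  refine (integral_mono_subinterval h1.integrableOn_sqNorm (fun _ => sqNorm_nonneg _) le_rfl hT.le
    hTn).trans (h5.trans ?_)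
  rw [pow_zero]
  gcongr

variable [CompleteSpace V] [CompleteSpace G]

/-- Finite-cost solutions exist and minimizers have energy bounded uniformly in the horizon. -/
theorem IsRotatedCost.uniform_energy_bound (hr : IsRotatedCost A B π h g h₀ p ν c)
    (hπA : ∀ z, π (A z) = M (π z)) (hπB : ∀ u, π (B u) = 0)
    (hy : ∀ t, HasDerivAt y (M (y t)) t) (hx₀ : π x₀ = y 0) {q R : ℝ}
    (hconn : HasConnections (W := W) A B π y q) (hR : 0 ≤ R) (hx₀R : ‖x₀‖ ≤ R)
    (hend : ∀ k : ℕ, ∃ x', π x' = y k ∧ ‖x'‖ ≤ R) :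
    ∃ E₀, 0 ≤ E₀ ∧ ∀ T : ℝ, 0 < T → (∃ (ξ : ℝ → V) (w : ℝ → W), IsAdm A B h T x₀ ξ w) ∧
      ∀ (ξ : ℝ → V) (w : ℝ → W), IsMin A B h T x₀ ξ w →
        ∫ t in (0 : ℝ)..T, sqNorm (ξ t, w t) ≤ E₀ := by
  obtain ⟨R', D, hR', hD, hcand⟩ := hconn.exists_bounded_candidate hR hx₀ hx₀R hend
  obtain ⟨C, hC0, hC⟩ := hr.upper R'
  set K := 2 + 4 * (‖A‖ ^ 2 + ‖B‖ ^ 2) with hK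
  have hK0 : 0 < K := by positivity
  have hc := hr.pos
  set P := C * D + ‖p‖ * R' with hP
  have hP0 : 0 ≤ P := by positivity
  refine ⟨2 / c * (P + ‖p‖ ^ 2 * K / (2 * c) + c / 2 * ‖x₀‖ ^ 2), by positivity, fun T hT => ?_⟩
  obtain ⟨ξ', w', h1, h2, h3, h4⟩ := hcand T hT
  obtain ⟨h5, h6⟩ := hr.integral_le_of_bounded hT.le h1 hC h3
  have hadm' : IsAdm A B h T x₀ ξ' w' := ⟨h1, h2, (hr.integrableOn_iff h1).2 h5⟩
  refine ⟨⟨ξ', w', hadm'⟩, fun ξ w hm => ?_⟩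
  have hyt : ∀ (ξ : ℝ → V) (w : ℝ → W), IsSol A B 0 T ξ w → ξ 0 = x₀ →
      ∀ t ∈ Icc 0 T, π (ξ t) = y t := fun ξ w hs h0 t ht =>
    hs.uncontrolled_eq hπA hπB hy (by rw [h0, hx₀]) ht
  have hg := (hr.integrableOn_iff hm.1.sol).1 hm.1.int
  have hle := hm.2 _ _ hadm'
  rw [hr.integral_eq hT.le hm.1.sol (hyt _ _ hm.1.sol hm.1.init) hg,
    hr.integral_eq hT.le h1 (hyt _ _ h1 h2) h5, map_sub, map_sub, h2, hm.1.init] at hle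
  have hen := hr.energy_le hT.le hm.1.sol hg
  have hb := hm.1.sol.sq_norm_le_initial_add_energy (right_mem_Icc.2 hT.le)
  rw [hm.1.init, ← hK] at hb
  set I := ∫ t in (0 : ℝ)..T, sqNorm (ξ t, w t)
  have hp1 : p (ξ' T) ≤ ‖p‖ * R' := (Real.le_norm_self _).trans ((p.le_opNorm _).trans
    (by gcongr; exact (h3 T (right_mem_Icc.2 hT.le)).1))
  have hp2 : -(‖p‖ * ‖ξ T‖) ≤ p (ξ T) := (neg_le_neg (p.le_opNorm _)).trans
    (neg_le_of_abs_le le_rfl)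
  have hCD : C * ∫ t in (0 : ℝ)..T, sqNorm (ξ' t, w' t) ≤ C * D := by gcongr
  have h7 : c * I ≤ P + ‖p‖ * ‖ξ T‖ := by rw [hP]; linarith
  -- The Young weight is chosen so that, after `|ξ T|² ≤ K (|x₀|² + I)`, the boundary term costs
  -- only half of the coercive term `c * I`.
  have h8 : ‖p‖ * ‖ξ T‖ ≤ c / (2 * K) * ‖ξ T‖ ^ 2 + ‖p‖ ^ 2 * K / (2 * c) := by
    have : 0 ≤ (c * ‖ξ T‖ - K * ‖p‖) ^ 2 / (2 * K * c) := by positivity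
    have e : (c * ‖ξ T‖ - K * ‖p‖) ^ 2 / (2 * K * c) =
        c / (2 * K) * ‖ξ T‖ ^ 2 + ‖p‖ ^ 2 * K / (2 * c) - ‖p‖ * ‖ξ T‖ := by
      field_simp; ring
    linarith
  have h9 : c / (2 * K) * ‖ξ T‖ ^ 2 ≤ c / 2 * (‖x₀‖ ^ 2 + I) := by
    calc c / (2 * K) * ‖ξ T‖ ^ 2 ≤ c / (2 * K) * (K * (‖x₀‖ ^ 2 + I)) := by gcongr
      _ = _ := by field_simp
  have h10 : c / 2 * I ≤ P + ‖p‖ ^ 2 * K / (2 * c) + c / 2 * ‖x₀‖ ^ 2 := by linarith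
  calc I = 2 / c * (c / 2 * I) := by field_simp
    _ ≤ _ := by gcongr

/-- The energy of a minimizer decays geometrically in the distance to the ends of the horizon. -/
theorem IsRotatedCost.energy_decay (hr : IsRotatedCost A B π h g h₀ p ν c)
    (hπA : ∀ z, π (A z) = M (π z)) (hπB : ∀ u, π (B u) = 0)
    (hy : ∀ t, HasDerivAt y (M (y t)) t) (hx₀ : π x₀ = y 0) {q E₀ : ℝ}
    (hconn : HasConnections (W := W) A B π y q) (hq0 : 0 < q) (hq1 : q < 1) (hE₀ : 0 ≤ E₀) :
    ∃ D r, 0 ≤ D ∧ 0 < r ∧ r < 1 ∧ ∀ T : ℝ, ∀ (ξ : ℝ → V) (w : ℝ → W), IsMin A B h T x₀ ξ w →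
      ∫ t in (0 : ℝ)..T, sqNorm (ξ t, w t) ≤ E₀ → ∀ i N : ℕ, (N : ℝ) ≤ T → 2 * i ≤ N →
        ∫ t in (i : ℝ)..((N - i : ℕ) : ℝ), sqNorm (ξ t, w t) ≤ D * r ^ i := by
  set K := 2 + 4 * (‖A‖ ^ 2 + ‖B‖ ^ 2) with hK
  have hK0 : 0 < K := by positivity
  set R := √(K * (‖x₀‖ ^ 2 + E₀)) with hR
  obtain ⟨R', D, hR', hD, hc⟩ := hconn R (Real.sqrt_nonneg _)
  obtain ⟨C, hC0, hC⟩ := hr.upper R'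
  have hcp := hr.pos
  -- `C * D` bounds the rotated cost of the connecting arc, `c⁻¹` returns from cost to energy, and
  -- `K` bounds the squared end states by the energy of the removed unit intervals.
  set Q := c⁻¹ * (C * D) * (K + 1) with hQ
  have hQ0 : 0 ≤ Q := by positivity
  obtain ⟨D', r, hD', hr0, hr1, hdec⟩ := geometric_decay_of_recurrence hQ0 hq0.le hq1 hE₀
  refine ⟨D', r, hD', hr0, hr1, fun T ξ w hm hE i N hN hi => ?_⟩
  have hs := hm.1.sol
  have hT : 0 ≤ T := (Nat.cast_nonneg N).trans hN
  have hi2 := hs.integrableOn_sqNorm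
  have hint : ∀ {a b : ℝ}, a ∈ Icc 0 T → b ∈ Icc 0 T →
      IntervalIntegrable (fun t => sqNorm (ξ t, w t)) volume a b :=
    fun ha hb => hi2.intervalIntegrable_of_mem ha hb
  have hRt : ∀ t ∈ Icc 0 T, ‖ξ t‖ ≤ R := fun t ht => by
    refine Real.le_sqrt_of_sq_le ((hs.sq_norm_le_initial_add_energy ht).trans ?_)
    rw [hm.1.init]
    gcongr
  have hyt : ∀ t ∈ Icc 0 T, π (ξ t) = y t := fun t ht =>
    hs.uncontrolled_eq hπA hπB hy (by rw [hm.1.init, hx₀]) ht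
  have mem : ∀ k : ℕ, k ≤ N → (k : ℝ) ∈ Icc 0 T := fun k hk =>
    ⟨Nat.cast_nonneg k, (Nat.cast_le.2 hk).trans hN⟩
  refine hdec (fun i => ∫ t in (i : ℝ)..((N - i : ℕ) : ℝ), sqNorm (ξ t, w t)) (N / 2) ?_ ?_ i
    (by omega)
  · simp only [Nat.cast_zero, Nat.sub_zero]
    exact (integral_mono_subinterval hi2 (fun _ => sqNorm_nonneg _) le_rfl
      (Nat.cast_nonneg N) hN).trans hE
  intro k hk
  have hsplit : ∫ t in (k : ℝ)..((N - k : ℕ) : ℝ), sqNorm (ξ t, w t) =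
      (∫ t in (k : ℝ)..((k + 1 : ℕ) : ℝ), sqNorm (ξ t, w t)) +
      (∫ t in ((k + 1 : ℕ) : ℝ)..((N - (k + 1) : ℕ) : ℝ), sqNorm (ξ t, w t)) +
      ∫ t in ((N - (k + 1) : ℕ) : ℝ)..((N - k : ℕ) : ℝ), sqNorm (ξ t, w t) := by
    have m1 := mem k (by omega)
    have m2 := mem (k + 1) (by omega)
    have m3 := mem (N - (k + 1)) (by omega)
    have m4 := mem (N - k) (by omega)
    rw [intervalIntegral.integral_add_adjacent_intervals (hint m1 m2) (hint m2 m3),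
      intervalIntegral.integral_add_adjacent_intervals (hint m1 m3) (hint m3 m4)]
  have hu : ∀ k : ℕ, k + 1 ≤ N → ∀ t ∈ Icc (k : ℝ) ((k + 1 : ℕ) : ℝ),
      ‖ξ t‖ ^ 2 ≤ K * ∫ t in (k : ℝ)..((k + 1 : ℕ) : ℝ), sqNorm (ξ t, w t) := fun k hk t ht => by
    have m1 := mem k (by omega)
    have m2 := mem (k + 1) hk
    push_cast at m2 ht ⊢
    exact (hs.mono m1.1 m2.2).sq_norm_le_of_unit ht
  have hx := hu k (by omega) ((k + 1 : ℕ) : ℝ) ⟨by push_cast; linarith, le_rfl⟩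
  have hx' : ‖ξ ((N - (k + 1) : ℕ) : ℝ)‖ ^ 2 ≤
      K * ∫ t in ((N - (k + 1) : ℕ) : ℝ)..((N - k : ℕ) : ℝ), sqNorm (ξ t, w t) := by
    have e : N - k = N - (k + 1) + 1 := by omega
    have := hu (N - (k + 1)) (by omega) ((N - (k + 1) : ℕ) : ℝ)
      ⟨le_rfl, by push_cast; linarith⟩
    rwa [← e] at this
  have hkk : k + 1 ≤ N - (k + 1) := by omega
  have hrec : ∫ t in ((k + 1 : ℕ) : ℝ)..((N - (k + 1) : ℕ) : ℝ), sqNorm (ξ t, w t) ≤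
      c⁻¹ * (C * D) * (‖ξ ((k + 1 : ℕ) : ℝ)‖ ^ 2 + ‖ξ ((N - (k + 1) : ℕ) : ℝ)‖ ^ 2 +
        q ^ (k + 1)) := by
    -- Connections require distinct times; when the two times agree, the inner interval is a point
    -- and carries no energy.
    rcases hkk.eq_or_lt with he | hlt
    · rw [← he, intervalIntegral.integral_same]
      positivity
    have m2 := mem (k + 1) (by omega)
    have m3 := mem (N - (k + 1)) (by omega)
    obtain ⟨ξ', w', s1, s2, s3, s4, s5⟩ := hc (k + 1) (N - (k + 1)) _ _ hlt (hyt _ m2) (hyt _ m3)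
      (hRt _ m2) (hRt _ m3)
    have hle : ((k + 1 : ℕ) : ℝ) ≤ ((N - (k + 1) : ℕ) : ℝ) := Nat.cast_le.2 hkk
    obtain ⟨g1, g2⟩ := hr.integral_le_of_bounded hle s1 hC s4
    have hs' := hs.mono m2.1 m3.2
    have hmin := hm.integral_le_of_endpoints m2.1 hle m3.2 s1 s2 s3 ((hr.integrableOn_iff s1).2 g1)
    have g3 := (hr.integrableOn_iff hs').1
      (hm.1.int.mono_set (Icc_subset_Icc m2.1 m3.2))
    rw [hr.integral_eq hle hs' (fun t ht => hyt t ⟨m2.1.trans ht.1, ht.2.trans m3.2⟩) g3,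
      hr.integral_eq hle s1 (fun t ht => s1.uncontrolled_eq hπA hπB hy
        (by rw [s2]; exact hyt _ m2) ht) g1, s2, s3] at hmin
    have hen := hr.energy_le hle hs' g3
    have h5 : c * ∫ t in ((k + 1 : ℕ) : ℝ)..((N - (k + 1) : ℕ) : ℝ), sqNorm (ξ t, w t) ≤
        C * (D * (‖ξ ((k + 1 : ℕ) : ℝ)‖ ^ 2 + ‖ξ ((N - (k + 1) : ℕ) : ℝ)‖ ^ 2 + q ^ (k + 1))) := by
      have := mul_le_mul_of_nonneg_left s5 hC0
      linarith
    rw [mul_assoc, le_inv_mul_iff₀ hcp, mul_assoc]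
    exact h5
  set I₁ := ∫ t in (k : ℝ)..((k + 1 : ℕ) : ℝ), sqNorm (ξ t, w t)
  set I₂ := ∫ t in ((N - (k + 1) : ℕ) : ℝ)..((N - k : ℕ) : ℝ), sqNorm (ξ t, w t)
  have hI₁ : 0 ≤ I₁ := by
    have := (sq_nonneg _).trans hx
    exact nonneg_of_mul_nonneg_right this hK0
  have hI₂ : 0 ≤ I₂ := by
    have := (sq_nonneg _).trans hx'
    exact nonneg_of_mul_nonneg_right this hK0
  simp only [hsplit]
  refine hrec.trans ?_
  rw [hQ, mul_assoc (c⁻¹ * (C * D))]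
  have hqk : 0 ≤ q ^ (k + 1) := by positivity
  refine mul_le_mul_of_nonneg_left ?_ (by positivity)
  have : 0 ≤ K * q ^ (k + 1) := by positivity
  linarith

/-- The exponential turnpike estimate around the origin. -/
theorem IsRotatedCost.exists_turnpike (hr : IsRotatedCost A B π h g h₀ p ν c)
    (hπA : ∀ z, π (A z) = M (π z)) (hπB : ∀ u, π (B u) = 0)
    (hy : ∀ t, HasDerivAt y (M (y t)) t) (hx₀ : π x₀ = y 0) {q R : ℝ}
    (hconn : HasConnections (W := W) A B π y q) (hq0 : 0 < q) (hq1 : q < 1)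
    (hR : 0 ≤ R) (hx₀R : ‖x₀‖ ≤ R) (hend : ∀ k : ℕ, ∃ x', π x' = y k ∧ ‖x'‖ ≤ R) :
    ∃ K lam : ℝ, 0 < K ∧ 0 < lam ∧ ∀ T : ℝ, 0 < T →
      (∃ (ξ : ℝ → V) (w : ℝ → W), IsAdm A B h T x₀ ξ w) ∧
      ∀ (ξ : ℝ → V) (w : ℝ → W), IsMin A B h T x₀ ξ w → ∀ t ∈ Icc 0 T,
        ‖ξ t‖ ≤ K * (Real.exp (-lam * t) + Real.exp (-lam * (T - t))) := by
  obtain ⟨E₀, hE₀, hen⟩ := hr.uniform_energy_bound hπA hπB hy hx₀ hconn hR hx₀R hend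
  obtain ⟨D, r, hD, hr0, hr1, hdec⟩ := hr.energy_decay hπA hπB hy hx₀ hconn hq0 hq1 hE₀
  set K := 2 + 4 * (‖A‖ ^ 2 + ‖B‖ ^ 2) with hK
  have hK0 : 0 < K := by positivity
  -- The energy is quadratic in the state, so the norm decays at half its rate.
  set lam := -Real.log r / 2 with hlam
  have hlam0 : 0 < lam := by
    have := Real.log_neg hr0 hr1
    rw [hlam]; linarith
  have hrexp : ∀ k : ℕ, r ^ k = Real.exp (-2 * lam * k) := fun k => by
    have : -2 * lam * k = k * Real.log r := by rw [hlam]; ring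
    rw [this, Real.exp_nat_mul, Real.exp_log hr0]
  -- The factor `e^{4 lam}` pays for rounding: the integer `i` below may fall short of `μ` by 2. The
  -- summands serve the cases `μ < 1` and `μ ≥ 1`, and `+ 1` keeps `Z` positive.
  set Z := (K * (‖x₀‖ ^ 2 + E₀) + K * D + 1) * Real.exp (4 * lam) with hZ
  have hZ0 : 0 < Z := by positivity
  refine ⟨√Z, lam, Real.sqrt_pos.2 hZ0, hlam0, fun T hT => ⟨(hen T hT).1, fun ξ w hm t ht => ?_⟩⟩
  have hE := (hen T hT).2 ξ w hm
  have hs := hm.1.sol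
  set μ := min t (T - t) with hμ
  have hμ1 : μ ≤ t := min_le_left _ _
  have hμ2 : μ ≤ T - t := min_le_right _ _
  have hμ0 : 0 ≤ μ := le_min ht.1 (by linarith [ht.2])
  have key : ‖ξ t‖ ^ 2 ≤ Z * Real.exp (-2 * lam * μ) := by
    have hE4 : 0 < Real.exp (4 * lam) := Real.exp_pos _
    rw [hZ, mul_assoc, ← Real.exp_add]
    rcases lt_or_ge μ 1 with h1 | h1
    · have h2 : 1 ≤ Real.exp (4 * lam + -2 * lam * μ) := Real.one_le_exp (by nlinarith)
      have h3 := hs.sq_norm_le_initial_add_energy ht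
      rw [hm.1.init, ← hK] at h3
      calc ‖ξ t‖ ^ 2 ≤ K * (‖x₀‖ ^ 2 + E₀) := h3.trans (by gcongr)
        _ ≤ K * (‖x₀‖ ^ 2 + E₀) + K * D + 1 := by
          have : 0 ≤ K * D := by positivity
          linarith
        _ ≤ _ := le_mul_of_one_le_right (by positivity) h2
    -- Subtracting 1 leaves room for a unit window containing `t` inside `[i, N - i]`, even though
    -- `N = ⌊T⌋` may be smaller than `T`.
    · set i := ⌊μ⌋₊ - 1 with hi
      set N := ⌊T⌋₊ with hN
      have hf1 : 1 ≤ ⌊μ⌋₊ := Nat.one_le_floor_iff μ |>.2 h1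
      have hic : (i : ℝ) = ⌊μ⌋₊ - 1 := by rw [hi, Nat.cast_sub hf1, Nat.cast_one]
      have hi1 : (i : ℝ) ≤ μ - 1 := by rw [hic]; linarith [Nat.floor_le hμ0]
      have hi2 : μ - 2 ≤ i := by rw [hic]; linarith [Nat.lt_floor_add_one μ]
      have hNT : (N : ℝ) ≤ T := Nat.floor_le hT.le
      have hNT' : T < N + 1 := Nat.lt_floor_add_one T
      have h2i : (2 * i + 1 : ℝ) < N := by linarith
      have h2i' : 2 * i ≤ N := by
        have : (2 * i : ℝ) ≤ N := by linarith
        exact_mod_cast this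
      have hNi : ((N - i : ℕ) : ℝ) = N - i := by rw [Nat.cast_sub (by omega)]
      have hd := hdec T ξ w hm hE i N hNT h2i'
      rw [hNi] at hd
      set a := min t ((N : ℝ) - i - 1) with ha
      have ha1 : (i : ℝ) ≤ a := le_min (by linarith) (by linarith)
      have ha2 : a + 1 ≤ N - i := by linarith [min_le_right t ((N : ℝ) - i - 1)]
      have hi0 : (0 : ℝ) ≤ i := Nat.cast_nonneg i
      have hat : t ∈ Icc a (a + 1) := by
        refine ⟨min_le_left _ _, ?_⟩
        rcases min_choice t ((N : ℝ) - i - 1) with h2 | h2 <;> rw [ha, h2]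
        · linarith
        · linarith
      have h3 := (hs.mono (hi0.trans ha1) (by linarith)).sq_norm_le_of_unit hat
      have h4 : ∫ s in a..(a + 1), sqNorm (ξ s, w s) ≤
          ∫ s in (i : ℝ)..(N - i), sqNorm (ξ s, w s) :=
        integral_mono_subinterval (hs.mono hi0 (by linarith)).integrableOn_sqNorm
          (fun _ => sqNorm_nonneg _) ha1 (by linarith) ha2
      have h5 : r ^ i ≤ Real.exp (4 * lam + -2 * lam * μ) := by
        rw [hrexp]
        gcongr
        nlinarith
      have hE' := Real.exp_pos (4 * lam + -2 * lam * μ)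
      calc ‖ξ t‖ ^ 2 ≤ K * (D * r ^ i) := h3.trans (by gcongr; exact h4.trans hd)
        _ ≤ K * (D * Real.exp (4 * lam + -2 * lam * μ)) := by gcongr
        _ = K * D * Real.exp (4 * lam + -2 * lam * μ) := by ring
        _ ≤ _ := by
          gcongr
          have : 0 ≤ K * (‖x₀‖ ^ 2 + E₀) := by positivity
          linarith
  have h6 : ‖ξ t‖ ≤ √Z * Real.exp (-lam * μ) := by
    refine (sq_le_sq₀ (norm_nonneg _) (by positivity)).1 (key.trans_eq ?_)
    rw [mul_pow, Real.sq_sqrt hZ0.le, ← Real.exp_nat_mul]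
    congr 2
    push_cast
    ring
  refine h6.trans ?_
  gcongr
  rcases min_choice t (T - t) with h7 | h7 <;> rw [hμ, h7]
  · linarith [Real.exp_pos (-lam * (T - t))]
  · linarith [Real.exp_pos (-lam * t)]

end Estimate

/-! ### Extended-valued cost and passage to deviations -/

section Cost

variable {n m : ℕ}

theorem cost_eq_integral {f : E n × E m → ℝ} {T : ℝ} (hT : 0 ≤ T) {X : ℝ → E n} {u : ℝ → E m}
    (hi : IntegrableOn (fun t => f (X t, u t)) (Icc 0 T)) :
    cost f T X u = ((∫ t in (0 : ℝ)..T, f (X t, u t) : ℝ) : EReal) := by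
  have h1 : ∫⁻ t in Icc 0 T, ENNReal.ofReal (f (X t, u t)) ≠ ⊤ := hi.lintegral_lt_top.ne
  have h2 : ∫⁻ t in Icc 0 T, ENNReal.ofReal (-f (X t, u t)) ≠ ⊤ := hi.neg.lintegral_lt_top.ne
  rw [intervalIntegral.integral_of_le hT, ← integral_Icc_eq_integral_Ioc,
    integral_eq_lintegral_pos_part_sub_lintegral_neg_part hi, EReal.coe_sub, cost,
    ← EReal.toReal_coe_ennreal, ← EReal.toReal_coe_ennreal, EReal.coe_toReal, EReal.coe_toReal]
  all_goals simp [h1, h2]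

/-- The negative part has finite integral, being at most `M` on a bounded interval, so failure of
integrability comes from the positive part. -/
theorem cost_eq_top {f : E n × E m → ℝ} {T M : ℝ} {X : ℝ → E n} {u : ℝ → E m}
    (hM : ∀ p, -M ≤ f p)
    (hm : AEStronglyMeasurable (fun t => f (X t, u t)) (volume.restrict (Icc 0 T)))
    (hi : ¬IntegrableOn (fun t => f (X t, u t)) (Icc 0 T)) : cost f T X u = ⊤ := by
  have h2 : ∫⁻ t in Icc 0 T, ENNReal.ofReal (-f (X t, u t)) ≠ ⊤ := by
    refine ne_top_of_le_ne_top ?_ (lintegral_mono fun t =>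
      ENNReal.ofReal_le_ofReal (neg_le.1 (hM (X t, u t))))
    rw [lintegral_const]
    exact ENNReal.mul_ne_top ENNReal.ofReal_ne_top (by simp)
  have h1 : ∫⁻ t in Icc 0 T, ENNReal.ofReal (f (X t, u t)) = ⊤ := by
    by_contra h1
    refine hi ⟨hm, ?_⟩
    rw [hasFiniteIntegral_iff_norm]
    have h3 : ∀ t, ENNReal.ofReal ‖f (X t, u t)‖ ≤
        ENNReal.ofReal (f (X t, u t)) + ENNReal.ofReal (-f (X t, u t)) := fun t => by
      rcases le_total 0 (f (X t, u t)) with h | h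
      · rw [Real.norm_of_nonneg h]; exact le_self_add
      · rw [Real.norm_of_nonpos h]; exact le_add_self
    refine (lintegral_mono h3).trans_lt ?_
    rw [lintegral_add_left' hm.aemeasurable.ennreal_ofReal]
    exact ENNReal.add_lt_top.2 ⟨lt_top_iff_ne_top.2 h1, lt_top_iff_ne_top.2 h2⟩
  rw [cost, h1, EReal.coe_ennreal_top, EReal.top_sub]
  simpa using h2

end Cost

section Transfer

variable {n m : ℕ} {A : Matrix (Fin n) (Fin n) ℝ} {B : Matrix (Fin n) (Fin m) ℝ} {b : E n}
  {f : E n × E m → ℝ} {x : E n} {p : E n × E m} {T : ℝ} {X : ℝ → E n} {u : ℝ → E m}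

/-- The continuous linear map given by a matrix. -/
noncomputable abbrev linC {p q : ℕ} (M : Matrix (Fin p) (Fin q) ℝ) : E q →L[ℝ] E p :=
  LinearMap.toContinuousLinearMap (lin M)

theorem isAdmissible_iff (hT : 0 ≤ T) (hp : lin A p.1 + lin B p.2 + b = 0) :
    IsAdmissible A B b T x X u ↔
      IsSol (linC A) (linC B) 0 T (fun t => X t - p.1) (fun t => u t - p.2) ∧
        X 0 - p.1 = x - p.1 := by
  have e : ∀ s, linC A (X s - p.1) + linC B (u s - p.2) = lin A (X s) + lin B (u s) + b :=
    fun s => by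
      have : b = -(lin A p.1 + lin B p.2) := by rw [eq_neg_iff_add_eq_zero, add_comm]; exact hp
      simp only [LinearMap.coe_toContinuousLinearMap', map_sub]
      rw [this]
      abel
  have hc : MemLp (fun _ : ℝ => p.2) 2 (volume.restrict (Icc 0 T)) := memLp_const _
  constructor
  · rintro ⟨h1, h2, h3⟩
    have h0 : X 0 = x := by simpa using h3 0 ⟨le_rfl, hT⟩
    refine ⟨⟨h1.sub hc, h2.sub continuousOn_const, fun t ht => ?_⟩, by rw [h0]⟩
    simp only [e]
    rw [h3 t ht, h0]
    abel
  · rintro ⟨⟨h1, h2, h3⟩, h0⟩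
    refine ⟨(memLp_congr_ae (Filter.Eventually.of_forall fun t => by simp)).1 (h1.add hc),
      (h2.add (continuousOn_const (c := p.1))).congr fun t _ => by simp, fun t ht => ?_⟩
    have := h3 t ht
    simp only [e] at this
    rw [h0] at this
    rw [← sub_add_cancel (X t) p.1, this]
    abel

/-- Optimal pairs correspond to minimizers of the cost of the deviation from a steady pair. -/
theorem isOptimalPair_iff (hT : 0 ≤ T) (hp : lin A p.1 + lin B p.2 + b = 0) {M : ℝ}
    (hf : Continuous f) (hM : ∀ q, -M ≤ f q) {ξ₀ : ℝ → E n} {w₀ : ℝ → E m}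
    (hmin : IsMin (linC A) (linC B) (fun z => f (p + z)) T (x - p.1) ξ₀ w₀) :
    IsOptimalPair A B b f T x X u ↔ IsMin (linC A) (linC B) (fun z => f (p + z)) T (x - p.1)
      (fun t => X t - p.1) (fun t => u t - p.2) := by
  have e : ∀ (X : ℝ → E n) (u : ℝ → E m) t, f (p + (X t - p.1, u t - p.2)) = f (X t, u t) :=
    fun X u t => by congr 1; ext1 <;> simp
  have hadm : ∀ (X : ℝ → E n) (u : ℝ → E m),
      IsAdm (linC A) (linC B) (fun z => f (p + z)) T (x - p.1) (fun t => X t - p.1)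
        (fun t => u t - p.2) ↔
      IsAdmissible A B b T x X u ∧ IntegrableOn (fun t => f (X t, u t)) (Icc 0 T) := by
    intro X u
    rw [isAdmissible_iff hT hp]
    constructor
    · rintro ⟨h1, h2, h3⟩
      simp only [e] at h3
      exact ⟨⟨h1, h2⟩, h3⟩
    · rintro ⟨⟨h1, h2⟩, h3⟩
      refine ⟨h1, h2, ?_⟩
      simp only [e]
      exact h3
  have htop : ∀ (X : ℝ → E n) (u : ℝ → E m), IsAdmissible A B b T x X u →
      ¬IntegrableOn (fun t => f (X t, u t)) (Icc 0 T) → cost f T X u = ⊤ := fun X u h hi =>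
    cost_eq_top hM (hf.comp_aestronglyMeasurable
      ((memLp_Icc_of_continuousOn h.2.1 2).1.prodMk h.1.1)) hi
  have hlow : ∀ (X : ℝ → E n) (u : ℝ → E m), IsMin (linC A) (linC B) (fun z => f (p + z)) T
      (x - p.1) (fun t => X t - p.1) (fun t => u t - p.2) →
      cost f T X u = value A B b f T x := by
    intro X u h
    have hX := (hadm X u).1 h.1
    have hleast : IsLeast {r | ∃ X u, IsAdmissible A B b T x X u ∧ cost f T X u = r}
        (cost f T X u) := by
      refine ⟨⟨X, u, hX.1, rfl⟩, ?_⟩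
      rintro _ ⟨X', u', h', rfl⟩
      by_cases hi : IntegrableOn (fun t => f (X' t, u' t)) (Icc 0 T)
      · have := h.2 _ _ ((hadm X' u').2 ⟨h', hi⟩)
        simp only [e] at this
        rw [cost_eq_integral hT hX.2, cost_eq_integral hT hi]
        exact EReal.coe_le_coe_iff.2 this
      · rw [htop X' u' h' hi]; exact le_top
    exact hleast.csInf_eq.symm
  constructor
  · rintro ⟨h1, h2⟩
    have e0 : ∀ t, ξ₀ t = (fun t => ξ₀ t + p.1) t - p.1 := fun t => by simp
    have e1 : ∀ t, w₀ t = (fun t => w₀ t + p.2) t - p.2 := fun t => by simp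
    rw [show ξ₀ = fun t => (fun t => ξ₀ t + p.1) t - p.1 from funext e0,
      show w₀ = fun t => (fun t => w₀ t + p.2) t - p.2 from funext e1] at hmin
    set X₀ : ℝ → E n := fun t => ξ₀ t + p.1
    set u₀ : ℝ → E m := fun t => w₀ t + p.2
    have h3 := hlow X₀ u₀ hmin
    have h4 := (hadm X₀ u₀).1 hmin.1
    rw [cost_eq_integral hT h4.2, ← h2] at h3
    -- The given minimizer shows that the value is finite, which excludes an optimal pair of
    -- infinite cost.
    have hi : IntegrableOn (fun t => f (X t, u t)) (Icc 0 T) := by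
      by_contra hi
      rw [htop X u h1 hi] at h3
      exact EReal.coe_ne_top _ h3
    rw [cost_eq_integral hT hi, EReal.coe_eq_coe_iff] at h3
    refine ⟨(hadm X u).2 ⟨h1, hi⟩, fun ξ' w' h' => ?_⟩
    refine le_trans (le_of_eq ?_) (hmin.2 ξ' w' h')
    simp only [e]
    exact h3.symm
  · intro h
    exact ⟨((hadm X u).1 h.1).1, hlow X u h⟩

end Transfer

/-! ### Application to the matrix system -/

section Final

variable {n m l : ℕ} {A : Matrix (Fin n) (Fin n) ℝ} {B : Matrix (Fin n) (Fin m) ℝ}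

theorem linC_pow_apply (j : ℕ) (u : E m) : ((linC A) ^ j) (linC B u) = lin (A ^ j * B) u := by
  induction j with
  | zero => simp
  | succ j ih =>
    rw [pow_succ', pow_succ', Matrix.mul_assoc, lin_mul_apply, ← ih]
    rfl

theorem hasConnections (v : OrthonormalBasis (Fin l) ℝ ↥(controllable A B)ᗮ) {y : ℝ → E l}
    (hy : ∀ t, HasDerivAt y (lin (block A (colMatrix v)) (y t)) t) {C q : ℝ} (hq0 : 0 < q)
    (hq1 : q < 1) (hyC : ∀ k : ℕ, ‖y k‖ ^ 2 ≤ C * q ^ k) :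
    HasConnections (linC A) (linC B) (linC (colMatrix v).transpose) y q := by
  obtain ⟨κ, hκ, hst⟩ := exists_steering (A := linC A) (B := linC B)
    (π := linC (colMatrix v).transpose) (M := linC (block A (colMatrix v)))
    (colMatrix_transpose_lin v) (colMatrix_transpose_range v) fun p hp z hz =>
      inner_eq_zero_of_unobservable v (fun j u => by rw [← linC_pow_apply]; exact hp j u) hz
  exact fun R hR => exists_connecting_solution hκ (hst y hy)
    (ι := linC (colMatrix v)) (colMatrix_transpose_colMatrix v) hq0 hq1 hyC R hR

/-- Here `g` is the first-order Taylor remainder of `f` at `p`: strong convexity bounds it below,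
compactness of balls above, and the multipliers rewrite the linear term. -/
theorem IsStaticSolution.exists_isRotatedCost {b : E n} {f : E n × E m → ℝ} {c : E l} {x : E n}
    {P : Matrix (Fin n) (Fin l) ℝ} {hx : x ∈ feasible A P c} {δ : ℝ} (hf : ContDiff ℝ 2 f)
    (hδ0 : 0 < δ) (hδ : ∀ p h, δ * sqNorm h ≤ fderiv ℝ (fderiv ℝ f) p h h) {p : E n × E m}
    (hp : IsStaticSolution A B b f P c x hx p) :
    ∃ (g : E n × E m → ℝ) (η : E n →L[ℝ] ℝ) (ν : E l →L[ℝ] ℝ),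
      IsRotatedCost (linC A) (linC B) (linC P.transpose) (fun z => f (p + z)) g (f p) η ν
        (δ / 2) := by
  obtain ⟨η, ν, hην⟩ := hp.exists_multipliers hf
  refine ⟨fun z => f (p + z) - f p - fderiv ℝ f p z, η, ν, fun z => ?_, ?_, by positivity,
    fun z => ?_, fun R => ?_⟩
  · rw [hην]
    simp only [LinearMap.coe_toContinuousLinearMap']
    ring
  · have := hf.continuous
    fun_prop
  · linarith [strongConvex_lower hf hδ p z]
  · obtain ⟨C, hC, h⟩ := exists_quadratic_upper_bound hf p R
    refine ⟨C, hC, fun z h1 h2 => (h z (max_le h1 h2)).trans ?_⟩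
    gcongr
    exact sq_norm_le_sqNorm z

end Final

end Turnpike

/-! ### The turnpike theorem -/

open Turnpike in
theorem mainTheorem1 {n m l : ℕ}
    (A : Matrix (Fin n) (Fin n) ℝ) (B : Matrix (Fin n) (Fin m) ℝ) (b : E n)
    (f : E n × E m → ℝ)
    (hA1 : b ∈ LinearMap.range (lin A) ⊔ LinearMap.range (lin B))
    (hA2 : IsC2StronglyConvex f)
    (v : OrthonormalBasis (Fin l) ℝ ↥(controllable A B)ᗮ)
    (c : E l) (hc : lin (block A (colMatrix v)) c = lin (colMatrix v).transpose b)
    (x : E n) (hx : x ∈ feasible A (colMatrix v) c) :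
    ∃ p : E n × E m,
      (IsStaticSolution A B b f (colMatrix v) c x hx p ∧
        ∀ q, IsStaticSolution A B b f (colMatrix v) c x hx q → q = p) ∧
      ∃ K : ℝ, 0 < K ∧ ∃ lam : ℝ, 0 < lam ∧ ∀ T : ℝ, 0 < T →
        ∃ (X : ℝ → E n) (u : ℝ → E m),
          IsOptimalPair A B b f T x X u ∧
          (∀ X' u', IsOptimalPair A B b f T x X' u' →
            Set.EqOn X' X (Set.Icc 0 T) ∧
              u' =ᵐ[MeasureTheory.volume.restrict (Set.Icc 0 T)] u) ∧
          ∀ t ∈ Set.Icc (0 : ℝ) T,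
            ‖X t - p.1‖ ≤ K * (Real.exp (-lam * t) + Real.exp (-lam * (T - t))) := by
  obtain ⟨hf, δ, hδ0, hδ⟩ := hA2
  obtain ⟨p, hp⟩ := exists_isStaticSolution hx hf hδ0 hδ (steadySet_nonempty v hc hx)
  refine ⟨p, ⟨hp, fun q hq => hp.unique hf hδ0 hδ hq⟩, ?_⟩
  obtain ⟨M₀, -, hcoer⟩ := strongConvex_coercive hf hδ0 hδ
  have hM₀ : ∀ q, -M₀ ≤ f q := fun q => by
    have : 0 ≤ δ / 4 * sqNorm q := mul_nonneg (by positivity) (sqNorm_nonneg q)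
    linarith [hcoer q]
  have hmid : ∀ q r : E n × E m, f (p + (1 / 2 : ℝ) • (q + r)) + δ / 8 * sqNorm (q - r) ≤
      (f (p + q) + f (p + r)) / 2 := fun q r => by
    have := strongConvex_midpoint hf hδ (p + q) (p + r)
    rwa [add_sub_add_left_eq_sub, show (1 / 2 : ℝ) • (p + q + (p + r)) =
      p + (1 / 2 : ℝ) • (q + r) by module] at this
  have hcont : Continuous fun z => f (p + z) := hf.continuous.comp (continuous_const.add continuous_id)
  -- The second static constraint identifies `P₂ᵀ x* + c` with the `𝒢₂` component of `P₂ᵀ x + c`;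
  -- their difference is the `𝒢₁` component.
  have hG : lin (colMatrix v).transpose (x - p.1) ∈ G₁ (block A (colMatrix v)) := by
    have h1 := sub_Q₂_mem_G₁ _ ⟨lin (colMatrix v).transpose x + c, hx⟩
    rw [← hp.1.2] at h1
    rwa [map_sub, ← add_sub_add_right_eq_sub _ _ c]
  obtain ⟨y, hy, hy0, C, α, hα, hC, hyb⟩ := exists_decaying_solution _ hG
  -- The decay factor of `|y|²` over one unit of time.
  set q := Real.exp (-α) ^ 2 with hq
  have hq0 : 0 < q := by positivity
  have hq1 : q < 1 := pow_lt_one₀ (Real.exp_pos _).le (by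
    rw [← Real.exp_zero]; exact Real.exp_lt_exp.2 (by linarith)) two_ne_zero
  have hyC : ∀ k : ℕ, ‖y k‖ ^ 2 ≤ C ^ 2 * q ^ k := fun k => by
    have h1 := hyb k (Nat.cast_nonneg k)
    rw [mul_comm (-α) (k : ℝ), Real.exp_nat_mul] at h1
    calc ‖y k‖ ^ 2 ≤ (C * Real.exp (-α) ^ k) ^ 2 := by gcongr
      _ = _ := by rw [hq]; ring
  obtain ⟨g, η, ν, hr⟩ := hp.exists_isRotatedCost hf hδ0 hδ
  have hend : ∀ k : ℕ, ∃ x', linC (colMatrix v).transpose x' = y k ∧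
      ‖x'‖ ≤ ‖x - p.1‖ + ‖linC (colMatrix v)‖ * C := fun k => by
    refine ⟨linC (colMatrix v) (y k), colMatrix_transpose_colMatrix v _, ?_⟩
    have h1 : ‖y k‖ ≤ C := (hyb k (Nat.cast_nonneg k)).trans
      (mul_le_of_le_one_right hC (Real.exp_le_one_iff.2 (by
        have : (0 : ℝ) ≤ k := Nat.cast_nonneg k
        nlinarith)))
    have h2 := ((linC (colMatrix v)).le_opNorm (y k)).trans
      (mul_le_mul_of_nonneg_left h1 (norm_nonneg _))
    linarith [norm_nonneg (x - p.1)]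
  obtain ⟨K, lam, hK, hlam, hturn⟩ := hr.exists_turnpike (M := linC (block A (colMatrix v)))
    (colMatrix_transpose_lin v) (colMatrix_transpose_range v) hy hy0.symm
    (hasConnections v hy hq0 hq1 hyC) hq0 hq1
    (R := ‖x - p.1‖ + ‖linC (colMatrix v)‖ * C) (by positivity)
    (le_add_of_nonneg_right (by positivity)) hend
  refine ⟨K, hK, lam, hlam, fun T hT => ?_⟩
  obtain ⟨hne, hest⟩ := hturn T hT
  obtain ⟨ξ, w, hmin⟩ := exists_isMin hT.le hcont (fun z => hM₀ (p + z))
    (by positivity : 0 < δ / 8) hmid hne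
  have hiff := fun X u => isOptimalPair_iff (X := X) (u := u) hT.le hp.1.1 hf.continuous hM₀ hmin
  refine ⟨fun t => ξ t + p.1, fun t => w t + p.2, ?_, fun X' u' h' => ?_, fun t ht => ?_⟩
  · rw [hiff]
    simpa using hmin
  · rw [hiff] at h'
    obtain ⟨h1, h2⟩ := hmin.unique hT.le hcont (fun z => hM₀ (p + z))
      (by positivity : 0 < δ / 8) hmid h'
    refine ⟨fun t ht => sub_eq_iff_eq_add.1 (h1 ht), ?_⟩
    filter_upwards [h2] with t ht using sub_eq_iff_eq_add.1 ht
  · simpa using hest ξ w hmin t ht
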